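/- A \emph{table} is a compact convex set $T\subset\mathbb{R}^2$ with non-empty interior; it is \emph{polygonal} if it is the convex hull of finitely many points. A \emph{generalised closed billiard orbit} on $T$ is a periodic sequence $(q_i)_{i\in\mathbb{Z}}$ (of period at least $2$) of points of $\partial T$ with $q_i\neq q_{i+1}$ such that for every $i$ the vector $$\nu_i=\frac{q_i-q_{i-1}}{\|q_i-q_{i-1}\|}+\frac{q_i-q_{i+1}}{\|q_i-q_{i+1}\|}$$ satisfies $\langle x-q_i,\nu_i\rangle\le 0$ for all $x\in T$. Its length is $\sum_{i=0}^{n-1}\|q_{i+1}-q_i\|$ with $n$ its smallest period, and its trace is $\bigcup_i[q_i,q_{i+1}]$. Let $\mathcal{P}_{\min}(T)$ be the set of those orbits on $T$ that have minimal length, and $\ell(T)$ this minimal length. Orbits are identified through their traces: orbits $c_n$ are said to converge to $c$ if their traces converge to the trace of $c$ in the Hausdorff distance. For $\varepsilon>0$, a polygonal table $S$ is called an $\varepsilon$-\emph{approximation of $T$ with centre $p$} if $S\subset T\subset p+(1+\varepsilon)(S-p)$. There is a single algorithm (a program over the real numbers that uses exact $+,-,\times,/$, square roots, comparisons and the constant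 $1$) such that the following holds for every table $T$. 1. The minimum defining $\ell(T)$ is attained. 2. For every $p$ in the interior of $T$ and every $\varepsilon>0$ there exists an $\varepsilon$-approximation $T_\varepsilon$ of $T$ with centre $p$. 3. For every $\varepsilon>0$ and every $\varepsilon$-approximation $T_\varepsilon$ of $T$ (with any centre), the number $\ell_\varepsilon(T):=(1+\varepsilon)\,\ell(T_\varepsilon)$ satisfies $$\ell(T)\le\ell_\varepsilon(T)\le(1+\varepsilon)\,\ell(T),$$ and the algorithm, given $\varepsilon$ and the coordinates of finitely many points with convex hull $T_\varepsilon$ (for instance its vertices), halts after finitely many steps with output $\ell_\varepsilon(T)$. 4. Let $\varepsilon_n>0$ with $\varepsilon_n\to0$, let $T_n$ be $\varepsilon_n$-approximations of $T$ (with any centres), and let $c_n\in\mathcal{P}_{\min}(T_n)$. Then a subsequence of $(c_n)$ converges to some $c\in\mathcal{P}_{\min}(T)$. Moreover, if the traces of the $c_n$ converge in the Hausdorff distance to a compact set $K$, then $K$ is the trace of some $c\in\mathcal{P}_{\min}(T)$. 5. For every $c\in\mathcal{P}_{\min}(T)$, every $p$ in the interior of $T$ and every sequence $\varepsilon_n>0$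 with $\varepsilon_n\to0$ there are $\varepsilon_n$-approximations $T_n$ of $T$ with centre $p$ and orbits $c_n\in\mathcal{P}_{\min}(T_n)$ that converge to $c$. -/

import Mathlib

open Set Filter Topology

namespace Billiard

/-! ## Billiard tables -/

/-- The Euclidean plane. -/
abbrev Plane := EuclideanSpace ℝ (Fin 2)

/-- A planar convex billiard table: a compact convex set with non-empty interior. -/
structure IsTable (T : Set Plane) : Prop where
  convex : Convex ℝ T
  isCompact : IsCompact T
  interior_nonempty : (interior T).Nonempty

/-- A polygonal convex billiard table: a table that is the convex hull of finitely many points. -/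
structure IsPolygonalTable (S : Set Plane) : Prop where
  isTable : IsTable S
  finite_hull : ∃ F : Finset Plane, S = convexHull ℝ (F : Set Plane)

/-! ## Generalised closed billiard orbits -/

/-- `ν` is an outward support vector of `T` at `q`. -/
def IsOutwardSupport (T : Set Plane) (q ν : Plane) : Prop :=
  ∀ x ∈ T, inner ℝ (x - q) ν ≤ 0

/-- The vector `ν_i = (q_i - q_{i-1}) / ‖q_i - q_{i-1}‖ + (q_i - q_{i+1}) / ‖q_i - q_{i+1}‖`. -/
noncomputable def bounceVector (q : ℤ → Plane) (i : ℤ) : Plane :=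
  ‖q i - q (i - 1)‖⁻¹ • (q i - q (i - 1)) + ‖q i - q (i + 1)‖⁻¹ • (q i - q (i + 1))

/-- A generalised billiard orbit on `T`. Consecutive bounce points are distinct, as is implicit
in the quotients that define `bounceVector`. -/
structure IsOrbit (T : Set Plane) (q : ℤ → Plane) : Prop where
  mem_frontier : ∀ i, q i ∈ frontier T
  ne_succ : ∀ i, q i ≠ q (i + 1)
  support : ∀ i, IsOutwardSupport T (q i) (bounceVector q i)

/-- The set of all `n ≥ 2` with `q_{i+n} = q_i` for all `i`. -/
def periods (q : ℤ → Plane) : Set ℕ := {n | 2 ≤ n ∧ ∀ i : ℤ, q (i + n) = q i}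

/-- The generalised closed billiard orbits on `T`. -/
def closedOrbits (T : Set Plane) : Set (ℤ → Plane) := {q | IsOrbit T q ∧ (periods q).Nonempty}

/-- The (smallest) period of a closed orbit, i.e. its number of bounces. -/
noncomputable def period (q : ℤ → Plane) : ℕ := sInf (periods q)

/-- The length of a closed orbit. -/
noncomputable def orbitLength (q : ℤ → Plane) : ℝ :=
  ∑ i ∈ Finset.range (period q), ‖q ((i : ℤ) + 1) - q (i : ℤ)‖

/-- The generalised closed billiard orbits on `T` of minimal length. -/
def shortestOrbits (T : Set Plane) : Set (ℤ → Plane) :=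
  {q | q ∈ closedOrbits T ∧ ∀ q' ∈ closedOrbits T, orbitLength q ≤ orbitLength q'}

/-- `ℓ(T)`, the minimal length of a generalised closed billiard orbit on `T`. -/
noncomputable def minLength (T : Set Plane) : ℝ := sInf (orbitLength '' closedOrbits T)

/-- The trace of an orbit: the polygonal curve through its bounce points, as a set. -/
def trace (q : ℤ → Plane) : Set Plane := ⋃ i : ℤ, segment ℝ (q i) (q (i + 1))

/-- The traces of the orbits `c n` converge to the set `K` in the Hausdorff distance. -/
def TracesConvergeTo (c : ℕ → ℤ → Plane) (K : Set Plane) : Prop :=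
  Tendsto (fun n => Metric.hausdorffEDist (trace (c n)) K) atTop (𝓝 0)

/-! ## Polygonal approximation -/

/-- `S` is a polygonal table with `S ⊆ T ⊆ (1 + ε) S`, the dilation by the factor `1 + ε` being
taken with respect to the centre `p`. -/
structure IsApprox (p : Plane) (ε : ℝ) (S T : Set Plane) : Prop where
  polygonal : IsPolygonalTable S
  subset : S ⊆ T
  subset_dilation : T ⊆ AffineMap.homothety p (1 + ε) '' S

/-! ## Algorithms over the real numbers

Programs of a small while-language on finite binary trees whose leaves are empty or carry a real
number. As for the real RAM and the Blum-Shub-Smale machine with square roots, the elementary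
operations are exact arithmetic, square roots and comparisons of real numbers; the only real
constant a program can use is `1`. -/

/-- Finite binary trees with empty leaves and real leaves. -/
inductive Data : Type
  | nil : Data
  | num : ℝ → Data
  | pair : Data → Data → Data

/-- Programs. Each program transforms one datum into one datum. -/
inductive Prog : Type
  /-- return the input -/
  | id : Prog
  /-- return the empty leaf -/
  | nil : Prog
  /-- return the number one -/
  | one : Prog
  /-- return the left subtree -/
  | fst : Prog
  /-- return the right subtree -/
  | snd : Prog
  /-- run two programs on the input and pair the results -/
  | pair : Prog → Prog → Prog
  /-- `comp g f` runs `f`, and then `g` on the result -/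
  | comp : Prog → Prog → Prog
  | add : Prog
  | sub : Prog
  | mul : Prog
  | div : Prog
  | sqrt : Prog
  /-- `ifLe s t f g` runs `f` if the number returned by `s` is at most the number returned by `t`,
  and `g` otherwise -/
  | ifLe : Prog → Prog → Prog → Prog → Prog
  /-- `ifNil s f g` runs `f` if `s` returns the empty leaf, and `g` if `s` returns a pair -/
  | ifNil : Prog → Prog → Prog → Prog
  /-- `loop s f` replaces the datum by its image under `f` as long as `s` returns a pair, and ends
  as soon as `s` returns the empty leaf -/
  | loop : Prog → Prog → Prog

/-- `Runs P x y t`: the program `P`, started on the datum `x`, halts after `t` elementary steps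
with the datum `y` as output. There is no rule for an undefined operation (such as a division by
zero or the square root of a negative number): a program that attempts one has no output. -/
inductive Runs : Prog → Data → Data → ℕ → Prop
  | id (x : Data) : Runs Prog.id x x 1
  | nil (x : Data) : Runs Prog.nil x Data.nil 1
  | one (x : Data) : Runs Prog.one x (Data.num 1) 1
  | fst (x y : Data) : Runs Prog.fst (Data.pair x y) x 1
  | snd (x y : Data) : Runs Prog.snd (Data.pair x y) y 1
  | pair {f g : Prog} {x y z : Data} {m n : ℕ} : Runs f x y m → Runs g x z n →
      Runs (Prog.pair f g) x (Data.pair y z) (m + n + 1)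
  | comp {f g : Prog} {x y z : Data} {m n : ℕ} : Runs f x y m → Runs g y z n →
      Runs (Prog.comp g f) x z (m + n + 1)
  | add (a b : ℝ) : Runs Prog.add (Data.pair (Data.num a) (Data.num b)) (Data.num (a + b)) 1
  | sub (a b : ℝ) : Runs Prog.sub (Data.pair (Data.num a) (Data.num b)) (Data.num (a - b)) 1
  | mul (a b : ℝ) : Runs Prog.mul (Data.pair (Data.num a) (Data.num b)) (Data.num (a * b)) 1
  | div (a b : ℝ) : b ≠ 0 →
      Runs Prog.div (Data.pair (Data.num a) (Data.num b)) (Data.num (a / b)) 1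
  | sqrt (a : ℝ) : 0 ≤ a → Runs Prog.sqrt (Data.num a) (Data.num (Real.sqrt a)) 1
  | ifLe_pos {s t f g : Prog} {x y : Data} {a b : ℝ} {k l m : ℕ} :
      Runs s x (Data.num a) k → Runs t x (Data.num b) l → a ≤ b → Runs f x y m →
      Runs (Prog.ifLe s t f g) x y (k + l + m + 1)
  | ifLe_neg {s t f g : Prog} {x y : Data} {a b : ℝ} {k l m : ℕ} :
      Runs s x (Data.num a) k → Runs t x (Data.num b) l → b < a → Runs g x y m →
      Runs (Prog.ifLe s t f g) x y (k + l + m + 1)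
  | ifNil_nil {s f g : Prog} {x y : Data} {k m : ℕ} :
      Runs s x Data.nil k → Runs f x y m → Runs (Prog.ifNil s f g) x y (k + m + 1)
  | ifNil_pair {s f g : Prog} {x y u v : Data} {k m : ℕ} :
      Runs s x (Data.pair u v) k → Runs g x y m → Runs (Prog.ifNil s f g) x y (k + m + 1)
  | loop_nil {s f : Prog} {x : Data} {k : ℕ} :
      Runs s x Data.nil k → Runs (Prog.loop s f) x x (k + 1)
  | loop_pair {s f : Prog} {x y z u v : Data} {k m n : ℕ} :
      Runs s x (Data.pair u v) k → Runs f x y m → Runs (Prog.loop s f) y z n →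
      Runs (Prog.loop s f) x z (k + m + n + 1)

/-- A list of points of the plane, given by their coordinates, as a datum. -/
def encodePoints : List Plane → Data
  | [] => Data.nil
  | v :: L => Data.pair (Data.pair (Data.num (v 0)) (Data.num (v 1))) (encodePoints L)

/-- The input of an algorithm: a number and a list of points. -/
def encodeInput (ε : ℝ) (L : List Plane) : Data := Data.pair (Data.num ε) (encodePoints L)

end Billiard

open Billiard

namespace Billiard

/-! ## Closed polygons with three vertices that a table cannot escape -/

/-! Orbits on different tables are hard to compare, so they are replaced by caged triples: closed
polygons with three, possibly coinciding, vertices that no translation moves into the interior of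
the table, as certified by weights of sum zero. This is the principle of Bezdek and Bezdek: the
least length of a caged triple is `minLength T` (`minLength_eq`). In one direction, the bounce
vectors of a closed orbit sum to zero, and Carathéodory's theorem in the plane leaves at most three
balanced ones. Their bounce points form a pinned triple no longer than the orbit, with the same
trace if the lengths agree (`exists_pinned_of_mem_closedOrbits`). In the other direction, a shortest
caged triple has a translate in the table, since otherwise Hahn-Banach separation shows that a
smaller copy is still caged. At such a pinned triple the Lagrange condition for the length is the
reflection law, and degenerate triples become two-bounce orbits
(`IsShortestCaged.isDoubleNormal_or_isTriangleOrbit`).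

Being caged passes to smaller tables and is transported by dilations (`Caged.mono`, `Caged.dilate`),
which gives the two-sided estimate for the lengths. Pinned triples with weights of norm one range
over a compact set, and the support inequalities pass to limits (`exists_subseq_tracesConvergeTo`).
Conversely, an outer polygon of `T` is cut along the support lines of a given shortest pinned triple
and then contracted, so that the contracted triple is a shortest one of the contracted polygon
(`exists_isApprox_pinned`).

For the algorithm, three directions of equal norm with a balanced nonnegative combination bound
`minLength` from above by values of the support function (`minLength_le_of_directions`). If a bounce
vector of a shortest orbit of a polygon were orthogonal to no difference of two of the given points,
a slight turn of the directions would keep every support and improve this bound. So each bounce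
vector is orthogonal to such a difference, and for a triangle the three differences determine the
edge directions up to a common factor. Hence `minLength` is the least of finitely many explicit
upper bounds (`exists_value_eq_minLength`), and `lengthP` searches for it. -/

/-- The length of the closed polygon with vertices `p 0`, `p 1`, `p 2`. -/
noncomputable def loopLength (p : ZMod 3 → Plane) : ℝ := ∑ i, ‖p (i + 1) - p i‖

/-- The closed polygon with vertices `p 0`, `p 1`, `p 2`, as a set. -/
def loopTrace (p : ZMod 3 → Plane) : Set Plane := ⋃ i, segment ℝ (p i) (p (i + 1))

/-- The weights `n` certify that no translate of `p` lies in the interior of `T`. -/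
structure Caged (T : Set Plane) (p n : ZMod 3 → Plane) : Prop where
  ne_zero : n ≠ 0
  sum_eq : ∑ i, n i = 0
  le : ∀ x : ZMod 3 → Plane, (∀ i, x i ∈ T) →
    ∑ i, inner ℝ (x i) (n i) ≤ ∑ i, inner ℝ (p i) (n i)

/-- The points `p i` lie in `T` and `n` are balanced outward support vectors there. -/
structure Pinned (T : Set Plane) (p n : ZMod 3 → Plane) : Prop where
  ne_zero : n ≠ 0
  sum_eq : ∑ i, n i = 0
  mem : ∀ i, p i ∈ T
  support : ∀ i, IsOutwardSupport T (p i) (n i)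

/-- `p` is caged, and of minimal length among the caged triples. -/
def IsShortestCaged (T : Set Plane) (p : ZMod 3 → Plane) : Prop :=
  (∃ n, Caged T p n) ∧ ∀ p' n', Caged T p' n' → loopLength p ≤ loopLength p'

lemma sum_zmod_three {M : Type*} [AddCommMonoid M] (f : ZMod 3 → M) :
    ∑ i, f i = f 0 + f 1 + f 2 := Fin.sum_univ_three f

lemma sum_shift {M : Type*} [AddCommMonoid M] (f : ZMod 3 → M) (a : ZMod 3) :
    ∑ i, f (i + a) = ∑ i, f i := Equiv.sum_comp (Equiv.addRight a) f

lemma forall_zmod_three {P : ZMod 3 → Prop} : (∀ i, P i) ↔ P 0 ∧ P 1 ∧ P 2 := by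
  refine ⟨fun h => ⟨h 0, h 1, h 2⟩, fun ⟨h0, h1, h2⟩ i => ?_⟩
  fin_cases i
  exacts [h0, h1, h2]

lemma Pinned.caged {T : Set Plane} {p n : ZMod 3 → Plane} (h : Pinned T p n) : Caged T p n where
  ne_zero := h.ne_zero
  sum_eq := h.sum_eq
  le x hx := Finset.sum_le_sum fun i _ => by
    have := h.support i (x i) (hx i)
    rw [inner_sub_left] at this
    linarith

/-- A smaller table has fewer inequalities to satisfy. This is the source of the monotonicity of
`minLength`. -/
lemma Caged.mono {S T : Set Plane} (hST : S ⊆ T) {p n : ZMod 3 → Plane} (h : Caged T p n) :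
    Caged S p n :=
  ⟨h.ne_zero, h.sum_eq, fun x hx => h.le x fun i => hST (hx i)⟩

lemma sum_inner_smul_add {n : ZMod 3 → Plane} (hn : ∑ i, n i = 0) (r : ℝ) (w : Plane)
    (x : ZMod 3 → Plane) :
    ∑ i, inner ℝ (r • x i + w) (n i) = r * ∑ i, inner ℝ (x i) (n i) := by
  simp only [inner_add_left, inner_smul_left, Finset.sum_add_distrib, ← inner_sum, hn,
    inner_zero_right, add_zero, Finset.mul_sum]
  rfl

/-- The weights sum to zero, so the translation `w` drops out of both sides. This is why the centre
of an approximation does not affect the length estimate. -/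
lemma Caged.dilate {S T : Set Plane} {r : ℝ} (hr : 0 ≤ r) {w : Plane}
    (hT : ∀ x ∈ T, ∃ s ∈ S, x = r • s + w) {p n : ZMod 3 → Plane} (h : Caged S p n) :
    Caged T (fun i => r • p i + w) n where
  ne_zero := h.ne_zero
  sum_eq := h.sum_eq
  le x hx := by
    choose s hs hxs using fun i => hT (x i) (hx i)
    simp only [hxs, sum_inner_smul_add h.sum_eq]
    exact mul_le_mul_of_nonneg_left (h.le s hs) hr

lemma loopLength_smul_add {r : ℝ} (hr : 0 ≤ r) (w : Plane) (p : ZMod 3 → Plane) :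
    loopLength (fun i => r • p i + w) = r * loopLength p := by
  simp only [loopLength, add_sub_add_right_eq_sub, ← smul_sub, norm_smul, Real.norm_of_nonneg hr,
    Finset.mul_sum]

lemma loopLength_nonneg (p : ZMod 3 → Plane) : 0 ≤ loopLength p :=
  Finset.sum_nonneg fun _ _ => norm_nonneg _

lemma continuous_loopLength : Continuous loopLength := by
  unfold loopLength
  fun_prop

lemma norm_sub_le_loopLength (p : ZMod 3 → Plane) (i j : ZMod 3) :
    ‖p i - p j‖ ≤ loopLength p := by
  have h0 := norm_nonneg (p 1 - p 0)
  have h1 := norm_nonneg (p 2 - p 1)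
  have h2 := norm_nonneg (p 0 - p 2)
  have e : loopLength p = ‖p 1 - p 0‖ + ‖p 2 - p 1‖ + ‖p 0 - p 2‖ := by
    rw [loopLength, sum_zmod_three]; rfl
  rw [e]
  revert i j
  simp only [forall_zmod_three, sub_self, norm_zero]
  rw [norm_sub_rev (p 0) (p 1), norm_sub_rev (p 1) (p 2), norm_sub_rev (p 2) (p 0)]
  refine ⟨⟨?_, ?_, ?_⟩, ⟨?_, ?_, ?_⟩, ⟨?_, ?_, ?_⟩⟩ <;> linarith

lemma sum_norm_sq_pos {n : ZMod 3 → Plane} (hn : n ≠ 0) : 0 < ∑ i, inner ℝ (n i) (n i) := by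
  obtain ⟨i, hi⟩ := Function.ne_iff.1 hn
  exact Finset.sum_pos' (fun _ _ => real_inner_self_nonneg)
    ⟨i, Finset.mem_univ _, real_inner_self_pos.2 hi⟩

/-- Around an interior point `x` there is room for the triple `t • n i + x` with a small `t > 0`,
and its pairing with `n` is `t` times the sum of the squared norms of the `n i`. -/
lemma Caged.sum_inner_pos {T : Set Plane} (hT : (interior T).Nonempty) {p n : ZMod 3 → Plane}
    (h : Caged T p n) : 0 < ∑ i, inner ℝ (p i) (n i) := by
  obtain ⟨x, hx⟩ := hT
  have hev : ∀ i, ∀ᶠ t : ℝ in 𝓝 0, t • n i + x ∈ T := fun i => by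
    have hc : ContinuousAt (fun t : ℝ => t • n i + x) 0 := by fun_prop
    exact hc (by simpa using mem_interior_iff_mem_nhds.1 hx)
  obtain ⟨t, ht, htT⟩ := ((eventually_all.2 hev).filter_mono
    (nhdsWithin_le_nhds (s := Ioi 0))).and self_mem_nhdsWithin |>.exists
  have := h.le _ ht
  rw [sum_inner_smul_add h.sum_eq] at this
  exact (mul_pos htT (sum_norm_sq_pos h.ne_zero)).trans_le this

lemma Caged.loopLength_pos {T : Set Plane} (hT : (interior T).Nonempty) {p n : ZMod 3 → Plane}
    (h : Caged T p n) : 0 < loopLength p := by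
  refine (loopLength_nonneg p).lt_of_ne fun h0 => ?_
  have hp : ∀ i, p i = p 0 := fun i => by
    have := norm_sub_le_loopLength p i 0
    rw [← h0] at this
    exact sub_eq_zero.1 (norm_le_zero_iff.1 this)
  have := h.sum_inner_pos hT
  rw [Finset.sum_congr rfl fun i _ => by rw [hp i], ← inner_sum, h.sum_eq, inner_zero_right] at this
  exact this.false

/-! ### Existence of shortest caged triples, and their position inside the table -/

lemma exists_caged {T : Set Plane} (hT : IsCompact T) : ∃ p n, Caged T p n := by
  obtain ⟨R, hR⟩ := hT.isBounded.exists_norm_le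
  let u : Plane := EuclideanSpace.single 0 1
  have hu : u ≠ 0 := by simp [u]
  let n : ZMod 3 → Plane := fun i => if i = 0 then u else if i = 1 then -u else 0
  have hn : n ≠ 0 := fun h => hu (by simpa [n] using congrFun h 0)
  have hn0 : ∑ i, n i = 0 := by
    rw [sum_zmod_three]
    simp [n, show (1 : ZMod 3) ≠ 0 by decide, show (2 : ZMod 3) ≠ 0 by decide,
      show (2 : ZMod 3) ≠ 1 by decide]
  have hpos := sum_norm_sq_pos hn
  -- The factor makes the pairing of the triple with `n` equal to `∑ i, R * ‖n i‖`, which bounds the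
  -- pairing of every triple in `T` by Cauchy-Schwarz.
  refine ⟨fun i => ((∑ i, R * ‖n i‖) / ∑ i, inner ℝ (n i) (n i)) • n i + 0, n, hn, hn0,
    fun x hx => ?_⟩
  rw [sum_inner_smul_add hn0, div_mul_cancel₀ _ hpos.ne']
  exact Finset.sum_le_sum fun i _ => (real_inner_le_norm _ _).trans
    (mul_le_mul_of_nonneg_right (hR _ (hx i)) (norm_nonneg _))

lemma Caged.normalize {T : Set Plane} {p n : ZMod 3 → Plane} (h : Caged T p n) :
    Caged T p (‖n‖⁻¹ • n) where
  ne_zero := smul_ne_zero (inv_ne_zero (norm_ne_zero_iff.2 h.ne_zero)) h.ne_zero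
  sum_eq := by simp only [Pi.smul_apply, ← Finset.smul_sum, h.sum_eq, smul_zero]
  le x hx := by
    simp only [Pi.smul_apply, inner_smul_right, ← Finset.mul_sum]
    exact mul_le_mul_of_nonneg_left (h.le x hx) (by positivity)

lemma Pinned.normalize {T : Set Plane} {p n : ZMod 3 → Plane} (h : Pinned T p n) :
    Pinned T p (‖n‖⁻¹ • n) where
  ne_zero := smul_ne_zero (inv_ne_zero (norm_ne_zero_iff.2 h.ne_zero)) h.ne_zero
  sum_eq := by simp only [Pi.smul_apply, ← Finset.smul_sum, h.sum_eq, smul_zero]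
  mem := h.mem
  support i x hx := by
    simp only [Pi.smul_apply, inner_smul_right]
    exact mul_nonpos_of_nonneg_of_nonpos (by positivity) (h.support i x hx)

lemma Caged.translate {T : Set Plane} {p n : ZMod 3 → Plane} (h : Caged T p n) (w : Plane) :
    Caged T (fun i => p i + w) n := by
  refine ⟨h.ne_zero, h.sum_eq, fun x hx => (h.le x hx).trans_eq ?_⟩
  simpa using (sum_inner_smul_add h.sum_eq 1 w p).symm

lemma loopLength_translate (p : ZMod 3 → Plane) (w : Plane) :
    loopLength (fun i => p i + w) = loopLength p := by
  simpa using loopLength_smul_add zero_le_one w p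

/-- Translating `p 0` to the origin and scaling `n` to norm one preserve both being caged and the
length. With the length bounded by that of one caged triple, the admissible pairs form a compact
set, because the caging inequalities are closed in `(p, n)`. -/
theorem exists_isShortestCaged {T : Set Plane} (hT : IsCompact T) :
    ∃ p, IsShortestCaged T p := by
  obtain ⟨p₀, n₀, h₀⟩ := exists_caged hT
  let K : Set ((ZMod 3 → Plane) × (ZMod 3 → Plane)) :=
    {z | ‖z.1‖ ≤ loopLength p₀ ∧ ‖z.2‖ = 1 ∧ ∑ i, z.2 i = 0 ∧
      ∀ x : ZMod 3 → Plane, (∀ i, x i ∈ T) →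
        ∑ i, inner ℝ (x i) (z.2 i) ≤ ∑ i, inner ℝ (z.1 i) (z.2 i)}
  have key : ∀ p n, Caged T p n → loopLength p ≤ loopLength p₀ →
      (fun i => p i + -p 0, ‖n‖⁻¹ • n) ∈ K := fun p n h hp => by
    have h' := (h.normalize).translate (-p 0)
    refine ⟨(pi_norm_le_iff_of_nonneg (loopLength_nonneg _)).2 fun i => ?_, ?_, h'.sum_eq, h'.le⟩
    · change ‖p i + -p 0‖ ≤ _
      rw [← sub_eq_add_neg]
      exact (norm_sub_le_loopLength p i 0).trans hp
    · rw [norm_smul, norm_inv, norm_norm, inv_mul_cancel₀ (norm_ne_zero_iff.2 h.ne_zero)]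
  have hK : IsCompact K := by
    refine (isCompact_closedBall (0 : (ZMod 3 → Plane) × (ZMod 3 → Plane))
      (max (loopLength p₀) 1)).of_isClosed_subset ?_ fun z hz => ?_
    · simp only [K, ofPred_and, ofPred_forall]
      refine (isClosed_le (by fun_prop) (by fun_prop)).inter
        ((isClosed_eq (by fun_prop) (by fun_prop)).inter
        ((isClosed_eq (by fun_prop) (by fun_prop)).inter ?_))
      exact isClosed_iInter fun x => isClosed_iInter fun _ =>
        isClosed_le (by fun_prop) (by fun_prop)
    · rw [mem_closedBall_zero_iff, Prod.norm_def]
      exact max_le_max hz.1 hz.2.1.le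
  obtain ⟨z, hz, hmin⟩ := hK.exists_isMinOn ⟨_, key _ _ h₀ le_rfl⟩
    (f := fun z => loopLength z.1) (continuous_loopLength.comp continuous_fst).continuousOn
  refine ⟨z.1, ⟨z.2, ?_, hz.2.2.1, hz.2.2.2⟩, fun p n h => ?_⟩
  · rw [← norm_ne_zero_iff, hz.2.1]
    exact one_ne_zero
  · by_cases hp : loopLength p ≤ loopLength p₀
    · have := hmin (key p n h hp)
      simpa only [mem_ofPred_eq, loopLength_translate] using this
    · have := hmin (key _ _ h₀ le_rfl)
      simp only [mem_ofPred_eq, loopLength_translate] at this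
      exact this.trans (not_le.1 hp).le

/-- If no translate of `p` fits into `T`, then a slightly smaller triple is still caged. -/
lemma exists_caged_smul_of_not_fits {T : Set Plane} (hT : IsTable T) (p : ZMod 3 → Plane)
    (h : ∀ w, ∃ i, p i + w ∉ T) :
    ∃ r : ℝ, 0 ≤ r ∧ r < 1 ∧ ∃ n, Caged T (fun i => r • p i + 0) n := by
  let C : Set (ZMod 3 → Plane) := Set.pi univ fun _ => T
  let D : Set (ZMod 3 → Plane) := Set.range fun w : Plane => fun i => p i + w
  have hC : Convex ℝ C := convex_pi fun _ _ => hT.convex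
  have hC' : IsCompact C := isCompact_univ_pi fun _ => hT.isCompact
  have hD : Convex ℝ D := by
    rintro _ ⟨v, rfl⟩ _ ⟨w, rfl⟩ a b ha hb hab
    refine ⟨a • v + b • w, funext fun i => ?_⟩
    simp only [Pi.add_apply, Pi.smul_apply, smul_add]
    rw [add_add_add_comm, ← add_smul, hab, one_smul]
  have hD' : IsClosed D := by
    have : D = {x | ∀ i, x i - p i = x 0 - p 0} := by
      ext x
      constructor
      · rintro ⟨w, rfl⟩ i
        simp
      · intro hx
        exact ⟨x 0 - p 0, funext fun i => by rw [← hx i]; exact add_sub_cancel _ _⟩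
    rw [this, ofPred_forall]
    exact isClosed_iInter fun i => isClosed_eq (by fun_prop) (by fun_prop)
  have hCD : Disjoint C D := by
    rw [Set.disjoint_left]
    rintro _ hx ⟨w, rfl⟩
    obtain ⟨i, hi⟩ := h w
    exact hi (hx i (mem_univ i))
  -- The triples in `T` are separated from the translates of `p`. The separating functional is a
  -- triple of vectors, which will serve as weights.
  obtain ⟨f, u, v, hfC, huv, hfD⟩ := geometric_hahn_banach_compact_closed hC hC' hD hD' hCD
  let n : ZMod 3 → Plane := fun i => (InnerProductSpace.toDual ℝ Plane).symm
    (f.comp (ContinuousLinearMap.single ℝ (fun _ : ZMod 3 => Plane) i))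
  have hfn : ∀ x, f x = ∑ i, inner ℝ (x i) (n i) := fun x => by
    conv_lhs => rw [← Finset.univ_sum_single x]
    rw [map_sum]
    refine Finset.sum_congr rfl fun i _ => ?_
    rw [real_inner_comm, InnerProductSpace.toDual_symm_apply]
    rfl
  -- A functional bounded below on all translates of `p` is constant along translations, which
  -- forces the weights to sum to zero.
  have hconst : ∀ w : Plane, inner ℝ w (∑ i, n i) = 0 := fun w => by
    have h1 : ∀ t : ℝ, v < f p + t * inner ℝ w (∑ i, n i) := fun t => by
      have := hfD _ ⟨t • w, rfl⟩
      rw [hfn] at this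
      rw [hfn]
      simpa only [inner_add_left, Finset.sum_add_distrib, ← inner_sum, inner_smul_left,
        conj_trivial, ← Finset.mul_sum] using this
    by_contra hne
    have := h1 ((v - f p) / inner ℝ w (∑ i, n i))
    rw [div_mul_cancel₀ _ hne] at this
    linarith
  have hsum : ∑ i, n i = 0 := inner_self_eq_zero.1 (hconst _)
  have hp : u < f p := huv.trans (hfD p ⟨0, by simp⟩)
  have hne : n ≠ 0 := fun h0 => by
    obtain ⟨x, hx⟩ := hT.interior_nonempty
    have h1 := hfC (fun _ => x) fun _ _ => interior_subset hx
    rw [hfn] at h1 hp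
    simp only [h0, Pi.zero_apply, inner_zero_right, Finset.sum_const_zero] at h1 hp
    linarith
  have hu : 0 < u := by
    obtain ⟨x, hx⟩ := hT.interior_nonempty
    have h1 := hfC (fun _ => x) fun _ _ => interior_subset hx
    rw [hfn, ← inner_sum, hsum, inner_zero_right] at h1
    exact h1
  have hfp := hu.trans hp
  -- With this factor the pairing of the scaled triple with `n` is exactly `u`, the bound for `f` on
  -- triples in `T`.
  refine ⟨u / f p, by positivity, (div_lt_one hfp).2 hp, n, hne, hsum, fun x hx => ?_⟩
  rw [sum_inner_smul_add hsum, ← hfn, ← hfn, div_mul_cancel₀ _ hfp.ne']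
  exact (hfC x fun i _ => hx i).le

/-- Test the caging inequality with the triple that differs from `p` only at `i`: all other terms
cancel. -/
lemma Caged.pinned_of_mem {T : Set Plane} {p n : ZMod 3 → Plane}
    (h : Caged T p n) (hp : ∀ i, p i ∈ T) : Pinned T p n where
  ne_zero := h.ne_zero
  sum_eq := h.sum_eq
  mem := hp
  support i x hx := by
    have := h.le (Function.update p i x) fun j => by
      by_cases hj : j = i
      · subst hj; simpa using hx
      · simpa [hj] using hp j
    rw [← sub_nonpos, ← Finset.sum_sub_distrib, Finset.sum_eq_single i] at this
    · simpa [inner_sub_left] using this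
    · intro j _ hj
      simp [hj]
    · simp

lemma IsShortestCaged.exists_pinned {T : Set Plane} (hT : IsTable T) {p : ZMod 3 → Plane}
    (h : IsShortestCaged T p) : ∃ p' n, Pinned T p' n ∧ IsShortestCaged T p' := by
  obtain ⟨⟨n, hn⟩, hmin⟩ := h
  by_cases hfit : ∃ w, ∀ i, p i + w ∈ T
  · obtain ⟨w, hw⟩ := hfit
    have hc := hn.translate w
    refine ⟨_, n, Caged.pinned_of_mem hc hw, ⟨n, hc⟩, fun p' n' h' => ?_⟩
    rw [loopLength_translate]
    exact hmin p' n' h'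
  · push Not at hfit
    obtain ⟨r, hr, hr1, n', h'⟩ := exists_caged_smul_of_not_fits hT p hfit
    have h1 := hmin _ _ h'
    rw [loopLength_smul_add hr] at h1
    have := hn.loopLength_pos hT.interior_nonempty
    nlinarith

theorem exists_pinned_isShortestCaged {T : Set Plane} (hT : IsTable T) :
    ∃ p n, Pinned T p n ∧ IsShortestCaged T p :=
  let ⟨_, hp⟩ := exists_isShortestCaged hT.isCompact
  hp.exists_pinned hT

/-! ## First order conditions for shortest caged triples -/

lemma loopLength_shift (p : ZMod 3 → Plane) (a : ZMod 3) :
    loopLength (fun i => p (i + a)) = loopLength p := by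
  simp only [loopLength, add_right_comm _ 1 a]
  exact sum_shift (fun i => ‖p (i + 1) - p i‖) a

lemma loopTrace_shift (p : ZMod 3 → Plane) (a : ZMod 3) :
    loopTrace (fun i => p (i + a)) = loopTrace p := by
  simp only [loopTrace, add_right_comm _ 1 a]
  exact (Equiv.addRight a).surjective.iUnion_comp fun i => segment ℝ (p i) (p (i + 1))

lemma Caged.shift {T : Set Plane} {p n : ZMod 3 → Plane} (h : Caged T p n) (a : ZMod 3) :
    Caged T (fun i => p (i + a)) (fun i => n (i + a)) where
  ne_zero := fun h0 => h.ne_zero <| funext fun i => by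
    have := congrFun h0 (i - a)
    simpa using this
  sum_eq := (sum_shift n a).trans h.sum_eq
  le x hx := by
    have := h.le (fun i => x (i - a)) fun i => hx _
    rw [← sum_shift _ a, ← sum_shift (fun i => inner ℝ (p i) (n i)) a] at this
    simpa using this

lemma Pinned.shift {T : Set Plane} {p n : ZMod 3 → Plane} (h : Pinned T p n) (a : ZMod 3) :
    Pinned T (fun i => p (i + a)) (fun i => n (i + a)) :=
  Caged.pinned_of_mem (h.caged.shift a) fun _ => h.mem _

lemma IsShortestCaged.shift {T : Set Plane} {p : ZMod 3 → Plane} (h : IsShortestCaged T p)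
    (a : ZMod 3) : IsShortestCaged T (fun i => p (i + a)) :=
  ⟨h.1.imp' (fun n i => n (i + a)) fun _ hn => hn.shift a, fun p' n' h' => by
    rw [loopLength_shift]; exact h.2 p' n' h'⟩

/-- The direction in which the closed polygon `p` reaches its vertex `p i`. -/
noncomputable def edgeDir (p : ZMod 3 → Plane) (i : ZMod 3) : Plane :=
  ‖p i - p (i - 1)‖⁻¹ • (p i - p (i - 1))

lemma norm_smul_edgeDir (p : ZMod 3 → Plane) (i : ZMod 3) :
    ‖p i - p (i - 1)‖ • edgeDir p i = p i - p (i - 1) := by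
  by_cases h : ‖p i - p (i - 1)‖ = 0
  · rw [h, norm_eq_zero.1 h, zero_smul]
  · rw [edgeDir, smul_inv_smul₀ h]

lemma norm_edgeDir {p : ZMod 3 → Plane} (hp : ∀ i, p (i + 1) ≠ p i) (i : ZMod 3) :
    ‖edgeDir p i‖ = 1 := by
  have := hp (i - 1)
  rw [sub_add_cancel] at this
  rw [edgeDir, norm_smul, norm_inv, norm_norm,
    inv_mul_cancel₀ (norm_ne_zero_iff.2 (sub_ne_zero.2 this))]

lemma loopLength_eq (p : ZMod 3 → Plane) : loopLength p = ∑ i, ‖p i - p (i - 1)‖ := by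
  rw [loopLength, ← sum_shift (fun i => ‖p i - p (i - 1)‖) 1]
  simp

/-- Summation by parts. -/
lemma sum_inner_sub_shift (x u : ZMod 3 → Plane) :
    ∑ i, inner ℝ (x i) (u i - u (i + 1)) = ∑ i, inner ℝ (x i - x (i - 1)) (u i) := by
  simp only [inner_sub_right, inner_sub_left, Finset.sum_sub_distrib]
  rw [← sum_shift (fun i => inner ℝ (x (i - 1)) (u i)) 1]
  simp

/-- Summation by parts pairs each side with its own unit direction. Degenerate sides contribute zero
to both sums. -/
lemma sum_inner_edgeDir {p : ZMod 3 → Plane} :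
    ∑ i, inner ℝ (p i) (edgeDir p i - edgeDir p (i + 1)) = loopLength p := by
  rw [sum_inner_sub_shift, loopLength_eq]
  refine Finset.sum_congr rfl fun i _ => ?_
  by_cases h : ‖p i - p (i - 1)‖ = 0
  · rw [h, norm_eq_zero.1 h, inner_zero_left]
  · rw [edgeDir, inner_smul_right, real_inner_self_eq_norm_sq]
    field_simp

/-- The right-hand side equals `(‖x‖ ^ 2 + ‖x + t • d‖ ^ 2) / (2 * ‖x‖)`, so this is the inequality
of arithmetic and geometric means. It replaces differentiation of the norm. -/
lemma norm_add_smul_le {E : Type*} [NormedAddCommGroup E] [InnerProductSpace ℝ E] {x : E}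
    (hx : x ≠ 0) (d : E) (t : ℝ) :
    ‖x + t • d‖ ≤ ‖x‖ + t * inner ℝ d (‖x‖⁻¹ • x) + t ^ 2 * (‖d‖ ^ 2 / (2 * ‖x‖)) := by
  have h0 : 0 < ‖x‖ := norm_pos_iff.2 hx
  have h1 : ‖x + t • d‖ ^ 2 = ‖x‖ ^ 2 + 2 * (t * inner ℝ d x) + t ^ 2 * ‖d‖ ^ 2 := by
    rw [norm_add_sq_real, norm_smul, inner_smul_right, mul_pow, Real.norm_eq_abs, sq_abs,
      real_inner_comm]
  have h2 : ‖x‖ + t * inner ℝ d (‖x‖⁻¹ • x) + t ^ 2 * (‖d‖ ^ 2 / (2 * ‖x‖)) =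
      (‖x‖ ^ 2 + ‖x + t • d‖ ^ 2) / (2 * ‖x‖) := by
    rw [h1, inner_smul_right]
    field_simp
    ring
  rw [h2, le_div_iff₀ (by positivity)]
  nlinarith [sq_nonneg (‖x‖ - ‖x + t • d‖)]

/-- Farkas' lemma for a single inequality: testing with minus the component of `v` orthogonal to `n`
shows that this component vanishes. -/
lemma exists_eq_smul_of_halfspace_le {E : Type*} [NormedAddCommGroup E] [InnerProductSpace ℝ E]
    {n v : E} (hn : n ≠ 0) (h : ∀ d : E, 0 ≤ inner ℝ d n → 0 ≤ inner ℝ d v) :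
    ∃ c : ℝ, 0 ≤ c ∧ v = c • n := by
  have hN : 0 < inner ℝ n n := real_inner_self_pos.2 hn
  have h1 := h (-(v - (inner ℝ v n / inner ℝ n n) • n)) (by
    rw [inner_neg_left, inner_sub_left, inner_smul_left, conj_trivial, div_mul_cancel₀ _ hN.ne']
    simp)
  have h2 : inner ℝ (v - (inner ℝ v n / inner ℝ n n) • n) n = 0 := by
    rw [inner_sub_left, inner_smul_left, conj_trivial, div_mul_cancel₀ _ hN.ne', sub_self]
  have h3 : inner ℝ (v - (inner ℝ v n / inner ℝ n n) • n)
      (v - (inner ℝ v n / inner ℝ n n) • n) ≤ 0 := by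
    rw [inner_sub_right, inner_smul_right, h2]
    rw [inner_neg_left] at h1
    linarith
  refine ⟨inner ℝ v n / inner ℝ n n, div_nonneg ?_ hN.le, ?_⟩
  · rw [real_inner_comm]
    exact h n hN.le
  · exact sub_eq_zero.1 (real_inner_self_nonpos.1 h3)

lemma nonneg_of_forall_add_mul_sq {A B : ℝ} (h : ∀ t : ℝ, 0 < t → 0 ≤ t * A + t ^ 2 * B) :
    0 ≤ A := by
  by_contra! hA
  -- At this `t` the quadratic term is at most half the size of the linear one.
  have h1 := h (-A / (2 * (|B| + 1))) (by have := abs_nonneg B; apply div_pos <;> linarith)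
  have hb : 0 < |B| + 1 := by positivity
  have h2 : -A / (2 * (|B| + 1)) * A + (-A / (2 * (|B| + 1))) ^ 2 * B =
      A ^ 2 / (4 * (|B| + 1) ^ 2) * (B - 2 * (|B| + 1)) := by
    field_simp
    ring
  rw [h2] at h1
  have h3 : B - 2 * (|B| + 1) < 0 := by linarith [le_abs_self B, abs_nonneg B]
  have h4 : 0 < A ^ 2 / (4 * (|B| + 1) ^ 2) := by have := hA.ne; positivity
  nlinarith

lemma Caged.move {T : Set Plane} {p n : ZMod 3 → Plane} (h : Caged T p n) {d : ZMod 3 → Plane}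
    (hd : 0 ≤ ∑ i, inner ℝ (d i) (n i)) : Caged T (fun i => p i + d i) n := by
  refine ⟨h.ne_zero, h.sum_eq, fun x hx => (h.le x hx).trans ?_⟩
  simp only [inner_add_left, Finset.sum_add_distrib]
  linarith

/-- Lagrange multipliers: moves `d` with nonnegative pairing with `n` keep the triple caged, so the
length cannot decrease along them to first order. Its gradient at vertex `i` is `edgeDir p i -
edgeDir p (i + 1)`, and a functional nonnegative on a half-space is a nonnegative multiple of the
defining one. -/
lemma IsShortestCaged.exists_bounce_eq {T : Set Plane} {p n : ZMod 3 → Plane}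
    (hs : IsShortestCaged T p) (h : Caged T p n) (hp : ∀ i, p (i + 1) ≠ p i) :
    ∃ c : ℝ, 0 ≤ c ∧ ∀ i, edgeDir p i - edgeDir p (i + 1) = c • n i := by
  have key : ∀ d : ZMod 3 → Plane, 0 ≤ ∑ i, inner ℝ (d i) (n i) →
      0 ≤ ∑ i, inner ℝ (d i) (edgeDir p i - edgeDir p (i + 1)) := fun d hd => by
    have hp' : ∀ i, p i - p (i - 1) ≠ 0 := fun i => by
      have := hp (i - 1)
      rw [sub_add_cancel] at this
      exact sub_ne_zero.2 this
    refine nonneg_of_forall_add_mul_sq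
      (B := ∑ i, ‖d i - d (i - 1)‖ ^ 2 / (2 * ‖p i - p (i - 1)‖)) fun t ht => ?_
    have h1 := hs.2 _ n (h.move (d := fun i => t • d i) (by
      simp only [inner_smul_left, ← Finset.mul_sum]
      exact mul_nonneg ht.le hd))
    rw [sum_inner_sub_shift, Finset.mul_sum, Finset.mul_sum, ← Finset.sum_add_distrib]
    rw [loopLength_eq, loopLength_eq, ← sub_nonneg, ← Finset.sum_sub_distrib] at h1
    refine h1.trans (Finset.sum_le_sum fun i _ => ?_)
    have h2 := norm_add_smul_le (hp' i) (d i - d (i - 1)) t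
    have h3 : p i + t • d i - (p (i - 1) + t • d (i - 1)) =
        p i - p (i - 1) + t • (d i - d (i - 1)) := by module
    rw [h3]
    unfold edgeDir
    linarith
  obtain ⟨c, hc, hv⟩ := exists_eq_smul_of_halfspace_le (E := PiLp 2 fun _ : ZMod 3 => Plane)
    (n := WithLp.toLp 2 n) (v := WithLp.toLp 2 fun i => edgeDir p i - edgeDir p (i + 1))
    (fun h0 => h.ne_zero (by simpa using h0)) fun d hd => by
      simpa only [PiLp.inner_apply] using key d (by simpa only [PiLp.inner_apply] using hd)
  exact ⟨c, hc, fun i => congrArg (fun z : PiLp 2 fun _ : ZMod 3 => Plane => z i) hv⟩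

lemma IsOutwardSupport.smul {T : Set Plane} {q v : Plane} (h : IsOutwardSupport T q v) {c : ℝ}
    (hc : 0 ≤ c) : IsOutwardSupport T q (c • v) := fun x hx => by
  rw [inner_smul_right]
  exact mul_nonpos_of_nonneg_of_nonpos hc (h x hx)

/-- Two-bounce orbits: `a` and `b` are the ends of a double normal of `T`. -/
structure IsDoubleNormal (T : Set Plane) (a b : Plane) : Prop where
  ne : a ≠ b
  left_mem : a ∈ T
  right_mem : b ∈ T
  left_support : IsOutwardSupport T a (a - b)
  right_support : IsOutwardSupport T b (b - a)

/-- Three-bounce orbits. -/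
structure IsTriangleOrbit (T : Set Plane) (p : ZMod 3 → Plane) : Prop where
  ne : ∀ i, p (i + 1) ≠ p i
  mem : ∀ i, p i ∈ T
  bounce_ne : ∀ i, edgeDir p i - edgeDir p (i + 1) ≠ 0
  support : ∀ i, IsOutwardSupport T (p i) (edgeDir p i - edgeDir p (i + 1))

/-- The length is not differentiable where two vertices coincide. Moving both by the same vector and
fixing `p 2` gives the variational argument for the single length `‖p 0 - p 2‖`, with `n 0 + n 1` as
the weight of the double vertex. -/
lemma IsShortestCaged.isDoubleNormal_of_eq {T : Set Plane} (hT : IsTable T)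
    {p n : ZMod 3 → Plane} (hs : IsShortestCaged T p) (h : Pinned T p n) (hp : p 1 = p 0) :
    ∃ a b, IsDoubleNormal T a b ∧ loopLength p = 2 * ‖a - b‖ ∧ loopTrace p = segment ℝ a b := by
  have e12 : (1 : ZMod 3) + 1 = 2 := rfl
  have e20 : (2 : ZMod 3) + 1 = 0 := rfl
  have hl : loopLength p = 2 * ‖p 0 - p 2‖ := by
    rw [loopLength, sum_zmod_three, zero_add, e12, e20, hp, norm_sub_rev (p 2)]
    simp
    ring
  have hne : p 0 ≠ p 2 := fun h0 => by
    have := h.caged.loopLength_pos hT.interior_nonempty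
    rw [hl, h0] at this
    simp at this
  have hn2 : n 2 = -(n 0 + n 1) := by
    have := h.sum_eq
    rw [sum_zmod_three] at this
    exact eq_neg_of_add_eq_zero_right this
  have key : ∀ d : Plane, 0 ≤ inner ℝ d (n 0 + n 1) → 0 ≤ inner ℝ d (p 0 - p 2) := fun d hd => by
    refine nonneg_of_mul_nonneg_right (a := 2) ?_ two_pos
    refine nonneg_of_forall_add_mul_sq (B := ‖d‖ ^ 2) fun t ht => ?_
    have h1 := hs.2 _ n (h.caged.move (d := fun i => if i = 2 then 0 else t • d) (by
      rw [sum_zmod_three]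
      rw [inner_add_right] at hd
      simp only [show (0 : ZMod 3) ≠ 2 by decide, show (1 : ZMod 3) ≠ 2 by decide, if_true,
        if_false, inner_smul_left, conj_trivial, inner_zero_left]
      nlinarith))
    rw [hl, loopLength, sum_zmod_three, zero_add, e12, e20] at h1
    simp only [show (0 : ZMod 3) ≠ 2 by decide, show (1 : ZMod 3) ≠ 2 by decide, if_true,
        if_false, hp, sub_self, norm_zero, add_zero, zero_add] at h1
    rw [norm_sub_rev (p 2)] at h1
    have h2 : ‖p 0 - p 2‖ ^ 2 ≤ ‖p 0 - p 2 + t • d‖ ^ 2 := by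
      rw [← add_sub_right_comm]
      exact pow_le_pow_left₀ (norm_nonneg _) (by linarith) 2
    rw [norm_add_sq_real, norm_smul, inner_smul_right, mul_pow, Real.norm_eq_abs, sq_abs,
      real_inner_comm] at h2
    nlinarith
  have hn : n 0 + n 1 ≠ 0 := fun h0 => by
    have := key (-(p 0 - p 2)) (by rw [h0, inner_zero_right])
    rw [inner_neg_left, neg_nonneg] at this
    exact hne (sub_eq_zero.1 (real_inner_self_nonpos.1 this))
  obtain ⟨c, hc, hv⟩ := exists_eq_smul_of_halfspace_le hn key
  refine ⟨p 0, p 2, ⟨hne, h.mem 0, h.mem 2, fun x hx => ?_, fun x hx => ?_⟩, hl, ?_⟩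
  · have h0 := h.support 0 x hx
    have h1 := h.support 1 x hx
    rw [hp] at h1
    rw [hv, inner_smul_right, inner_add_right]
    exact mul_nonpos_of_nonneg_of_nonpos hc (by linarith)
  · have h2 := h.support 2 x hx
    rw [← neg_sub (p 0), hv, ← smul_neg, ← hn2, inner_smul_right]
    exact mul_nonpos_of_nonneg_of_nonpos hc h2
  · have : loopTrace p = segment ℝ (p 0) (p 1) ∪ segment ℝ (p 1) (p 2) ∪ segment ℝ (p 2) (p 0) := by
      ext z
      simp only [loopTrace, mem_iUnion, mem_union]
      constructor
      · rintro ⟨i, hi⟩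
        fin_cases i
        exacts [Or.inl (Or.inl hi), Or.inl (Or.inr hi), Or.inr hi]
      · rintro ((hi | hi) | hi)
        exacts [⟨0, hi⟩, ⟨1, hi⟩, ⟨2, hi⟩]
    rw [this, hp, segment_same, segment_symm ℝ (p 2), union_assoc, union_self]
    exact union_eq_right.2 (singleton_subset_iff.2 (left_mem_segment _ _ _))

/-- Equal directions before and after `p 0` put it between `p 2` and `p 1`. The polygon runs along
this segment and back, and the bounce vectors at the ends are `2 • u` and `-2 • u`. -/
lemma isDoubleNormal_of_bounce_eq_zero {T : Set Plane} {p : ZMod 3 → Plane}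
    (hp : ∀ i, p (i + 1) ≠ p i) (hmem : ∀ i, p i ∈ T)
    (hsup : ∀ i, IsOutwardSupport T (p i) (edgeDir p i - edgeDir p (i + 1)))
    (h0 : edgeDir p 0 = edgeDir p 1) :
    ∃ a b, IsDoubleNormal T a b ∧ loopLength p = 2 * ‖a - b‖ ∧ loopTrace p = segment ℝ a b := by
  set u := edgeDir p 1 with hu
  set r := ‖p 0 - p 2‖
  set s := ‖p 1 - p 0‖
  have hr : 0 < r := norm_pos_iff.2 (sub_ne_zero.2 (hp 2))
  have hs : 0 < s := norm_pos_iff.2 (sub_ne_zero.2 (hp 0))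
  have hu1 : ‖u‖ = 1 := norm_edgeDir hp 1
  have h02 : r • u = p 0 - p 2 := by rw [← h0]; exact norm_smul_edgeDir p 0
  have h10 : s • u = p 1 - p 0 := norm_smul_edgeDir p 1
  have h12 : p 1 - p 2 = (r + s) • u := by rw [add_smul, h02, h10]; abel
  have hn12 : ‖p 1 - p 2‖ = r + s := by
    rw [h12, norm_smul, hu1, mul_one, Real.norm_of_nonneg (by positivity)]
  have hu2 : edgeDir p 2 = -u := by
    have : edgeDir p 2 = ‖p 2 - p 1‖⁻¹ • (p 2 - p 1) := rfl
    rw [this, norm_sub_rev, hn12, ← neg_sub, h12, smul_neg, inv_smul_smul₀ (by positivity)]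
  have hne : p 1 ≠ p 2 := (hp 1).symm
  refine ⟨p 1, p 2, ⟨hne, hmem 1, hmem 2, ?_, ?_⟩, ?_, ?_⟩
  · have : p 1 - p 2 = ((r + s) / 2) • (edgeDir p 1 - edgeDir p (1 + 1)) := by
      rw [show (1 : ZMod 3) + 1 = 2 from rfl, hu2, h12]
      module
    rw [this]
    exact (hsup 1).smul (by positivity)
  · have : p 2 - p 1 = ((r + s) / 2) • (edgeDir p 2 - edgeDir p (2 + 1)) := by
      rw [show (2 : ZMod 3) + 1 = 0 from rfl, hu2, h0, ← neg_sub, h12]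
      module
    rw [this]
    exact (hsup 2).smul (by positivity)
  · rw [loopLength, sum_zmod_three, zero_add, show (1 : ZMod 3) + 1 = 2 from rfl,
      show (2 : ZMod 3) + 1 = 0 from rfl, norm_sub_rev (p 2), hn12]
    change s + (r + s) + r = _
    ring
  · have hm : p 0 ∈ segment ℝ (p 1) (p 2) := by
      refine ⟨r / (r + s), s / (r + s), by positivity, by positivity, by field_simp, ?_⟩
      have e1 : p 1 = p 0 + s • u := by rw [h10]; abel
      have e2 : p 2 = p 0 - r • u := by rw [h02]; abel
      rw [e1, e2]
      match_scalars <;> field_simp <;> ring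
    refine Subset.antisymm (iUnion_subset fun i => ?_) (subset_iUnion_of_subset 1 Subset.rfl)
    refine (convex_segment _ _).segment_subset ?_ ?_
    · fin_cases i
      exacts [hm, left_mem_segment _ _ _, right_mem_segment _ _ _]
    · fin_cases i
      exacts [left_mem_segment _ _ _, right_mem_segment _ _ _, hm]

theorem IsShortestCaged.isDoubleNormal_or_isTriangleOrbit {T : Set Plane} (hT : IsTable T)
    {p n : ZMod 3 → Plane} (hs : IsShortestCaged T p) (h : Pinned T p n) :
    (∃ a b, IsDoubleNormal T a b ∧ loopLength p = 2 * ‖a - b‖ ∧ loopTrace p = segment ℝ a b) ∨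
      IsTriangleOrbit T p := by
  by_cases hp : ∀ i, p (i + 1) ≠ p i
  · obtain ⟨c, hc, hv⟩ := hs.exists_bounce_eq h.caged hp
    have hsup : ∀ i, IsOutwardSupport T (p i) (edgeDir p i - edgeDir p (i + 1)) := fun i => by
      rw [hv i]
      exact (h.support i).smul hc
    by_cases hb : ∀ i, edgeDir p i - edgeDir p (i + 1) ≠ 0
    · exact Or.inr ⟨hp, h.mem, hb, hsup⟩
    · push Not at hb
      obtain ⟨i, hi⟩ := hb
      have hed : ∀ j, edgeDir (fun j => p (j + i)) j = edgeDir p (j + i) := fun j => by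
        simp only [edgeDir, sub_add_eq_add_sub]
      have := isDoubleNormal_of_bounce_eq_zero (T := T) (p := fun j => p (j + i))
        (fun j => by rw [add_right_comm]; exact hp _) (fun j => h.mem _)
        (fun j => by rw [hed, hed, add_right_comm]; exact hsup _)
        (by rw [hed, hed, zero_add, add_comm]; exact sub_eq_zero.1 hi)
      rw [loopLength_shift, loopTrace_shift] at this
      exact Or.inl this
  · push Not at hp
    obtain ⟨i, hi⟩ := hp
    have := (hs.shift i).isDoubleNormal_of_eq hT (h.shift i) (by
      rw [zero_add, add_comm]; exact hi)
    rw [loopLength_shift, loopTrace_shift] at this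
    exact Or.inl this

/-! ## From caged triples to closed orbits -/

lemma mem_frontier_of_support {T : Set Plane} {x v : Plane} (hx : x ∈ T) (hv : v ≠ 0)
    (h : IsOutwardSupport T x v) : x ∈ frontier T := by
  refine ⟨subset_closure hx, fun hi => ?_⟩
  have hc : ContinuousAt (fun t : ℝ => x + t • v) 0 := by fun_prop
  have hev : ∀ᶠ t : ℝ in 𝓝 0, x + t • v ∈ T :=
    hc (by simpa using mem_interior_iff_mem_nhds.1 hi)
  obtain ⟨t, ht, htT⟩ := (hev.filter_mono (nhdsWithin_le_nhds (s := Ioi 0))).and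
    self_mem_nhdsWithin |>.exists
  have := h _ ht
  rw [add_sub_cancel_left, inner_smul_left, conj_trivial] at this
  exact (mul_pos htT (real_inner_self_pos.2 hv)).not_ge this

lemma periods_of_zmod {m : ℕ} (hm : 2 ≤ m) (g : ZMod m → Plane) :
    m ∈ periods fun i : ℤ => g i :=
  ⟨hm, fun i => by simp⟩

lemma trace_of_zmod {m : ℕ} (g : ZMod m → Plane) :
    trace (fun i : ℤ => g i) = ⋃ j : ZMod m, segment ℝ (g j) (g (j + 1)) := by
  simp only [trace, Int.cast_add, Int.cast_one]
  exact (ZMod.intCast_surjective (n := m)).iUnion_comp fun j => segment ℝ (g j) (g (j + 1))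

lemma isOrbit_of_zmod {T : Set Plane} {m : ℕ} {g : ZMod m → Plane} (hmem : ∀ j, g j ∈ T)
    (hne : ∀ j, g (j + 1) ≠ g j)
    (hv : ∀ j, ‖g j - g (j - 1)‖⁻¹ • (g j - g (j - 1)) +
      ‖g j - g (j + 1)‖⁻¹ • (g j - g (j + 1)) ≠ 0)
    (hs : ∀ j, IsOutwardSupport T (g j) (‖g j - g (j - 1)‖⁻¹ • (g j - g (j - 1)) +
      ‖g j - g (j + 1)‖⁻¹ • (g j - g (j + 1)))) : IsOrbit T fun i : ℤ => g i where
  mem_frontier i := mem_frontier_of_support (hmem _) (hv i) (hs i)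
  ne_succ i := by
    rw [Int.cast_add, Int.cast_one]
    exact (hne i).symm
  support i := by
    have : bounceVector (fun i : ℤ => g i) i = ‖g i - g (i - 1)‖⁻¹ • (g i - g (i - 1)) +
      ‖g i - g (i + 1)‖⁻¹ • (g i - g (i + 1)) := by
      simp only [bounceVector, Int.cast_sub, Int.cast_add, Int.cast_one]
    rw [this]
    exact hs i

lemma IsTriangleOrbit.exists_orbit {T : Set Plane} {p : ZMod 3 → Plane}
    (h : IsTriangleOrbit T p) :
    ∃ q ∈ closedOrbits T, orbitLength q = loopLength p ∧ trace q = loopTrace p := by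
  have hb : ∀ i, ‖p i - p (i - 1)‖⁻¹ • (p i - p (i - 1)) +
      ‖p i - p (i + 1)‖⁻¹ • (p i - p (i + 1)) = edgeDir p i - edgeDir p (i + 1) := fun i => by
    simp only [edgeDir, add_sub_cancel_right]
    rw [norm_sub_rev (p i) (p (i + 1)), ← neg_sub (p (i + 1)) (p i), smul_neg, ← sub_eq_add_neg]
  have hper : period (fun i : ℤ => p i) = 3 := by
    refine le_antisymm (Nat.sInf_le (periods_of_zmod (by norm_num) p)) ?_
    refine le_csInf ⟨3, periods_of_zmod (by norm_num) p⟩ fun m hm => ?_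
    by_contra! hlt
    obtain rfl : m = 2 := le_antisymm (by omega) hm.1
    -- Since `-2` is `1` modulo `3`, a period of two would identify the adjacent vertices `p 0` and
    -- `p 1`.
    have := hm.2 (-2)
    refine h.ne 0 ?_
    rw [show (0 : ZMod 3) + 1 = -2 from rfl]
    simpa using this.symm
  refine ⟨fun i : ℤ => p i, ⟨isOrbit_of_zmod h.mem h.ne (fun j => ?_) fun j => ?_,
    3, periods_of_zmod (by norm_num) p⟩, ?_, trace_of_zmod p⟩
  · rw [hb]; exact h.bounce_ne j
  · rw [hb]; exact h.support j
  · rw [orbitLength, hper, loopLength, sum_zmod_three, Finset.sum_range_succ,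
      Finset.sum_range_succ, Finset.sum_range_one]
    simp
    rfl

lemma IsDoubleNormal.exists_orbit {T : Set Plane} {a b : Plane} (h : IsDoubleNormal T a b) :
    ∃ q ∈ closedOrbits T, orbitLength q = 2 * ‖a - b‖ ∧ trace q = segment ℝ a b := by
  let g : ZMod 2 → Plane := fun i => if i = 0 then a else b
  have hall : ∀ {P : ZMod 2 → Prop}, P 0 → P 1 → ∀ i, P i := fun h0 h1 i => by
    fin_cases i
    exacts [h0, h1]
  have e : (1 : ZMod 2) + 1 = 0 := rfl
  have e' : (0 : ZMod 2) - 1 = 1 := rfl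
  have g0 : g 0 = a := rfl
  have g1 : g 1 = b := rfl
  have h2 : ∀ v : Plane, v ≠ 0 → ‖v‖⁻¹ • v + ‖v‖⁻¹ • v ≠ 0 := fun v hv h0 => by
    rw [← two_smul ℝ] at h0
    exact hv (by simpa using h0)
  have hper : period (fun i : ℤ => g i) = 2 :=
    le_antisymm (Nat.sInf_le (periods_of_zmod le_rfl g))
      (le_csInf ⟨2, periods_of_zmod le_rfl g⟩ fun m hm => hm.1)
  refine ⟨fun i : ℤ => g i, ⟨isOrbit_of_zmod (hall h.left_mem h.right_mem)
    (hall ?_ ?_) (hall ?_ ?_) (hall ?_ ?_), 2, periods_of_zmod le_rfl g⟩, ?_, ?_⟩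
  · rw [zero_add, g0, g1]; exact h.ne.symm
  · rw [e, g0, g1]; exact h.ne
  · rw [e', zero_add, g0, g1]; exact h2 _ (sub_ne_zero.2 h.ne)
  · rw [e, sub_self, g0, g1]; exact h2 _ (sub_ne_zero.2 h.ne.symm)
  · rw [e', zero_add, g0, g1, ← two_smul ℝ, smul_smul]; exact h.left_support.smul (by positivity)
  · rw [e, sub_self, g0, g1, ← two_smul ℝ, smul_smul]; exact h.right_support.smul (by positivity)
  · rw [orbitLength, hper, Finset.sum_range_succ, Finset.sum_range_one]
    simp only [Nat.cast_zero, Int.cast_zero, zero_add, Int.cast_add, Int.cast_one, Nat.cast_one, e,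
      g0, g1]
    rw [norm_sub_rev b]
    ring
  · rw [trace_of_zmod]
    have : ∀ j : ZMod 2, segment ℝ (g j) (g (j + 1)) = segment ℝ a b :=
      hall rfl (segment_symm ℝ b a)
    simp only [this, iUnion_const]

theorem IsShortestCaged.exists_orbit {T : Set Plane} (hT : IsTable T) {p n : ZMod 3 → Plane}
    (hs : IsShortestCaged T p) (h : Pinned T p n) :
    ∃ q ∈ closedOrbits T, orbitLength q = loopLength p ∧ trace q = loopTrace p := by
  obtain ⟨a, b, hab, hl, ht⟩ | ho := hs.isDoubleNormal_or_isTriangleOrbit hT h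
  · rw [hl, ht]
    exact hab.exists_orbit
  · exact ho.exists_orbit

/-! ## From closed orbits to caged triples -/

lemma segment_union_of_mem {x y z : Plane} (h : y ∈ segment ℝ x z) :
    segment ℝ x y ∪ segment ℝ y z = segment ℝ x z := by
  rw [segment_eq_image_lineMap] at h
  obtain ⟨s, hs, rfl⟩ := h
  have e0 : x = AffineMap.lineMap x z (0 : ℝ) := (AffineMap.lineMap_apply_zero _ _).symm
  have e1 : z = AffineMap.lineMap x z (1 : ℝ) := (AffineMap.lineMap_apply_one _ _).symm
  set f : ℝ →ᵃ[ℝ] Plane := AffineMap.lineMap x z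
  rw [e0, e1, ← image_segment, ← image_segment, ← image_segment, ← image_union,
    segment_eq_Icc hs.1, segment_eq_Icc hs.2, segment_eq_Icc zero_le_one,
    Icc_union_Icc_eq_Icc hs.1 hs.2]

/-- The length of the polygonal curve from `q a` to `q b`. -/
noncomputable def arcLength (q : ℤ → Plane) (a b : ℕ) : ℝ :=
  ∑ k ∈ Finset.Ico a b, ‖q ((k : ℤ) + 1) - q k‖

/-- The polygonal curve from `q a` to `q b`. -/
def arc (q : ℤ → Plane) (a b : ℕ) : Set Plane :=
  ⋃ k ∈ Finset.Ico a b, segment ℝ (q (k : ℤ)) (q ((k : ℤ) + 1))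

lemma norm_sub_le_arcLength (q : ℤ → Plane) {a b : ℕ} (h : a ≤ b) :
    ‖q b - q a‖ ≤ arcLength q a b := by
  have := dist_le_Ico_sum_dist (fun k : ℕ => q k) h
  rw [dist_comm, dist_eq_norm] at this
  refine this.trans_eq (Finset.sum_congr rfl fun k _ => ?_)
  rw [dist_comm, dist_eq_norm, Nat.cast_succ]

lemma arcLength_add (q : ℤ → Plane) {a b c : ℕ} (hab : a ≤ b) (hbc : b ≤ c) :
    arcLength q a b + arcLength q b c = arcLength q a c :=
  Finset.sum_Ico_consecutive _ hab hbc

lemma arc_union (q : ℤ → Plane) {a b c : ℕ} (hab : a ≤ b) (hbc : b ≤ c) :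
    arc q a b ∪ arc q b c = arc q a c := by
  rw [arc, arc, arc, ← Finset.Ico_union_Ico_eq_Ico hab hbc, Finset.set_biUnion_union]

/-- Equality in the triangle inequality puts each earlier end point on the segment to the next one.
The point `q a` is inserted because for `a = b` the arc is empty while the segment is a single
point. -/
lemma insert_arc_eq_segment (q : ℤ → Plane) {a b : ℕ} (h : a ≤ b)
    (hl : arcLength q a b ≤ ‖q b - q a‖) : insert (q a) (arc q a b) = segment ℝ (q a) (q b) := by
  induction b, h using Nat.le_induction with
  | base => simp [arc]
  | succ b hab ih =>
    have h1 : arcLength q a b + ‖q ((b : ℤ) + 1) - q b‖ = arcLength q a (b + 1) :=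
      (Finset.sum_Ico_succ_top hab _).symm
    have h2 := norm_sub_le_arcLength q hab
    have h3 : ‖q ((b : ℤ) + 1) - q a‖ ≤ ‖q ((b : ℤ) + 1) - q b‖ + ‖q b - q a‖ :=
      norm_sub_le_norm_sub_add_norm_sub _ _ _
    push_cast at hl ⊢
    have hw : Wbtw ℝ (q a) (q b) (q ((b : ℤ) + 1)) := by
      have n1 := norm_sub_rev (q b) (q a)
      have n2 := norm_sub_rev (q ((b : ℤ) + 1)) (q b)
      have n3 := norm_sub_rev (q ((b : ℤ) + 1)) (q a)
      rw [← dist_add_dist_eq_iff, dist_eq_norm, dist_eq_norm, dist_eq_norm]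
      linarith
    rw [← segment_union_of_mem (mem_segment_iff_wbtw.2 hw), ← ih (by linarith),
      ← arc_union q hab b.le_succ, insert_union]
    congr 2
    simp [arc]

lemma arcLength_period (q : ℤ → Plane) {N : ℕ} (hN : ∀ i : ℤ, q (i + N) = q i) {a : ℕ}
    (ha : a ≤ N) : arcLength q a (a + N) = arcLength q 0 N := by
  have : arcLength q N (a + N) = arcLength q 0 a := by
    have h1 := Finset.sum_Ico_add' (fun k : ℕ => ‖q ((k : ℤ) + 1) - q k‖) 0 a N
    rw [zero_add] at h1
    rw [arcLength, arcLength, ← h1]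
    refine Finset.sum_congr rfl fun k _ => ?_
    rw [Nat.cast_add, add_right_comm, hN, hN]
  rw [← arcLength_add q ha (Nat.le_add_left N a), this, add_comm,
    arcLength_add q (Nat.zero_le a) ha]

lemma trace_eq_arc (q : ℤ → Plane) {N : ℕ} (hN0 : 0 < N) (hN : ∀ i : ℤ, q (i + N) = q i) (a : ℕ) :
    trace q = arc q a (a + N) := by
  have hp : Function.Periodic q N := hN
  refine Subset.antisymm (iUnion_subset fun i => ?_)
    (iUnion₂_subset fun k _ => subset_iUnion (fun i : ℤ => segment ℝ (q i) (q (i + 1))) k)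
  let r : ℕ := ((i - a) % N).toNat
  have hN' : (0 : ℤ) < N := by exact_mod_cast hN0
  have hr : (r : ℤ) = (i - a) % N := Int.toNat_of_nonneg (Int.emod_nonneg _ hN'.ne')
  have hr' : r < N := by
    have := Int.emod_lt_of_pos (i - a) hN'
    omega
  have hi : i = ((a + r : ℕ) : ℤ) + (i - a) / N * N := by
    have := Int.emod_add_mul_ediv (i - a) N
    push_cast
    rw [hr]
    linarith
  refine subset_iUnion₂_of_subset (a + r) (by simp [hr']) ?_
  have e1 : q i = q ((a + r : ℕ) : ℤ) := by
    conv_lhs => rw [hi]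
    exact hp.int_mul _ _
  have e2 : q (i + 1) = q (((a + r : ℕ) : ℤ) + 1) := by
    conv_lhs => rw [hi, add_right_comm]
    exact hp.int_mul _ _
  rw [e1, e2]

/-- Zero is the mean of the nonzero `v k`, and by Carathéodory a convex combination of at most three
of them. Zero vectors are dropped beforehand so that the selected terms do not vanish. -/
lemma exists_balanced_triple {N : ℕ} {v : ℕ → Plane} (hv : ∑ k ∈ Finset.range N, v k = 0)
    (hne : ∃ k < N, v k ≠ 0) :
    ∃ (I : Fin 3 → ℕ) (w : Fin 3 → ℝ), Monotone I ∧ (∀ j, I j < N) ∧ (∀ j, 0 ≤ w j) ∧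
      (∃ j, w j • v (I j) ≠ 0) ∧ ∑ j, w j • v (I j) = 0 := by
  classical
  let s := (Finset.range N).filter fun k => v k ≠ 0
  have hs : s.Nonempty := by
    obtain ⟨k, hk, hk'⟩ := hne
    exact ⟨k, Finset.mem_filter.2 ⟨Finset.mem_range.2 hk, hk'⟩⟩
  have hsum : ∑ k ∈ s, v k = 0 := by rw [Finset.sum_filter_ne_zero, hv]
  have h0 : (0 : Plane) ∈ convexHull ℝ (v '' s) := by
    have := Finset.centerMass_mem_convexHull (R := ℝ) s (w := fun _ => 1) (z := v)
      (s := v '' s) (fun _ _ => zero_le_one) (by simpa using hs) fun k hk => mem_image_of_mem v hk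
    simpa [Finset.centerMass, hsum] using this
  obtain ⟨ι, _, z, w, hz, hind, hw, hw1, hwz⟩ := eq_pos_convex_span_of_mem_convexHull h0
  have hcard : Fintype.card ι ≤ Fintype.card (Fin 3) := by
    have := hind.card_le_finrank_succ
    have h2 := Submodule.finrank_le (vectorSpan ℝ (range z))
    rw [finrank_euclideanSpace_fin] at h2
    rw [Fintype.card_fin]
    omega
  obtain ⟨e⟩ := Function.Embedding.nonempty_of_card_le hcard
  choose k hks hkz using fun i => hz (mem_range_self i)
  have hks' : ∀ i, k i < N ∧ v (k i) ≠ 0 := fun i => by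
    have := hks i
    simpa [s] using this
  obtain ⟨k₀, hk₀, -⟩ := hne
  -- If fewer than three vectors are needed, the remaining slots get an arbitrary valid index with
  -- weight zero.
  let I := Function.extend e k fun _ => k₀
  let W := Function.extend e w 0
  have hI : ∀ i, I (e i) = k i := fun i => e.injective.extend_apply _ _ _
  have hW : ∀ i, W (e i) = w i := fun i => e.injective.extend_apply _ _ _
  have hI' : ∀ j, I j < N := fun j => by
    by_cases hj : ∃ i, e i = j
    · obtain ⟨i, rfl⟩ := hj
      rw [hI]; exact (hks' i).1
    · simp only [I, Function.extend_apply' _ _ _ hj, hk₀]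
  have hW' : ∀ j, 0 ≤ W j := fun j => by
    by_cases hj : ∃ i, e i = j
    · obtain ⟨i, rfl⟩ := hj
      rw [hW]; exact (hw i).le
    · simp only [W, Function.extend_apply' _ _ _ hj, Pi.zero_apply, le_refl]
  have hsum' : ∑ j, W j • v (I j) = 0 := by
    rw [← hwz]
    refine (Fintype.sum_of_injective e e.injective _ _ (fun j hj => ?_) fun i => ?_).symm
    · simp only [W, Function.extend_apply' _ _ _ hj, Pi.zero_apply, zero_smul]
    · rw [hI, hW, hkz]
  have hι : Nonempty ι := by
    by_contra hemp
    rw [not_nonempty_iff] at hemp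
    simp at hw1
  obtain ⟨i₀⟩ := hι
  -- Sorting makes the triple visit its bounce points in the order of the orbit, so that its sides
  -- are chords of consecutive arcs.
  refine ⟨I ∘ Tuple.sort I, W ∘ Tuple.sort I, Tuple.monotone_sort I, fun j => hI' _, fun j => hW' _,
    ⟨(Tuple.sort I).symm (e i₀), ?_⟩, ?_⟩
  · simp only [Function.comp_apply, Equiv.apply_symm_apply, hI, hW]
    exact smul_ne_zero (hw i₀).ne' (hks' i₀).2
  · exact (Equiv.sum_comp (Tuple.sort I) fun j => W j • v (I j)).trans hsum'

/-- A bounce vector is the incoming minus the outgoing unit direction, so the sum telescopes and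
periodicity closes it. -/
lemma sum_bounceVector {q : ℤ → Plane} {N : ℕ} (hN : ∀ i : ℤ, q (i + N) = q i) :
    ∑ k ∈ Finset.range N, bounceVector q k = 0 := by
  let u : ℕ → Plane := fun k => ‖q k - q ((k : ℤ) - 1)‖⁻¹ • (q k - q ((k : ℤ) - 1))
  have h : ∀ k : ℕ, bounceVector q k = u k - u (k + 1) := fun k => by
    simp only [bounceVector, u, Nat.cast_add, Nat.cast_one, add_sub_cancel_right]
    rw [norm_sub_rev (q k) (q (k + 1)), ← neg_sub (q ((k : ℤ) + 1)), smul_neg, ← sub_eq_add_neg]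
  rw [Finset.sum_congr rfl fun k _ => h k, Finset.sum_range_sub', sub_eq_zero]
  have h0 := hN 0
  have h1 := hN (-1)
  rw [zero_add] at h0
  rw [neg_add_eq_sub] at h1
  simp only [u, Nat.cast_zero, zero_sub, h0, h1]

/-- Otherwise all steps would point in one direction and the orbit could not close up. -/
lemma IsOrbit.exists_bounceVector_ne {T : Set Plane} {q : ℤ → Plane} (hq : IsOrbit T q) {N : ℕ}
    (hN0 : 0 < N) (hN : ∀ i : ℤ, q (i + N) = q i) : ∃ k < N, bounceVector q k ≠ 0 := by
  by_contra! h
  let u : ℕ → Plane := fun k => ‖q (k + 1) - q (k : ℤ)‖⁻¹ • (q (k + 1) - q (k : ℤ))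
  have hstep : ∀ k, k + 1 < N → u (k + 1) = u k := fun k hk => by
    have := h (k + 1) hk
    simp only [bounceVector, Nat.cast_add, Nat.cast_one, add_sub_cancel_right] at this
    rw [norm_sub_rev (q (k + 1)) (q (k + 1 + 1)), ← neg_sub (q ((k : ℤ) + 1 + 1)), smul_neg,
      ← sub_eq_add_neg, sub_eq_zero] at this
    exact this.symm
  have hu : ∀ k, k < N → u k = u 0 := fun k => by
    induction k with
    | zero => exact fun _ => rfl
    | succ k ih => exact fun hk => (hstep k hk).trans (ih (by omega))
  have hsum : ∑ k ∈ Finset.range N, (q ((k : ℤ) + 1) - q k) = 0 := by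
    have := Finset.sum_range_sub (fun k : ℕ => q k) N
    simp only [Nat.cast_add, Nat.cast_one] at this
    rw [this, Nat.cast_zero, sub_eq_zero]
    simpa using hN 0
  have hk : ∀ k : ℕ, 0 < ‖q ((k : ℤ) + 1) - q k‖ := fun k =>
    norm_pos_iff.2 (sub_ne_zero.2 (hq.ne_succ k).symm)
  have h2 : ∑ k ∈ Finset.range N, (q ((k : ℤ) + 1) - q k) =
      (∑ k ∈ Finset.range N, ‖q ((k : ℤ) + 1) - q k‖) • u 0 := by
    rw [Finset.sum_smul]
    refine Finset.sum_congr rfl fun k hkN => ?_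
    rw [← hu k (Finset.mem_range.1 hkN), smul_inv_smul₀ (hk k).ne']
  rw [hsum] at h2
  have hpos : 0 < ∑ k ∈ Finset.range N, ‖q ((k : ℤ) + 1) - q k‖ :=
    Finset.sum_pos (fun k _ => hk k) ⟨0, Finset.mem_range.2 hN0⟩
  have hu0 : u 0 ≠ 0 := smul_ne_zero (inv_ne_zero (hk 0).ne')
    (sub_ne_zero.2 (hq.ne_succ (0 : ℕ)).symm)
  exact smul_ne_zero hpos.ne' hu0 h2.symm

/-- The vertices are three bounce points with balanced weighted bounce vectors. They split one
period into three arcs, and replacing arcs by chords does not lengthen. If nothing is gained, every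
arc is straight and the traces coincide. -/
theorem exists_pinned_of_mem_closedOrbits {T : Set Plane} (hT : IsClosed T) {q : ℤ → Plane}
    (hq : q ∈ closedOrbits T) :
    ∃ p n, Pinned T p n ∧ loopLength p ≤ orbitLength q ∧
      (orbitLength q ≤ loopLength p → trace q = loopTrace p) := by
  obtain ⟨ho, hper⟩ := hq
  obtain ⟨hN2, hN⟩ := Nat.sInf_mem hper
  change 2 ≤ period q at hN2
  set N := period q with hNdef
  change ∀ i : ℤ, q (i + N) = q i at hN
  have hN0 : 0 < N := by omega
  obtain ⟨I, w, hmono, hI, hw, ⟨j, hj⟩, hsum⟩ := exists_balanced_triple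
    (sum_bounceVector hN) (ho.exists_bounceVector_ne hN0 hN)
  have hIi : I 0 ≤ I 1 := hmono (by decide)
  have hIj : I 1 ≤ I 2 := hmono (by decide)
  have hIk : I 2 ≤ I 0 + N := by have := hI 2; omega
  let p : ZMod 3 → Plane := fun j => q (I j : ℕ)
  let n : ZMod 3 → Plane := fun j => w j • bounceVector q (I j : ℕ)
  have hq0 : q ((I 0 + N : ℕ) : ℤ) = q (I 0 : ℕ) := by rw [Nat.cast_add, hN]
  have hl : orbitLength q = arcLength q (I 0) (I 1) + arcLength q (I 1) (I 2) +
      arcLength q (I 2) (I 0 + N) := by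
    rw [arcLength_add q hIi hIj, arcLength_add q (hIi.trans hIj) hIk,
      arcLength_period q hN (hI 0).le, orbitLength, arcLength, ← hNdef, Finset.range_eq_Ico]
  have hp : loopLength p = ‖q (I 1 : ℕ) - q (I 0 : ℕ)‖ + ‖q (I 2 : ℕ) - q (I 1 : ℕ)‖ +
      ‖q ((I 0 + N : ℕ) : ℤ) - q (I 2 : ℕ)‖ := by
    rw [hq0, loopLength, sum_zmod_three]
    rfl
  have l0 := norm_sub_le_arcLength q hIi
  have l1 := norm_sub_le_arcLength q hIj
  have l2 := norm_sub_le_arcLength q hIk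
  refine ⟨p, n, ⟨fun h0 => hj (congrFun h0 j), hsum, fun i => ?_, fun i => ?_⟩, by linarith,
    fun hle => ?_⟩
  · exact hT.frontier_subset (ho.mem_frontier _)
  · exact (ho.support _).smul (hw i)
  · have s0 := insert_arc_eq_segment q hIi (by linarith)
    have s1 := insert_arc_eq_segment q hIj (by linarith)
    have s2 := insert_arc_eq_segment q hIk (by linarith)
    have ht := trace_eq_arc q hN0 hN (I 0)
    rw [← arc_union q (hIi.trans hIj) hIk, ← arc_union q hIi hIj] at ht
    have hmem : ∀ i : ℤ, q i ∈ trace q := fun i => mem_iUnion.2 ⟨i, left_mem_segment _ _ _⟩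
    have : loopTrace p = insert (q (I 0 : ℕ)) (arc q (I 0) (I 1)) ∪
        insert (q (I 1 : ℕ)) (arc q (I 1) (I 2)) ∪
        insert (q (I 2 : ℕ)) (arc q (I 2) (I 0 + N)) := by
      rw [s0, s1, s2, hq0]
      ext z
      simp only [loopTrace, mem_iUnion, mem_union]
      constructor
      · rintro ⟨i, hi⟩
        fin_cases i
        exacts [Or.inl (Or.inl hi), Or.inl (Or.inr hi), Or.inr hi]
      · rintro ((hi | hi) | hi)
        exacts [⟨0, hi⟩, ⟨1, hi⟩, ⟨2, hi⟩]
    rw [this]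
    have m0 := hmem (I 0 : ℕ)
    have m1 := hmem (I 1 : ℕ)
    have m2 := hmem (I 2 : ℕ)
    rw [ht] at m0 m1 m2 ⊢
    refine Subset.antisymm (union_subset_union (union_subset_union (subset_insert _ _)
      (subset_insert _ _)) (subset_insert _ _)) (union_subset (union_subset
      (insert_subset m0 ?_) (insert_subset m1 ?_)) (insert_subset m2 subset_union_right))
    · exact subset_union_left.trans subset_union_left
    · exact subset_union_right.trans subset_union_left

/-! ## Shortest orbits and shortest caged triples -/

/-- A translate of a shortest caged triple yields an orbit of the same length, and every closed
orbit dominates a caged triple. -/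
theorem minLength_eq {T : Set Plane} (hT : IsTable T) {p : ZMod 3 → Plane}
    (hs : IsShortestCaged T p) :
    IsLeast (orbitLength '' closedOrbits T) (loopLength p) ∧ minLength T = loopLength p := by
  have : IsLeast (orbitLength '' closedOrbits T) (loopLength p) := by
    obtain ⟨p', n', h', hs'⟩ := hs.exists_pinned hT
    have e : loopLength p = loopLength p' :=
      le_antisymm (hs.2 _ _ h'.caged) (let ⟨_, hn⟩ := hs.1; hs'.2 _ _ hn)
    obtain ⟨q, hq, hl, -⟩ := hs'.exists_orbit hT h'
    refine ⟨⟨q, hq, hl.trans e.symm⟩, ?_⟩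
    rintro _ ⟨q', hq', rfl⟩
    obtain ⟨p'', n'', h'', hle, -⟩ :=
      exists_pinned_of_mem_closedOrbits hT.isCompact.isClosed hq'
    exact (hs.2 _ _ h''.caged).trans hle
  exact ⟨this, this.csInf_eq⟩

lemma minLength_le {T : Set Plane} (hT : IsTable T) {p n : ZMod 3 → Plane} (h : Caged T p n) :
    minLength T ≤ loopLength p := by
  obtain ⟨p', hp'⟩ := exists_isShortestCaged hT.isCompact
  rw [(minLength_eq hT hp').2]
  exact hp'.2 _ _ h

lemma isShortestCaged_iff {T : Set Plane} (hT : IsTable T) {p n : ZMod 3 → Plane}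
    (h : Caged T p n) : IsShortestCaged T p ↔ loopLength p = minLength T :=
  ⟨fun hs => (minLength_eq hT hs).2.symm, fun hl =>
    ⟨⟨n, h⟩, fun _ _ h' => hl.trans_le (minLength_le hT h')⟩⟩

/-- A shortest orbit has the trace of a pinned triple of minimal length. -/
theorem exists_pinned_of_mem_shortestOrbits {T : Set Plane} (hT : IsTable T) {q : ℤ → Plane}
    (hq : q ∈ shortestOrbits T) :
    ∃ p n, Pinned T p n ∧ loopLength p = minLength T ∧ trace q = loopTrace p := by
  obtain ⟨p₀, hp₀⟩ := exists_isShortestCaged hT.isCompact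
  obtain ⟨⟨⟨q₀, hq₀, hq₀l⟩, -⟩, hmin⟩ := minLength_eq hT hp₀
  obtain ⟨p, n, h, hle, ht⟩ := exists_pinned_of_mem_closedOrbits hT.isCompact.isClosed hq.1
  have h1 : orbitLength q ≤ minLength T := by
    rw [hmin, ← hq₀l]
    exact hq.2 _ hq₀
  have h2 := minLength_le hT h.caged
  exact ⟨p, n, h, by linarith, ht (by linarith)⟩

/-- A pinned triple of minimal length is the trace of a shortest orbit. -/
theorem exists_mem_shortestOrbits {T : Set Plane} (hT : IsTable T) {p n : ZMod 3 → Plane}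
    (h : Pinned T p n) (hl : loopLength p = minLength T) :
    ∃ q ∈ shortestOrbits T, trace q = loopTrace p := by
  have hs := (isShortestCaged_iff hT h.caged).2 hl
  obtain ⟨q, hq, hql, ht⟩ := hs.exists_orbit hT h
  refine ⟨q, ⟨hq, fun q' hq' => ?_⟩, ht⟩
  rw [hql]
  exact (minLength_eq hT hs).1.2 ⟨q', hq', rfl⟩

/-! ## Polygons -/

/-- The intersection of a polygon with a half-plane is a polygon. -/
theorem exists_convexHull_inter_halfspace (X : Finset Plane) (v : Plane) (c : ℝ) :
    ∃ Y : Finset Plane, convexHull ℝ (X : Set Plane) ∩ {x | inner ℝ x v ≤ c} =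
      convexHull ℝ (Y : Set Plane) := by
  classical
  let g : Plane → ℝ := fun x => inner ℝ x v - c
  let A := X.filter fun x => g x ≤ 0
  let B := X.filter fun x => 0 < g x
  -- For `g x ≤ 0 < g y` this is the point where the segment from `x` to `y` meets the boundary line
  -- `g = 0`.
  let cr : Plane → Plane → Plane := fun x y => (g y / (g y - g x)) • x + (-g x / (g y - g x)) • y
  let Y := A ∪ Finset.image₂ cr A B
  have hAX : ∀ x ∈ A, x ∈ X ∧ g x ≤ 0 := fun x hx => Finset.mem_filter.1 hx
  have hBX : ∀ x ∈ B, x ∈ X ∧ 0 < g x := fun x hx => Finset.mem_filter.1 hx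
  have hA : ∀ x ∈ A, x ∈ convexHull ℝ (Y : Set Plane) := fun x hx =>
    subset_convexHull _ _ (Finset.mem_union_left _ hx)
  have hcr : ∀ x ∈ A, ∀ y ∈ B, cr x y ∈ convexHull ℝ (Y : Set Plane) := fun x hx y hy =>
    subset_convexHull _ _ (Finset.mem_union_right _ (Finset.mem_image₂_of_mem hx hy))
  have hlin : ∀ m : ℝ, IsLinearMap ℝ fun x : Plane => m * inner ℝ x v := fun m =>
    ⟨fun x y => by rw [inner_add_left, mul_add], fun a x => by
      rw [inner_smul_left, conj_trivial, smul_eq_mul]; ring⟩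
  have hlin' : ∀ (m : ℝ) (f : StrongDual ℝ Plane),
      IsLinearMap ℝ fun x : Plane => f x - m * inner ℝ x v := fun m f =>
    ⟨fun x y => by rw [map_add, (hlin m).map_add]; ring, fun a x => by
      rw [map_smul, (hlin m).map_smul, smul_sub]⟩
  refine ⟨Y, Subset.antisymm ?_ (convexHull_min ?_ ((convex_convexHull _ _).inter ?_))⟩
  · rintro z ⟨hzX, hz⟩
    change inner ℝ z v ≤ c at hz
    by_contra hzY
    obtain ⟨f, u, hfY, hfz⟩ := geometric_hahn_banach_closed_point (convex_convexHull ℝ (Y : Set Plane))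
      (Y.finite_toSet.isClosed_convexHull ℝ) hzY
    let ψ : Plane → ℝ := fun x => f x - f z
    have hψA : ∀ x ∈ A, ψ x < 0 := fun x hx => by
      have := hfY _ (hA x hx)
      simp only [ψ]; linarith
    have hψ : ∀ x ∈ A, ∀ y ∈ B, g y * ψ x < g x * ψ y := fun x hx y hy => by
      have h1 := hfY _ (hcr x hx y hy)
      have hgx := (hAX x hx).2
      have hgy := (hBX y hy).2
      have hgxy : 0 < g y - g x := by linarith
      have h2 : f (cr x y) * (g y - g x) = g y * f x - g x * f y := by
        simp only [cr, map_add, map_smul, smul_eq_mul]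
        field_simp
        ring
      have h3 : f (cr x y) * (g y - g x) < f z * (g y - g x) :=
        mul_lt_mul_of_pos_right (h1.trans hfz) hgxy
      simp only [ψ]
      linarith
    -- A multiplier `m` with `ψ < m * g` on all of `X` is sought. Points outside the half-plane
    -- bound `m` from below, points strictly inside from above, and the crossing points make these
    -- bounds compatible. The extra lower bound `0` makes `m` positive.
    obtain ⟨m, hlo, hhi⟩ := Order.exists_between_finsets
      (insert 0 (B.image fun y => ψ y / g y))
      ((A.filter fun x => g x < 0).image fun x => ψ x / g x) (fun s hs t ht => by
        obtain ⟨x, hx, rfl⟩ := Finset.mem_image.1 ht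
        obtain ⟨hxA, hgx⟩ := Finset.mem_filter.1 hx
        obtain rfl | hs := Finset.mem_insert.1 hs
        · exact div_pos_of_neg_of_neg (hψA x hxA) hgx
        · obtain ⟨y, hy, rfl⟩ := Finset.mem_image.1 hs
          have := hψ x hxA y hy
          rw [div_lt_iff₀ (hBX y hy).2, div_mul_eq_mul_div, lt_div_iff_of_neg hgx]
          linarith)
    have hm : 0 < m := hlo 0 (Finset.mem_insert_self _ _)
    have key : ∀ x ∈ X, ψ x < m * g x := fun x hx => by
      by_cases hgx : 0 < g x
      · have hxB : x ∈ B := Finset.mem_filter.2 ⟨hx, hgx⟩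
        have := hlo _ (Finset.mem_insert_of_mem (Finset.mem_image_of_mem _ hxB))
        rwa [div_lt_iff₀ hgx] at this
      · have hxA : x ∈ A := Finset.mem_filter.2 ⟨hx, not_lt.1 hgx⟩
        obtain h0 | h0 := (not_lt.1 hgx).lt_or_eq
        · have := hhi _ (Finset.mem_image_of_mem _ (Finset.mem_filter.2 ⟨hxA, h0⟩))
          rwa [lt_div_iff_of_neg h0] at this
        · rw [h0, mul_zero]
          exact hψA x hxA
    have hsub : convexHull ℝ (X : Set Plane) ⊆ {x | f x - m * inner ℝ x v < f z - m * c} := by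
      refine convexHull_min (fun x hx => ?_) (convex_halfSpace_lt (hlin' m f) _)
      have := key x hx
      simp only [ψ, g] at this
      rw [mem_ofPred_eq]
      linarith
    have hzz : f z - m * inner ℝ z v < f z - m * c := hsub hzX
    nlinarith
  · intro x hx
    obtain hx | hx := Finset.mem_union.1 (Finset.mem_coe.1 hx)
    · refine ⟨subset_convexHull _ _ (hAX x hx).1, ?_⟩
      have := (hAX x hx).2
      rw [mem_ofPred_eq]
      simp only [g] at this
      linarith
    · obtain ⟨a, ha, b, hb, rfl⟩ := Finset.mem_image₂.1 hx
      have hga := (hAX a ha).2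
      have hgb := (hBX b hb).2
      have hab : 0 < g b - g a := by linarith
      have hsum : g b / (g b - g a) + -g a / (g b - g a) = 1 := by field_simp; ring
      refine ⟨convex_convexHull ℝ _ (subset_convexHull _ _ (hAX a ha).1)
        (subset_convexHull _ _ (hBX b hb).1) (by positivity)
        (div_nonneg (by linarith) hab.le) hsum, ?_⟩
      rw [mem_ofPred_eq]
      refine le_of_eq ?_
      simp only [cr, inner_add_left, inner_smul_left, conj_trivial]
      have e1 : inner ℝ a v = g a + c := by simp only [g]; ring
      have e2 : inner ℝ b v = g b + c := by simp only [g]; ring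
      rw [e1, e2]
      linear_combination c * hsum
  · simpa using convex_halfSpace_le (hlin 1) c

/-! ## Polygonal approximation -/

lemma homothety_eq (p : Plane) (r : ℝ) (s : Plane) :
    AffineMap.homothety p r s = r • s + (p - r • p) := by
  rw [AffineMap.homothety_apply, vsub_eq_sub, vadd_eq_add]
  module

lemma homothety_inv_homothety (p : Plane) {r : ℝ} (hr : r ≠ 0) (s : Plane) :
    AffineMap.homothety p r (AffineMap.homothety p r⁻¹ s) = s := by
  rw [homothety_eq, homothety_eq]
  match_scalars <;> field_simp
  ring

lemma homothety_homothety_inv (p : Plane) {r : ℝ} (hr : r ≠ 0) (s : Plane) :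
    AffineMap.homothety p r⁻¹ (AffineMap.homothety p r s) = s := by
  have := homothety_inv_homothety p (inv_ne_zero hr) s
  rwa [inv_inv] at this

lemma IsApprox.exists_eq {p : Plane} {ε : ℝ} {S T : Set Plane} (h : IsApprox p ε S T) :
    ∀ x ∈ T, ∃ s ∈ S, x = (1 + ε) • s + (p - (1 + ε) • p) := fun x hx => by
  obtain ⟨s, hs, rfl⟩ := h.subset_dilation hx
  exact ⟨s, hs, homothety_eq _ _ _⟩

/-- A polygon between `T` and its dilation becomes an inner approximation when contracted by the
same factor. -/
lemma isApprox_of_outer {T : Set Plane} (hT : IsTable T) {p : Plane} {ε : ℝ} (hε : 0 < ε)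
    {F : Finset Plane} (hTF : T ⊆ convexHull ℝ (F : Set Plane))
    (hF : convexHull ℝ (F : Set Plane) ⊆ AffineMap.homothety p (1 + ε) '' T) :
    IsApprox p ε (AffineMap.homothety p (1 + ε)⁻¹ '' convexHull ℝ (F : Set Plane)) T := by
  classical
  have hr : 1 + ε ≠ 0 := by positivity
  have heq : AffineMap.homothety p (1 + ε)⁻¹ '' convexHull ℝ (F : Set Plane) =
      convexHull ℝ ((F.image (AffineMap.homothety p (1 + ε)⁻¹) : Finset Plane) : Set Plane) := by
    rw [AffineMap.image_convexHull, Finset.coe_image]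
  refine ⟨⟨⟨?_, ?_, ?_⟩, _, heq⟩, ?_, fun x hx => ?_⟩
  · rw [heq]
    exact convex_convexHull _ _
  · rw [heq]
    exact (Finset.finite_toSet _).isCompact_convexHull ℝ
  · exact ((hT.interior_nonempty.mono (interior_mono hTF)).image _).mono
      ((AffineMap.homothety_isOpenMap p _ (inv_ne_zero hr)).image_interior_subset _)
  · rintro _ ⟨x, hx, rfl⟩
    obtain ⟨y, hy, rfl⟩ := hF hx
    rwa [homothety_homothety_inv p hr]
  · exact ⟨_, ⟨x, hTF hx, rfl⟩, homothety_inv_homothety p hr x⟩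

/-- Dilation about an interior point moves `T` into the interior of its image, which leaves room for
a polygon in between. -/
lemma exists_outer_polygon {T : Set Plane} (hT : IsTable T) {p : Plane} (hp : p ∈ interior T)
    {ε : ℝ} (hε : 0 < ε) : ∃ F : Finset Plane, T ⊆ convexHull ℝ (F : Set Plane) ∧
      convexHull ℝ (F : Set Plane) ⊆ AffineMap.homothety p (1 + ε) '' T := by
  obtain ⟨F, hF, hF'⟩ := hT.convex.exists_subset_interior_convexHull_finset_of_isCompact
    hT.isCompact (t := AffineMap.homothety p (1 + ε) '' T) (subset_interior_iff_mem_nhdsSet.1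
      (hT.convex.subset_interior_image_homothety_of_one_lt hp _ (by linarith)))
  exact ⟨F, hF.trans interior_subset, hF'⟩

theorem exists_isApprox {T : Set Plane} (hT : IsTable T) {p : Plane} (hp : p ∈ interior T)
    {ε : ℝ} (hε : 0 < ε) : ∃ S, IsApprox p ε S T :=
  let ⟨_, hF, hF'⟩ := exists_outer_polygon hT hp hε
  ⟨_, isApprox_of_outer hT hε hF hF'⟩

lemma minLength_le_of_isApprox {S T : Set Plane} (hT : IsTable T) {p : Plane} {ε : ℝ}
    (hε : 0 < ε) (h : IsApprox p ε S T) : minLength T ≤ (1 + ε) * minLength S := by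
  have hS := h.polygonal.isTable
  obtain ⟨q, hq⟩ := exists_isShortestCaged hS.isCompact
  obtain ⟨n, hn⟩ := hq.1
  rw [(minLength_eq hS hq).2, ← loopLength_smul_add (by positivity) (p - (1 + ε) • p)]
  exact minLength_le hT (hn.dilate (by positivity) h.exists_eq)

lemma minLength_mono {S T : Set Plane} (hS : IsTable S) (hT : IsTable T) (h : S ⊆ T) :
    minLength S ≤ minLength T := by
  obtain ⟨q, hq⟩ := exists_isShortestCaged hT.isCompact
  obtain ⟨n, hn⟩ := hq.1
  rw [(minLength_eq hT hq).2]
  exact minLength_le hS (hn.mono h)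

/-! ## Convergence of shortest orbits -/

lemma isCompact_segment (a b : Plane) : IsCompact (segment ℝ a b) := by
  rw [segment_eq_image_lineMap]
  exact isCompact_Icc.image AffineMap.lineMap_continuous

lemma isCompact_loopTrace (p : ZMod 3 → Plane) : IsCompact (loopTrace p) :=
  isCompact_iUnion fun _ => isCompact_segment _ _

lemma exists_mem_loopTrace_edist_le (p p' : ZMod 3 → Plane) :
    ∀ x ∈ loopTrace p, ∃ y ∈ loopTrace p', edist x y ≤ edist p p' := by
  intro x hx
  obtain ⟨i, a, b, ha, hb, hab, rfl⟩ := mem_iUnion.1 hx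
  refine ⟨a • p' i + b • p' (i + 1), mem_iUnion.2 ⟨i, a, b, ha, hb, hab, rfl⟩, ?_⟩
  rw [edist_dist, edist_dist]
  refine ENNReal.ofReal_le_ofReal ?_
  have e : a • p i + b • p (i + 1) - (a • p' i + b • p' (i + 1)) =
      a • (p - p') i + b • (p - p') (i + 1) := by
    simp only [Pi.sub_apply]
    module
  rw [dist_eq_norm, dist_eq_norm, e]
  refine (norm_add_le _ _).trans ?_
  rw [norm_smul, norm_smul, Real.norm_of_nonneg ha, Real.norm_of_nonneg hb]
  have h1 := norm_le_pi_norm (p - p') i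
  have h2 := norm_le_pi_norm (p - p') (i + 1)
  calc a * ‖(p - p') i‖ + b * ‖(p - p') (i + 1)‖ ≤ a * ‖p - p'‖ + b * ‖p - p'‖ := by gcongr
    _ = ‖p - p'‖ := by rw [← add_mul, hab, one_mul]

lemma tendsto_hausdorffEDist_loopTrace {P : ℕ → ZMod 3 → Plane} {p : ZMod 3 → Plane}
    (h : Tendsto P atTop (𝓝 p)) :
    Tendsto (fun n => Metric.hausdorffEDist (loopTrace (P n)) (loopTrace p)) atTop (𝓝 0) := by
  refine tendsto_of_tendsto_of_tendsto_of_le_of_le tendsto_const_nhds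
    (tendsto_iff_edist_tendsto_0.1 h) (fun _ => zero_le) fun n => ?_
  refine Metric.hausdorffEDist_le_of_mem_edist (exists_mem_loopTrace_edist_le _ _) ?_
  rw [edist_comm]
  exact exists_mem_loopTrace_edist_le _ _

/-- The centre is arbitrary, so the translation part `w` of the dilation needs a bound of its own.
Take `s` minimising the inner product with `w` on `S`, and write `s = (1 + ε) • s' + w` with `s'` in
`S`. Minimality gives `‖w‖ ^ 2 ≤ -ε * inner ℝ s' w`, hence `‖w‖ ≤ ε * R`. -/
lemma IsApprox.exists_norm_sub_le {S T : Set Plane} {R : ℝ}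
    (hR : ∀ x ∈ T, ‖x‖ ≤ R) {p : Plane} {ε : ℝ} (hε : 0 < ε) (h : IsApprox p ε S T) :
    ∀ x ∈ T, ∃ s ∈ S, ‖x - s‖ ≤ 2 * (ε * R) := by
  have hS := h.polygonal.isTable
  set w := p - (1 + ε) • p with hw
  have hSne : S.Nonempty := hS.interior_nonempty.mono interior_subset
  have hwR : ‖w‖ ≤ ε * R := by
    obtain ⟨s, hs, hmin⟩ := hS.isCompact.exists_isMinOn hSne
      (f := fun x : Plane => inner ℝ x w) (by fun_prop)
    obtain ⟨s', hs', he⟩ := h.exists_eq s (h.subset hs)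
    have h1 : inner ℝ s w ≤ inner ℝ s' w := hmin hs'
    have h2 : inner ℝ s w = (1 + ε) * inner ℝ s' w + ‖w‖ ^ 2 := by
      conv_lhs => rw [he]
      rw [← hw, inner_add_left, inner_smul_left, conj_trivial, real_inner_self_eq_norm_sq]
    have h3 : -(‖s'‖ * ‖w‖) ≤ inner ℝ s' w :=
      (abs_le.1 (abs_real_inner_le_norm s' w)).1
    have h4 := hR s' (h.subset hs')
    have h5 := norm_nonneg w
    have h6 : ‖w‖ ^ 2 ≤ ε * R * ‖w‖ := by
      have : ‖s'‖ * ‖w‖ ≤ R * ‖w‖ := by gcongr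
      nlinarith
    by_contra! hlt
    have h7 : 0 ≤ ε * R := mul_nonneg hε.le ((norm_nonneg _).trans h4)
    nlinarith
  intro x hx
  obtain ⟨s, hs, rfl⟩ := h.exists_eq x hx
  refine ⟨s, hs, ?_⟩
  have e : (1 + ε) • s + w - s = ε • s + w := by module
  rw [e]
  refine (norm_add_le _ _).trans ?_
  rw [norm_smul, Real.norm_of_nonneg hε.le]
  have := mul_le_mul_of_nonneg_left (hR s (h.subset hs)) hε.le
  linarith

/-- Extract a limit of pinned triples with weights of norm one. Each point of `T` is a limit of
points of the approximations, so the limit is pinned in `T`; its length is squeezed between the two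
estimates for `minLength`. -/
theorem exists_subseq_tracesConvergeTo {T : Set Plane} (hT : IsTable T) {p : ℕ → Plane}
    {ε : ℕ → ℝ} {S : ℕ → Set Plane} {c : ℕ → ℤ → Plane} (hε : ∀ n, 0 < ε n)
    (hε0 : Tendsto ε atTop (𝓝 0)) (hS : ∀ n, IsApprox (p n) (ε n) (S n) T)
    (hc : ∀ n, c n ∈ shortestOrbits (S n)) :
    ∃ φ : ℕ → ℕ, StrictMono φ ∧
      ∃ c' ∈ shortestOrbits T, TracesConvergeTo (fun n => c (φ n)) (trace c') := by
  choose P N hPN hPl hPt using fun n =>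
    exists_pinned_of_mem_shortestOrbits (hS n).polygonal.isTable (hc n)
  let N' : ℕ → ZMod 3 → Plane := fun n => ‖N n‖⁻¹ • N n
  have hPN' : ∀ n, Pinned (S n) (P n) (N' n) := fun n => (hPN n).normalize
  have hN' : ∀ n, ‖N' n‖ = 1 := fun n => by
    rw [norm_smul, norm_inv, norm_norm, inv_mul_cancel₀ (norm_ne_zero_iff.2 (hPN n).ne_zero)]
  have hcomp : IsCompact ((univ.pi fun _ : ZMod 3 => T) ×ˢ
      Metric.sphere (0 : ZMod 3 → Plane) 1) :=
    (isCompact_univ_pi fun _ => hT.isCompact).prod (isCompact_sphere _ _)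
  obtain ⟨⟨P₀, N₀⟩, ⟨hP₀, hN₀⟩, φ, hφ, hlim⟩ := hcomp.tendsto_subseq
    (x := fun n => (P n, N' n)) fun n => ⟨fun i _ => (hS n).subset ((hPN n).mem i), by
      rw [mem_sphere_zero_iff_norm, hN']⟩
  have hlimP : Tendsto (fun n => P (φ n)) atTop (𝓝 P₀) :=
    (continuous_fst.tendsto _).comp hlim
  have hlimN : Tendsto (fun n => N' (φ n)) atTop (𝓝 N₀) :=
    (continuous_snd.tendsto _).comp hlim
  have hPi := fun i => (continuous_apply i).continuousAt.tendsto.comp hlimP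
  have hNi := fun i => (continuous_apply i).continuousAt.tendsto.comp hlimN
  have hεφ := hε0.comp hφ.tendsto_atTop
  obtain ⟨R, hR⟩ := hT.isCompact.isBounded.exists_norm_le
  have hpin : Pinned T P₀ N₀ := by
    refine ⟨fun h0 => ?_, ?_, fun i => hP₀ i (mem_univ i), fun i x hx => ?_⟩
    · rw [h0] at hN₀
      simp at hN₀
    · refine tendsto_nhds_unique (tendsto_finsetSum _ fun i _ => hNi i) ?_
      refine tendsto_const_nhds.congr fun n => ?_
      exact (hPN' (φ n)).sum_eq.symm
    · choose s hs hxs using fun n => (hS n).exists_norm_sub_le hR (hε n) x hx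
      have hslim : Tendsto (fun n => s (φ n)) atTop (𝓝 x) := by
        rw [tendsto_iff_norm_sub_tendsto_zero]
        have h2 : Tendsto (fun n => 2 * (ε (φ n) * R)) atTop (𝓝 0) := by
          simpa using (hεφ.mul_const R).const_mul 2
        refine squeeze_zero (fun _ => norm_nonneg _) (fun n => ?_) h2
        rw [norm_sub_rev]
        exact hxs (φ n)
      exact le_of_tendsto ((hslim.sub (hPi i)).inner (hNi i))
        (Eventually.of_forall fun n => (hPN' (φ n)).support i _ (hs (φ n)))
  have hlen : loopLength P₀ = minLength T := by
    have h1 : Tendsto (fun n => loopLength (P (φ n))) atTop (𝓝 (loopLength P₀)) :=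
      (continuous_loopLength.tendsto _).comp hlimP
    have h2 : loopLength P₀ ≤ minLength T :=
      le_of_tendsto h1 (Eventually.of_forall fun n => by
        rw [hPl]
        exact minLength_mono (hS _).polygonal.isTable hT (hS _).subset)
    have h3 : Tendsto (fun n => (1 + ε (φ n)) * loopLength (P (φ n))) atTop
        (𝓝 ((1 + 0) * loopLength P₀)) := (tendsto_const_nhds.add hεφ).mul h1
    have h4 : minLength T ≤ (1 + 0) * loopLength P₀ :=
      ge_of_tendsto h3 (Eventually.of_forall fun n => by
        rw [hPl]
        exact minLength_le_of_isApprox hT (hε _) (hS _))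
    linarith
  obtain ⟨c', hc', ht'⟩ := exists_mem_shortestOrbits hT hpin hlen
  refine ⟨φ, hφ, c', hc', ?_⟩
  unfold TracesConvergeTo
  simp only [hPt, ht']
  exact tendsto_hausdorffEDist_loopTrace hlimP

theorem exists_trace_eq_of_tracesConvergeTo {T : Set Plane} (hT : IsTable T) {p : ℕ → Plane}
    {ε : ℕ → ℝ} {S : ℕ → Set Plane} {c : ℕ → ℤ → Plane} (hε : ∀ n, 0 < ε n)
    (hε0 : Tendsto ε atTop (𝓝 0)) (hS : ∀ n, IsApprox (p n) (ε n) (S n) T)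
    (hc : ∀ n, c n ∈ shortestOrbits (S n)) {K : Set Plane} (hK : IsCompact K)
    (hcK : TracesConvergeTo c K) : ∃ c' ∈ shortestOrbits T, trace c' = K := by
  obtain ⟨φ, hφ, c', hc', hlim⟩ := exists_subseq_tracesConvergeTo hT hε hε0 hS hc
  refine ⟨c', hc', ?_⟩
  have hclosed : IsClosed (trace c') := by
    obtain ⟨p', n', -, -, ht⟩ := exists_pinned_of_mem_shortestOrbits hT hc'
    rw [ht]
    exact (isCompact_loopTrace p').isClosed
  rw [← hclosed.hausdorffEDist_zero_iff hK.isClosed]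
  have h1 : Tendsto (fun n => Metric.hausdorffEDist (trace (c (φ n))) (trace c') +
      Metric.hausdorffEDist (trace (c (φ n))) K) atTop (𝓝 (0 + 0)) :=
    hlim.add (hcK.comp hφ.tendsto_atTop)
  rw [add_zero] at h1
  refine le_antisymm (ge_of_tendsto h1 (Eventually.of_forall fun n => ?_)) zero_le
  rw [Metric.hausdorffEDist_comm (s := trace (c (φ n))) (t := trace c')]
  exact Metric.hausdorffEDist_triangle

/-- An outer polygon is cut by the three half-planes with normals `N i` through the `P i`. They
contain `T`, so the result is still an outer polygon, and after contraction the image of `P` is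
pinned. Its length `minLength T / (1 + ε)` is at most `minLength S`, hence equal to it. -/
lemma exists_isApprox_pinned {T : Set Plane} (hT : IsTable T) {P N : ZMod 3 → Plane}
    (h : Pinned T P N) (hl : loopLength P = minLength T) {p : Plane} (hp : p ∈ interior T)
    {ε : ℝ} (hε : 0 < ε) :
    ∃ S, IsApprox p ε S T ∧ Pinned S (fun i => AffineMap.homothety p (1 + ε)⁻¹ (P i)) N ∧
      loopLength (fun i => AffineMap.homothety p (1 + ε)⁻¹ (P i)) = minLength S := by
  obtain ⟨F, hTF, hF⟩ := exists_outer_polygon hT hp hε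
  have hcut : ∀ (G : Finset Plane) (i : ZMod 3), T ⊆ convexHull ℝ (G : Set Plane) →
      ∃ G' : Finset Plane, T ⊆ convexHull ℝ (G' : Set Plane) ∧
        convexHull ℝ (G' : Set Plane) ⊆ convexHull ℝ (G : Set Plane) ∧
        IsOutwardSupport (convexHull ℝ (G' : Set Plane)) (P i) (N i) := fun G i hG => by
    obtain ⟨G', hG'⟩ := exists_convexHull_inter_halfspace G (N i) (inner ℝ (P i) (N i))
    refine ⟨G', ?_, ?_, fun x hx => ?_⟩
    · rw [← hG']
      refine subset_inter hG fun x hx => ?_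
      have := h.support i x hx
      rw [inner_sub_left, sub_nonpos] at this
      exact this
    · rw [← hG']
      exact inter_subset_left
    · rw [← hG'] at hx
      rw [inner_sub_left, sub_nonpos]
      exact hx.2
  obtain ⟨F0, hT0, hF0, hs0⟩ := hcut F 0 hTF
  obtain ⟨F1, hT1, hF1, hs1⟩ := hcut F0 1 hT0
  obtain ⟨F2, hT2, hF2, hs2⟩ := hcut F1 2 hT1
  have happ := isApprox_of_outer hT hε hT2 (hF2.trans (hF1.trans (hF0.trans hF)))
  have hr : 0 < 1 + ε := by positivity
  have hsup : ∀ i, IsOutwardSupport (convexHull ℝ (F2 : Set Plane)) (P i) (N i) :=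
    forall_zmod_three.2 ⟨fun x hx => hs0 x (hF1 (hF2 hx)), fun x hx => hs1 x (hF2 hx), hs2⟩
  have hpin : Pinned (AffineMap.homothety p (1 + ε)⁻¹ '' convexHull ℝ (F2 : Set Plane))
      (fun i => AffineMap.homothety p (1 + ε)⁻¹ (P i)) N := by
    refine ⟨h.ne_zero, h.sum_eq, fun i => ⟨P i, hT2 (h.mem i), rfl⟩, ?_⟩
    rintro i _ ⟨x, hx, rfl⟩
    rw [homothety_eq, homothety_eq, add_sub_add_right_eq_sub, ← smul_sub, inner_smul_left,
      conj_trivial]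
    exact mul_nonpos_of_nonneg_of_nonpos (by positivity) (hsup i x hx)
  refine ⟨_, happ, hpin, le_antisymm ?_ (minLength_le happ.polygonal.isTable hpin.caged)⟩
  have h1 := minLength_le_of_isApprox hT hε happ
  simp only [homothety_eq p _ (P _)]
  rw [loopLength_smul_add (by positivity), hl, inv_mul_le_iff₀ hr]
  exact h1

theorem exists_approximating_orbits {T : Set Plane} (hT : IsTable T) {c' : ℤ → Plane}
    (hc' : c' ∈ shortestOrbits T) {p : Plane} (hp : p ∈ interior T) {ε : ℕ → ℝ}
    (hε : ∀ n, 0 < ε n) (hε0 : Tendsto ε atTop (𝓝 0)) :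
    ∃ (S : ℕ → Set Plane) (c : ℕ → ℤ → Plane),
      (∀ n, IsApprox p (ε n) (S n) T) ∧ (∀ n, c n ∈ shortestOrbits (S n)) ∧
      TracesConvergeTo c (trace c') := by
  obtain ⟨P, N, h, hl, ht⟩ := exists_pinned_of_mem_shortestOrbits hT hc'
  choose S hS hpin hlen using fun n => exists_isApprox_pinned hT h hl hp (hε n)
  choose c hc hct using fun n =>
    exists_mem_shortestOrbits (hS n).polygonal.isTable (hpin n) (hlen n)
  refine ⟨S, c, hS, hc, ?_⟩
  unfold TracesConvergeTo
  simp only [hct, ht]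
  refine tendsto_hausdorffEDist_loopTrace (tendsto_pi_nhds.2 fun i => ?_)
  have h1 : Tendsto (fun n => (1 + ε n)⁻¹) atTop (𝓝 1) := by
    have := (hε0.const_add 1).inv₀ (by norm_num)
    simpa using this
  simp only [homothety_eq]
  have h2 : Tendsto (fun n => (1 + ε n)⁻¹ • P i + (p - (1 + ε n)⁻¹ • p)) atTop
      (𝓝 ((1 : ℝ) • P i + (p - (1 : ℝ) • p))) :=
    (h1.smul_const _).add ((h1.smul_const p).const_sub p)
  simpa using h2

/-! ## Plane geometry in coordinates -/

/-- Rotation by a right angle. -/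
noncomputable def rot (v : Plane) : Plane := !₂[-v 1, v 0]

/-- The determinant of two vectors. -/
def cross (a b : Plane) : ℝ := a 0 * b 1 - a 1 * b 0

@[simp] lemma rot_zero_apply (v : Plane) : rot v 0 = -v 1 := rfl
@[simp] lemma rot_one_apply (v : Plane) : rot v 1 = v 0 := rfl

lemma inner_eq (a b : Plane) : inner ℝ a b = a 0 * b 0 + a 1 * b 1 := by
  simp [PiLp.inner_apply, mul_comm]

lemma norm_sq_eq (a : Plane) : ‖a‖ ^ 2 = a 0 ^ 2 + a 1 ^ 2 := by
  rw [← real_inner_self_eq_norm_sq, inner_eq]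
  ring

lemma plane_ext {a b : Plane} (h0 : a 0 = b 0) (h1 : a 1 = b 1) : a = b := by
  ext i
  fin_cases i
  exacts [h0, h1]

lemma rot_add (a b : Plane) : rot (a + b) = rot a + rot b :=
  plane_ext (by simp; ring) (by simp)

lemma rot_sub (a b : Plane) : rot (a - b) = rot a - rot b :=
  plane_ext (by simp; ring) (by simp)

lemma rot_smul (c : ℝ) (a : Plane) : rot (c • a) = c • rot a :=
  plane_ext (by simp) (by simp)

lemma inner_rot_self (a : Plane) : inner ℝ a (rot a) = 0 := by
  rw [inner_eq, rot_zero_apply, rot_one_apply]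
  ring

lemma norm_rot (a : Plane) : ‖rot a‖ = ‖a‖ := by
  rw [← sq_eq_sq₀ (norm_nonneg _) (norm_nonneg _), norm_sq_eq, norm_sq_eq, rot_zero_apply,
    rot_one_apply]
  ring

lemma norm_add_smul_rot_sq (a : Plane) (t : ℝ) : ‖a + t • rot a‖ ^ 2 = (1 + t ^ 2) * ‖a‖ ^ 2 := by
  simp only [norm_sq_eq, PiLp.add_apply, PiLp.smul_apply, rot_zero_apply, rot_one_apply,
    smul_eq_mul]
  ring

lemma exists_eq_smul_rot {z w : Plane} (hz : z ≠ 0) (h : inner ℝ z w = 0) :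
    ∃ k : ℝ, w = k • rot z := by
  have hN : z 0 ^ 2 + z 1 ^ 2 ≠ 0 := by
    rw [← norm_sq_eq]
    exact pow_ne_zero 2 (norm_ne_zero_iff.2 hz)
  rw [inner_eq] at h
  refine ⟨(z 0 * w 1 - z 1 * w 0) / (z 0 ^ 2 + z 1 ^ 2), plane_ext ?_ ?_⟩
  · rw [PiLp.smul_apply, rot_zero_apply, smul_eq_mul, div_mul_eq_mul_div, eq_div_iff hN]
    linear_combination z 0 * h
  · rw [PiLp.smul_apply, rot_one_apply, smul_eq_mul, div_mul_eq_mul_div, eq_div_iff hN]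
    linear_combination z 1 * h

/-- For equal norms `a + b` is orthogonal to `a - b`. Hence adding `t • rot a` to `a` and
subtracting `t • rot b` from `b` only rescales their difference. -/
lemma exists_rot_add_eq_smul_sub {a b : Plane} (hab : ‖a‖ = ‖b‖) (hne : a - b ≠ 0) :
    ∃ k : ℝ, rot (a + b) = k • (a - b) := by
  have h1 : inner ℝ (a - b) (a + b) = 0 := by
    rw [inner_sub_left, inner_add_right, inner_add_right, real_inner_self_eq_norm_sq,
      real_inner_self_eq_norm_sq, hab, real_inner_comm]
    ring
  obtain ⟨k, hk⟩ := exists_eq_smul_rot hne h1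
  refine ⟨-k, ?_⟩
  rw [hk, rot_smul]
  exact plane_ext (by simp; ring) (by simp; ring)

lemma cross_cycle (a b c : Plane) : cross b c • a + cross c a • b + cross a b • c = 0 :=
  plane_ext (by simp [cross]; ring) (by simp [cross]; ring)

lemma cross_comm (a b : Plane) : cross a b = -cross b a := by
  unfold cross
  ring

lemma cross_self (a : Plane) : cross a a = 0 := by
  unfold cross
  ring

lemma cross_add_right (a b c : Plane) : cross a (b + c) = cross a b + cross a c := by
  simp [cross]
  ring

lemma cross_smul_right (a b : Plane) (r : ℝ) : cross a (r • b) = r * cross a b := by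
  simp [cross]
  ring

lemma eq_or_eq_neg_of_cross_eq_zero {a b : Plane} (ha : ‖a‖ = 1) (hb : ‖b‖ = 1)
    (h : cross a b = 0) : a = b ∨ a = -b := by
  have ha2 : inner ℝ a a = (1 : ℝ) := by rw [real_inner_self_eq_norm_sq, ha, one_pow]
  have hb2 : inner ℝ b b = (1 : ℝ) := by rw [real_inner_self_eq_norm_sq, hb, one_pow]
  have h1 : inner ℝ a b ^ 2 = (1 : ℝ) := by
    have : inner ℝ a b ^ 2 + cross a b ^ 2 = inner ℝ a a * inner ℝ b b := by
      simp only [inner_eq, cross]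
      ring
    rw [h, ha2, hb2] at this
    linarith
  obtain h1 | h1 := (sq_eq_one_iff (a := inner ℝ a b)).1 h1
  · exact Or.inl ((inner_eq_one_iff_of_norm_eq_one ha hb).1 h1)
  · refine Or.inr ((inner_eq_one_iff_of_norm_eq_one (𝕜 := ℝ) ha (by rwa [norm_neg])).1 ?_)
    rw [inner_neg_right, h1, neg_neg]

/-! ## Upper bounds for the minimal length -/

/-- The largest value of `⟨x, v⟩` for `x` in the list `L`. -/
noncomputable def height (L : List Plane) (v : Plane) : ℝ :=
  sSup ((fun x => inner ℝ x v) '' {x | x ∈ L})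

lemma inner_le_height {L : List Plane} {v : Plane} :
    ∀ x ∈ convexHull ℝ {x | x ∈ L}, inner ℝ x v ≤ height L v := by
  have hlin : IsLinearMap ℝ fun x : Plane => inner ℝ x v :=
    ⟨fun x y => inner_add_left _ _ _, fun a x => by
      rw [inner_smul_left, conj_trivial, smul_eq_mul]⟩
  refine convexHull_min (fun x hx => ?_) (convex_halfSpace_le hlin _)
  exact le_csSup (L.finite_toSet.image fun x : Plane => inner ℝ x v).bddAbove (mem_image_of_mem _ hx)

lemma height_eq_of_support {L : List Plane} {a v : Plane} (ha : a ∈ convexHull ℝ {x | x ∈ L})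
    (h : IsOutwardSupport (convexHull ℝ {x | x ∈ L}) a v) : height L v = inner ℝ a v := by
  have hne : {x | x ∈ L}.Nonempty := (convexHull_nonempty_iff (𝕜 := ℝ)).1 ⟨a, ha⟩
  refine le_antisymm (csSup_le (hne.image _) ?_)
    (inner_le_height a ha)
  rintro _ ⟨x, hx, rfl⟩
  have := h x (subset_convexHull _ _ hx)
  rwa [inner_sub_left, sub_nonpos] at this

/-- The closed polygon with sides `(t * c i) • U i` and weights `U i - U (i + 1)` is tested. Its
pairing is `t * m ^ 2 * ∑ i, c i` and its length `t * m * ∑ i, c i`, so the `t` that makes the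
pairing equal to `∑ i, H i` gives the bound. -/
theorem minLength_le_of_directions {S : Set Plane} (hS : IsTable S) {U : ZMod 3 → Plane}
    {c H : ZMod 3 → ℝ} {m : ℝ} (hm : 0 < m) (hU : ∀ i, ‖U i‖ = m) (hc : ∀ i, 0 ≤ c i)
    (hc0 : 0 < ∑ i, c i) (hcU : ∑ i, c i • U i = 0)
    (hH : ∀ i, ∀ x ∈ S, inner ℝ x (U i - U (i + 1)) ≤ H i) : minLength S ≤ (∑ i, H i) / m := by
  have hsum : ∑ i, (U i - U (i + 1)) = 0 := by
    rw [Finset.sum_sub_distrib, sum_shift, sub_self]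
  have hH0 : 0 ≤ ∑ i, H i := by
    obtain ⟨x, hx⟩ := hS.interior_nonempty
    have : ∑ i, inner ℝ x (U i - U (i + 1)) ≤ ∑ i, H i :=
      Finset.sum_le_sum fun i _ => hH i x (interior_subset hx)
    rwa [← inner_sum, hsum, inner_zero_right] at this
  set t : ℝ := (∑ i, H i) / (m ^ 2 * ∑ i, c i) with ht
  have ht0 : 0 ≤ t := by positivity
  -- These are the vertices relative to the centroid; the relation `hcU` turns their differences
  -- into the prescribed sides.
  let p : ZMod 3 → Plane := fun i => (t / 3) • (c i • U i - c (i + 1) • U (i + 1))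
  have hp : ∀ i, p i - p (i - 1) = (t * c i) • U i := fun i => by
    have h3 : c (i + 1) • U (i + 1) + c i • U i + c (i - 1) • U (i - 1) = 0 := by
      rw [← hcU, ← sum_shift _ (i - 1), sum_zmod_three, zero_add, add_sub_cancel,
        show 2 + (i - 1) = i + 1 by ring]
      abel
    have h4 : c (i - 1) • U (i - 1) = -(c (i + 1) • U (i + 1)) - c i • U i := by
      rw [eq_sub_iff_add_eq, eq_neg_iff_add_eq_zero, ← h3]
      abel
    simp only [p, sub_add_cancel, h4]
    module
  have hlen : loopLength p = (∑ i, H i) / m := by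
    rw [loopLength_eq]
    simp only [hp, norm_smul, hU, Real.norm_of_nonneg (mul_nonneg ht0 (hc _))]
    rw [← Finset.sum_mul, ← Finset.mul_sum, ht]
    field_simp
  rw [← hlen]
  refine minLength_le hS (n := fun i => U i - U (i + 1)) ⟨fun h0 => ?_, hsum, fun x hx => ?_⟩
  · have h1 : U 0 = U 1 := sub_eq_zero.1 (congrFun h0 0)
    have h2 : U 1 = U 2 := sub_eq_zero.1 (congrFun h0 1)
    have h3 : ∀ i, U i = U 0 := forall_zmod_three.2 ⟨rfl, h1.symm, (h1.trans h2).symm⟩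
    rw [Finset.sum_congr rfl fun i _ => by rw [h3 i], ← Finset.sum_smul] at hcU
    have h4 := (smul_eq_zero.1 hcU).resolve_left hc0.ne'
    have h5 := hU 0
    rw [h4, norm_zero] at h5
    exact hm.ne h5
  · refine (Finset.sum_le_sum fun i _ => hH i _ (hx i)).trans_eq ?_
    rw [sum_inner_sub_shift]
    simp only [hp, inner_smul_left, conj_trivial, real_inner_self_eq_norm_sq, hU]
    rw [← Finset.sum_mul, ← Finset.mul_sum, ht]
    field_simp

/-- The determinants are the coefficients of a linear relation among the `U i`. They have a common
sign, and the factor `cross (U 1) (U 2)` makes them positive. -/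
lemma minLength_le_of_cross {S : Set Plane} (hS : IsTable S) {U : ZMod 3 → Plane}
    {H : ZMod 3 → ℝ} {m : ℝ} (hm : 0 < m) (hU : ∀ i, ‖U i‖ = m)
    (h01 : 0 < cross (U 0) (U 1) * cross (U 1) (U 2))
    (h12 : 0 < cross (U 1) (U 2) * cross (U 2) (U 0))
    (hH : ∀ i, ∀ x ∈ S, inner ℝ x (U i - U (i + 1)) ≤ H i) : minLength S ≤ (∑ i, H i) / m := by
  have hne : cross (U 1) (U 2) ≠ 0 := fun h0 => by simp [h0] at h01
  have hc : ∀ i, 0 < cross (U 1) (U 2) * cross (U (i + 1)) (U (i + 2)) :=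
    forall_zmod_three.2 ⟨mul_self_pos.2 hne, h12, by
      rw [mul_comm]; exact h01⟩
  refine minLength_le_of_directions hS hm hU (fun i => (hc i).le)
    (Finset.sum_pos (fun i _ => hc i) Finset.univ_nonempty) ?_ hH
  simp only [mul_smul, ← Finset.smul_sum]
  rw [sum_zmod_three]
  exact smul_eq_zero_of_right _ (cross_cycle (U 0) (U 1) (U 2))

/-- The directions `U`, `-U`, `-U` with coefficients `2`, `1`, `1` describe a segment traversed
twice; the middle weight vanishes. -/
lemma minLength_le_width {S : Set Plane} (hS : IsTable S) {U : Plane} (hU : U ≠ 0) {H H' : ℝ}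
    (hH : ∀ x ∈ S, inner ℝ x U ≤ H) (hH' : ∀ x ∈ S, inner ℝ x (-U) ≤ H') :
    minLength S ≤ 2 * (H + H') / ‖U‖ := by
  let V : ZMod 3 → Plane := fun i => if i = 0 then U else -U
  let K : ZMod 3 → ℝ := fun i => if i = 0 then 2 * H else if i = 1 then 0 else 2 * H'
  let c : ZMod 3 → ℝ := fun i => if i = 0 then 2 else 1
  have d10 : (1 : ZMod 3) ≠ 0 := by decide
  have d20 : (2 : ZMod 3) ≠ 0 := by decide
  have d21 : (2 : ZMod 3) ≠ 1 := by decide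
  have e11 : (1 : ZMod 3) + 1 = 2 := rfl
  have e21 : (2 : ZMod 3) + 1 = 0 := rfl
  have := minLength_le_of_directions hS (U := V) (c := c) (H := K) (norm_pos_iff.2 hU)
    (forall_zmod_three.2 (by simp [V, d10, d20]))
    (forall_zmod_three.2 (by simp [c, d10, d20]))
    (by rw [sum_zmod_three]; simp [c, d10, d20]; norm_num)
    (by rw [sum_zmod_three]; simp only [c, V, d10, d20, if_true, if_false]; module)
    (forall_zmod_three.2 ⟨fun x hx => ?_, fun x hx => ?_, fun x hx => ?_⟩)
  · convert this using 2
    rw [sum_zmod_three]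
    simp only [K, d10, d20, d21, if_true, if_false]
    ring
  · have := hH x hx
    simp only [V, K, zero_add, d10, if_true, if_false]
    rw [sub_neg_eq_add, inner_add_right]
    linarith
  · simp only [V, K, e11, d10, d20, if_true, if_false]
    rw [sub_self, inner_zero_right]
  · have := hH' x hx
    simp only [V, K, e21, d20, d21, if_true, if_false]
    rw [sub_eq_add_neg, inner_add_right]
    linarith

/-! ## Shortest orbits of polygons touch edges orthogonally -/

/-- If no two points of `L` lie on a line orthogonal to the support vector `v` at `p`, then the
vectors close to `v` support at `p` as well. -/
lemma exists_support_nhds {L : Set Plane} (hL : L.Finite) {p v : Plane}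
    (hp : p ∈ convexHull ℝ L) (hv : IsOutwardSupport (convexHull ℝ L) p v)
    (h : ∀ x ∈ L, ∀ y ∈ L, x ≠ y → inner ℝ (x - y) v ≠ 0) :
    ∃ δ : ℝ, 0 < δ ∧ ∀ v', ‖v' - v‖ ≤ δ → IsOutwardSupport (convexHull ℝ L) p v' := by
  have hlin : IsLinearMap ℝ fun x : Plane => inner ℝ x v :=
    ⟨fun x y => inner_add_left _ _ _, fun a x => by
      rw [inner_smul_left, conj_trivial, smul_eq_mul]⟩
  obtain ⟨a, haL, ha⟩ : ∃ a ∈ L, inner ℝ a v = inner ℝ p v := by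
    by_contra! hne
    have : convexHull ℝ L ⊆ {x | inner ℝ x v < inner ℝ p v} := by
      refine convexHull_min (fun x hx => ?_) (convex_halfSpace_lt hlin _)
      have := hv x (subset_convexHull _ _ hx)
      rw [inner_sub_left, sub_nonpos] at this
      exact this.lt_of_ne (hne x hx)
    exact lt_irrefl (inner ℝ p v) (this hp)
  -- The inequality defines a convex cone with apex `a`, so it passes from the finite set `L` to its
  -- hull. It forces `p = a` and leaves a margin for vectors at distance at most `δ` from `v`.
  have hev : ∀ x ∈ L, ∀ᶠ δ : ℝ in 𝓝[>] 0, inner ℝ (x - a) v + δ * ‖x - a‖ ≤ 0 := fun x hx => by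
    by_cases hxa : x = a
    · simp [hxa]
    · have h1 : inner ℝ (x - a) v < 0 := by
        refine lt_of_le_of_ne ?_ (h x hx a haL hxa)
        have := hv x (subset_convexHull _ _ hx)
        rw [inner_sub_left] at this ⊢
        rwa [ha]
      have hc : ContinuousAt (fun δ : ℝ => inner ℝ (x - a) v + δ * ‖x - a‖) 0 := by fun_prop
      have := hc.eventually_lt_const (u := 0) (by simpa using h1)
      exact (this.filter_mono nhdsWithin_le_nhds).mono fun _ => le_of_lt
  obtain ⟨δ, hδ, hδ0⟩ := ((hL.eventually_all.2 hev).and self_mem_nhdsWithin).exists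
  have hδ0 : 0 < δ := hδ0
  have hconv : Convex ℝ {x | inner ℝ (x - a) v + δ * ‖x - a‖ ≤ 0} := by
    intro x hx y hy s t hs ht hst
    rw [mem_ofPred_eq] at hx hy ⊢
    have e : s • x + t • y - a = s • (x - a) + t • (y - a) := by
      have : a = (s + t) • a := by rw [hst, one_smul]
      conv_lhs => rw [this]
      module
    rw [e, inner_add_left, inner_smul_left, inner_smul_left, conj_trivial, conj_trivial]
    have h1 : ‖s • (x - a) + t • (y - a)‖ ≤ s * ‖x - a‖ + t * ‖y - a‖ := by
      refine (norm_add_le _ _).trans_eq ?_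
      rw [norm_smul, norm_smul, Real.norm_of_nonneg hs, Real.norm_of_nonneg ht]
    have h2 := mul_le_mul_of_nonneg_left h1 hδ0.le
    have h3 := mul_nonpos_of_nonneg_of_nonpos hs hx
    have h4 := mul_nonpos_of_nonneg_of_nonpos ht hy
    linarith
  have hsub := convexHull_min hδ hconv
  have hpa : p = a := by
    have h1 : inner ℝ (p - a) v + δ * ‖p - a‖ ≤ 0 := hsub hp
    rw [inner_sub_left, ha, sub_self, zero_add] at h1
    have h2 : ‖p - a‖ ≤ 0 := by
      by_contra! h0
      exact (mul_pos hδ0 h0).not_ge h1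
    exact sub_eq_zero.1 (norm_le_zero_iff.1 h2)
  refine ⟨δ, hδ0, fun v' hv' x hx => ?_⟩
  have h1 : inner ℝ (x - a) v + δ * ‖x - a‖ ≤ 0 := hsub hx
  have h2 : inner ℝ (x - a) v' = inner ℝ (x - a) v + inner ℝ (x - a) (v' - v) := by
    rw [← inner_add_right, add_sub_cancel]
  have h3 := real_inner_le_norm (x - a) (v' - v)
  have h4 := mul_le_mul_of_nonneg_left hv' (norm_nonneg (x - a))
  rw [hpa, h2]
  linarith

lemma eventually_norm_smul_le (v : Plane) {δ : ℝ} (hδ : 0 < δ) :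
    ∀ᶠ t : ℝ in 𝓝 0, ‖t • v‖ ≤ δ := by
  have hc : ContinuousAt (fun t : ℝ => ‖t • v‖) 0 := by fun_prop
  exact (hc.eventually_lt_const (u := δ) (by simpa using hδ)).mono fun _ => le_of_lt

/-- Otherwise `a` and `b` still support after `w = a - b` is replaced by `w + t • rot w`. The sum of
the two heights stays `‖w‖ ^ 2` while the norm grows, so the width bound falls below the minimal
length. -/
lemma IsDoubleNormal.exists_orthogonal_edge {L : Set Plane} (hL : L.Finite)
    (hS : IsTable (convexHull ℝ L)) {a b : Plane} (h : IsDoubleNormal (convexHull ℝ L) a b)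
    (hl : 2 * ‖a - b‖ = minLength (convexHull ℝ L)) :
    ∃ x ∈ L, ∃ y ∈ L, x ≠ y ∧ inner ℝ (x - y) (a - b) = 0 := by
  by_contra! hne
  obtain ⟨δ, hδ, hs⟩ := exists_support_nhds hL h.left_mem h.left_support hne
  obtain ⟨δ', hδ', hs'⟩ := exists_support_nhds hL h.right_mem h.right_support
    fun x hx y hy hxy => by
      rw [← neg_sub a b, inner_neg_right]
      exact neg_ne_zero.2 (hne x hx y hy hxy)
  set w := a - b with hw
  obtain ⟨t, ⟨ht1, ht2⟩, ht0⟩ := (((eventually_norm_smul_le (rot w) hδ).and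
    (eventually_norm_smul_le (rot w) hδ')).filter_mono
      (nhdsWithin_le_nhds (s := Ioi 0))).and self_mem_nhdsWithin |>.exists
  have ht0 : 0 < t := ht0
  have hw0 : 0 < ‖w‖ := norm_pos_iff.2 (sub_ne_zero.2 h.ne)
  have hUsq := norm_add_smul_rot_sq w t
  set U := w + t • rot w with hUdef
  have hwU : ‖w‖ < ‖U‖ := by
    refine lt_of_pow_lt_pow_left₀ 2 (norm_nonneg _) ?_
    rw [hUsq]
    have : 0 < t ^ 2 * ‖w‖ ^ 2 := by positivity
    linarith
  have hU0 : U ≠ 0 := norm_pos_iff.1 (hw0.trans hwU)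
  have h1 := minLength_le_width hS hU0 (H := inner ℝ a U) (H' := inner ℝ b (-U))
    (fun x hx => by
      have := hs U (by rwa [hUdef, add_sub_cancel_left]) x hx
      rwa [inner_sub_left, sub_nonpos] at this)
    (fun x hx => by
      have := hs' (-U) (by
        rw [hUdef, ← neg_sub a b, ← hw, sub_neg_eq_add, neg_add_rev, neg_add_cancel_right,
          norm_neg]
        exact ht2) x hx
      rwa [inner_sub_left, sub_nonpos] at this)
  have h2 : inner ℝ a U + inner ℝ b (-U) = ‖w‖ ^ 2 := by
    rw [inner_neg_right, ← sub_eq_add_neg, ← inner_sub_left, ← hw, hUdef, inner_add_right,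
      inner_smul_right, inner_rot_self, real_inner_self_eq_norm_sq]
    ring
  rw [h2, ← hl, le_div_iff₀ (hw0.trans hwU)] at h1
  nlinarith

lemma sum_smul_edgeDir (p : ZMod 3 → Plane) :
    ∑ i, ‖p i - p (i - 1)‖ • edgeDir p i = 0 := by
  simp only [norm_smul_edgeDir]
  rw [Finset.sum_sub_distrib, sub_eq_zero]
  exact (sum_shift p (-1)).symm

/-- The determinant of the closing relation with one direction makes adjacent determinants positive
multiples of each other. If one vanished, all would; then each direction would be minus the next,
which is impossible around an odd cycle. -/
lemma IsTriangleOrbit.cross_mul_pos {T : Set Plane} {p : ZMod 3 → Plane}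
    (h : IsTriangleOrbit T p) (i : ZMod 3) :
    0 < cross (edgeDir p i) (edgeDir p (i + 1)) *
      cross (edgeDir p (i + 1)) (edgeDir p (i + 2)) := by
  have hpos : ∀ i, 0 < ‖p i - p (i - 1)‖ := fun i => norm_pos_iff.2 (sub_ne_zero.2 (by
    have := h.ne (i - 1)
    rwa [sub_add_cancel] at this))
  have e3 : ∀ i : ZMod 3, i + 2 + 1 = i := fun i => by
    rw [add_assoc, show (2 : ZMod 3) + 1 = 0 from rfl, add_zero]
  have rel : ∀ i : ZMod 3, ‖p i - p (i - 1)‖ * cross (edgeDir p i) (edgeDir p (i + 1)) =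
      ‖p (i + 2) - p (i + 2 - 1)‖ * cross (edgeDir p (i + 1)) (edgeDir p (i + 2)) := fun i => by
    have h0 := sum_smul_edgeDir p
    rw [← sum_shift _ i, sum_zmod_three, zero_add, add_comm 1, add_comm 2] at h0
    have h1 := congrArg (cross (edgeDir p (i + 1))) h0
    rw [cross_add_right, cross_add_right, cross_smul_right, cross_smul_right, cross_smul_right,
      cross_self, cross_comm (edgeDir p (i + 1)) (edgeDir p i)] at h1
    have h2 : cross (edgeDir p (i + 1)) 0 = 0 := by simp [cross]
    rw [h2] at h1
    linarith
  have hne : ∀ i : ZMod 3, cross (edgeDir p i) (edgeDir p (i + 1)) ≠ 0 := by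
    have step : ∀ i : ZMod 3, cross (edgeDir p i) (edgeDir p (i + 1)) = 0 →
        cross (edgeDir p (i + 1)) (edgeDir p (i + 1 + 1)) = 0 := fun i h0 => by
      have := rel i
      rw [h0, mul_zero] at this
      rw [add_assoc, show (1 : ZMod 3) + 1 = 2 from rfl]
      exact (mul_eq_zero.1 this.symm).resolve_left (hpos _).ne'
    have flip : ∀ i : ZMod 3, cross (edgeDir p i) (edgeDir p (i + 1)) = 0 →
        edgeDir p i = -edgeDir p (i + 1) := fun i h0 =>
      (eq_or_eq_neg_of_cross_eq_zero (norm_edgeDir h.ne _) (norm_edgeDir h.ne _) h0).resolve_left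
        (sub_ne_zero.1 (h.bounce_ne i))
    intro i h0
    have f0 := flip _ h0
    have f1 := flip _ (step _ h0)
    have f2 := flip _ (step _ (step _ h0))
    rw [add_assoc i, show (1 : ZMod 3) + 1 = 2 from rfl] at f1 f2
    rw [e3] at f2
    rw [f1, f2, neg_neg, eq_neg_iff_add_eq_zero, ← two_smul ℝ] at f0
    have h1 := norm_edgeDir h.ne i
    rw [(smul_eq_zero.1 f0).resolve_left two_ne_zero, norm_zero] at h1
    exact zero_ne_one h1
  have h1 := rel i
  have h2 := hpos i
  have h3 := hpos (i + 2)
  have h4 : 0 < ‖p (i + 2) - p (i + 2 - 1)‖ * (cross (edgeDir p i) (edgeDir p (i + 1)) *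
      cross (edgeDir p (i + 1)) (edgeDir p (i + 2))) := by
    calc 0 < ‖p i - p (i - 1)‖ * (cross (edgeDir p i) (edgeDir p (i + 1)) *
          cross (edgeDir p i) (edgeDir p (i + 1))) := mul_pos h2 (mul_self_pos.2 (hne i))
      _ = _ := by linear_combination cross (edgeDir p i) (edgeDir p (i + 1)) * h1
  exact (mul_pos_iff_of_pos_left h3).1 h4

lemma edgeDir_shift (p : ZMod 3 → Plane) (a i : ZMod 3) :
    edgeDir (fun j => p (j + a)) i = edgeDir p (i + a) := by
  simp only [edgeDir, sub_add_eq_add_sub]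

lemma IsTriangleOrbit.shift {T : Set Plane} {p : ZMod 3 → Plane} (h : IsTriangleOrbit T p)
    (a : ZMod 3) : IsTriangleOrbit T fun i => p (i + a) where
  ne i := by rw [add_right_comm]; exact h.ne _
  mem i := h.mem _
  bounce_ne i := by rw [edgeDir_shift, edgeDir_shift, add_right_comm]; exact h.bounce_ne _
  support i := by rw [edgeDir_shift, edgeDir_shift, add_right_comm]; exact h.support _

/-- Turn `u 0` and `u 1` one way and `u 2` the other. The bounce vectors at `1` and `2` keep their
direction, and the one at `0` turns slightly, which is harmless unless it is orthogonal to a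
difference of points of `L`. All supports survive and the pairing stays the length of `p`, but the
common norm grows to `√(1 + t ^ 2)`, which contradicts minimality. -/
lemma IsTriangleOrbit.exists_orthogonal_edge_zero {L : Set Plane} (hL : L.Finite)
    (hS : IsTable (convexHull ℝ L)) {p : ZMod 3 → Plane}
    (h : IsTriangleOrbit (convexHull ℝ L) p) (hl : loopLength p = minLength (convexHull ℝ L)) :
    ∃ x ∈ L, ∃ y ∈ L, x ≠ y ∧ inner ℝ (x - y) (edgeDir p 0 - edgeDir p 1) = 0 := by
  by_contra! hne
  set u := edgeDir p with hu
  have hu1 : ∀ i, ‖u i‖ = 1 := norm_edgeDir h.ne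
  obtain ⟨δ, hδ, hs⟩ := exists_support_nhds hL (h.mem 0) (h.support 0) hne
  obtain ⟨k, hk⟩ := exists_rot_add_eq_smul_sub ((hu1 1).trans (hu1 2).symm) (h.bounce_ne 1)
  obtain ⟨l, hl'⟩ := exists_rot_add_eq_smul_sub ((hu1 2).trans (hu1 0).symm) (h.bounce_ne 2)
  let U : ℝ → ZMod 3 → Plane := fun t i => u i + ((if i = 2 then -1 else 1) * t) • rot (u i)
  have d02 : (0 : ZMod 3) ≠ 2 := by decide
  have d12 : (1 : ZMod 3) ≠ 2 := by decide
  have U0 : ∀ t, U t 0 = u 0 + t • rot (u 0) := fun t => by simp [U, d02]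
  have U1 : ∀ t, U t 1 = u 1 + t • rot (u 1) := fun t => by simp [U, d12]
  have U2 : ∀ t, U t 2 = u 2 - t • rot (u 2) := fun t => by simp [U, sub_eq_add_neg]
  have hcross : ∀ i j : ZMod 3, Continuous fun t => cross (U t i) (U t j) := fun i j => by
    simp only [cross, U, PiLp.add_apply, PiLp.smul_apply]
    fun_prop
  have hU00 : ∀ i, U 0 i = u i := fun i => by simp [U]
  have ev1 : ∀ᶠ t in 𝓝 (0 : ℝ), 0 < cross (U t 0) (U t 1) * cross (U t 1) (U t 2) :=
    ((hcross 0 1).mul (hcross 1 2)).continuousAt.eventually_const_lt (by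
      rw [Pi.mul_apply, hU00, hU00, hU00]; exact h.cross_mul_pos 0)
  have ev2 : ∀ᶠ t in 𝓝 (0 : ℝ), 0 < cross (U t 1) (U t 2) * cross (U t 2) (U t 0) :=
    ((hcross 1 2).mul (hcross 2 0)).continuousAt.eventually_const_lt (by
      rw [Pi.mul_apply, hU00, hU00, hU00]; exact h.cross_mul_pos 1)
  have ev3 : ∀ᶠ t in 𝓝 (0 : ℝ), 0 < 1 + t * k := by
    have hc : ContinuousAt (fun t : ℝ => 1 + t * k) 0 := by fun_prop
    exact hc.eventually_const_lt (by simp)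
  have ev4 : ∀ᶠ t in 𝓝 (0 : ℝ), 0 < 1 - t * l := by
    have hc : ContinuousAt (fun t : ℝ => 1 - t * l) 0 := by fun_prop
    exact hc.eventually_const_lt (by simp)
  obtain ⟨t, ⟨ht1, ht2, ht3, ht4, ht5⟩, ht0⟩ := ((ev1.and (ev2.and (ev3.and (ev4.and
    (eventually_norm_smul_le (rot (u 0 - u 1)) hδ))))).filter_mono
      (nhdsWithin_le_nhds (s := Ioi 0))).and self_mem_nhdsWithin |>.exists
  have ht0 : 0 < t := ht0
  have hm : 1 < √(1 + t ^ 2) := by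
    rw [Real.lt_sqrt zero_le_one]
    have := pow_pos ht0 2
    linarith
  have hU : ∀ i, ‖U t i‖ = √(1 + t ^ 2) := fun i => by
    have h1 := norm_add_smul_rot_sq (u i) ((if i = 2 then -1 else 1) * t)
    rw [hu1, one_pow, mul_one] at h1
    have h2 : ((if i = 2 then -1 else 1) * t) ^ 2 = t ^ 2 := by
      split_ifs <;> ring
    rw [h2] at h1
    rw [← h1, Real.sqrt_sq (norm_nonneg _)]
  have hsup : ∀ i, IsOutwardSupport (convexHull ℝ L) (p i) (U t i - U t (i + 1)) := by
    refine forall_zmod_three.2 ⟨hs _ ?_, ?_, ?_⟩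
    · have : U t 0 - U t (0 + 1) - (u 0 - u 1) = t • rot (u 0 - u 1) := by
        rw [zero_add, U0, U1, rot_sub]
        module
      exact (congrArg norm this).trans_le ht5
    · have : U t 1 - U t (1 + 1) = (1 + t * k) • (u 1 - u (1 + 1)) := by
        rw [show (1 : ZMod 3) + 1 = 2 from rfl, U1, U2, add_smul, mul_smul, one_smul]
        rw [← hk, rot_add]
        module
      rw [this]
      exact (h.support 1).smul ht3.le
    · have : U t 2 - U t (2 + 1) = (1 - t * l) • (u 2 - u (2 + 1)) := by
        rw [show (2 : ZMod 3) + 1 = 0 from rfl, U0, U2, sub_smul, mul_smul, one_smul]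
        rw [← hl', rot_add]
        module
      rw [this]
      exact (h.support 2).smul ht4.le
  have key := minLength_le_of_cross hS (zero_lt_one.trans hm) hU ht1 ht2
    (H := fun i => inner ℝ (p i) (U t i - U t (i + 1))) fun i x hx => by
      have := hsup i x hx
      rwa [inner_sub_left, sub_nonpos] at this
  have hsum : ∑ i, inner ℝ (p i) (U t i - U t (i + 1)) = loopLength p := by
    rw [sum_inner_sub_shift, loopLength_eq]
    refine Finset.sum_congr rfl fun i _ => ?_
    rw [← norm_smul_edgeDir p i, ← hu]
    simp only [U, inner_smul_left, inner_add_right, inner_smul_right, inner_rot_self,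
      real_inner_self_eq_norm_sq, hu1, conj_trivial, norm_smul, norm_norm]
    ring
  rw [hsum, ← hl, le_div_iff₀ (zero_lt_one.trans hm)] at key
  have hpos : 0 < loopLength p :=
    (norm_pos_iff.2 (sub_ne_zero.2 (h.ne 0))).trans_le (norm_sub_le_loopLength p _ _)
  nlinarith

lemma IsTriangleOrbit.exists_orthogonal_edge {L : Set Plane} (hL : L.Finite)
    (hS : IsTable (convexHull ℝ L)) {p : ZMod 3 → Plane}
    (h : IsTriangleOrbit (convexHull ℝ L) p) (hl : loopLength p = minLength (convexHull ℝ L))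
    (i : ZMod 3) :
    ∃ x ∈ L, ∃ y ∈ L, x ≠ y ∧ inner ℝ (x - y) (edgeDir p i - edgeDir p (i + 1)) = 0 := by
  have := (h.shift i).exists_orthogonal_edge_zero hL hS ((loopLength_shift p i).trans hl)
  rwa [edgeDir_shift, edgeDir_shift, zero_add, add_comm 1] at this

/-! ## A finite formula for the minimal length of a polygon -/

/-- Twice the width of the polygon `L` in the direction orthogonal to `E`. -/
noncomputable def widthValue (L : List Plane) (E : Plane) : ℝ :=
  2 * (height L (rot E) + height L (-rot E)) / ‖E‖

/-- The product `a * b * conj c` of complex numbers. -/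
noncomputable def tripleDir (a b c : Plane) : Plane :=
  !₂[(a 0 * b 0 - a 1 * b 1) * c 0 + (a 0 * b 1 + a 1 * b 0) * c 1,
    (a 0 * b 1 + a 1 * b 0) * c 0 - (a 0 * b 0 - a 1 * b 1) * c 1]

@[simp] lemma tripleDir_zero (a b c : Plane) : tripleDir a b c 0 =
  (a 0 * b 0 - a 1 * b 1) * c 0 + (a 0 * b 1 + a 1 * b 0) * c 1 := rfl

@[simp] lemma tripleDir_one (a b c : Plane) : tripleDir a b c 1 =
  (a 0 * b 1 + a 1 * b 0) * c 0 - (a 0 * b 0 - a 1 * b 1) * c 1 := rfl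

lemma tripleDir_comm (a b c : Plane) : tripleDir a b c = tripleDir b a c := by
  refine plane_ext ?_ ?_ <;> simp only [tripleDir_zero, tripleDir_one] <;> ring

lemma norm_tripleDir (a b c : Plane) : ‖tripleDir a b c‖ = ‖a‖ * ‖b‖ * ‖c‖ := by
  rw [← sq_eq_sq₀ (norm_nonneg _) (by positivity), mul_pow, mul_pow]
  simp only [norm_sq_eq, tripleDir_zero, tripleDir_one]
  ring

/-- In complex notation, `b * conj c - c * conj b` is twice the imaginary part of `b * conj c`,
times `i`. -/
lemma tripleDir_sub (a b c : Plane) :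
    tripleDir a b c - tripleDir a c b = (2 * cross c b) • rot a := by
  refine plane_ext ?_ ?_ <;>
  simp only [PiLp.sub_apply, PiLp.smul_apply, tripleDir_zero, tripleDir_one, rot_zero_apply,
    rot_one_apply, cross, smul_eq_mul] <;> ring

/-- The three directions `u` satisfy the strict inequalities that characterise triples with the
origin in the interior of their convex hull. -/
def Surrounds (u v w : Plane) : Prop :=
  0 < cross u v * cross v w ∧ 0 < cross v w * cross w u

/-- The length of the closed polygon with edge directions `u`, `v`, `w` around the polygon `L`. -/
noncomputable def triangleValue (L : List Plane) (u v w : Plane) : ℝ :=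
  (height L (u - v) + height L (v - w) + height L (w - u)) / ‖u‖

lemma minLength_le_widthValue {L : List Plane} (hS : IsTable (convexHull ℝ {x | x ∈ L}))
    {E : Plane} (hE : E ≠ 0) : minLength (convexHull ℝ {x | x ∈ L}) ≤ widthValue L E := by
  have h0 : rot E ≠ 0 := norm_ne_zero_iff.1 (by rw [norm_rot]; exact norm_ne_zero_iff.2 hE)
  have := minLength_le_width hS h0 inner_le_height inner_le_height
  rwa [norm_rot] at this

lemma minLength_le_triangleValue {L : List Plane} (hS : IsTable (convexHull ℝ {x | x ∈ L}))
    {u v w : Plane} (huv : ‖v‖ = ‖u‖) (huw : ‖w‖ = ‖u‖) (h : Surrounds u v w) :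
    minLength (convexHull ℝ {x | x ∈ L}) ≤ triangleValue L u v w := by
  have hu : u ≠ 0 := fun h0 => by
    have := h.1
    simp [cross, h0] at this
  let U : ZMod 3 → Plane := fun i => if i = 0 then u else if i = 1 then v else w
  have U0 : U 0 = u := rfl
  have U1 : U 1 = v := rfl
  have U2 : U 2 = w := rfl
  have e1 : (1 : ZMod 3) + 1 = 2 := rfl
  have e2 : (2 : ZMod 3) + 1 = 0 := rfl
  have := minLength_le_of_cross hS (U := U) (m := ‖u‖) (norm_pos_iff.2 hu)
    (forall_zmod_three.2 ⟨rfl, huv, huw⟩) h.1 h.2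
    (H := fun i => height L (U i - U (i + 1))) fun i => inner_le_height
  rwa [sum_zmod_three, zero_add, e1, e2, U0, U1, U2] at this

lemma widthValue_eq_of_isDoubleNormal {L : List Plane} {a b E : Plane}
    (h : IsDoubleNormal (convexHull ℝ {x | x ∈ L}) a b) (hE : E ≠ 0)
    (hEab : inner ℝ E (a - b) = 0) : widthValue L E = 2 * ‖a - b‖ := by
  obtain ⟨k, hk⟩ := exists_eq_smul_rot hE hEab
  have hk0 : k ≠ 0 := fun h0 => by
    rw [h0, zero_smul, sub_eq_zero] at hk
    exact h.ne hk
  have hrot : rot E = k⁻¹ • (a - b) := by rw [hk, inv_smul_smul₀ hk0]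
  have hEn : 0 < ‖E‖ := norm_pos_iff.2 hE
  have hnorm : ‖a - b‖ = |k| * ‖E‖ := by rw [hk, norm_smul, norm_rot, Real.norm_eq_abs]
  have hba : b - a = -(a - b) := (neg_sub a b).symm
  have hin : inner ℝ (a - b) (rot E) = k * ‖E‖ ^ 2 := by
    rw [hk, inner_smul_left, conj_trivial, real_inner_self_eq_norm_sq, norm_rot]
  obtain hneg | hpos := hk0.lt_or_gt
  · have h1 : IsOutwardSupport (convexHull ℝ {x | x ∈ L}) b (rot E) := by
      rw [hrot, show k⁻¹ • (a - b) = (-k⁻¹) • (b - a) by rw [hba]; module]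
      exact h.right_support.smul (neg_nonneg.2 (inv_nonpos.2 hneg.le))
    have h2 : IsOutwardSupport (convexHull ℝ {x | x ∈ L}) a (-rot E) := by
      rw [hrot, ← neg_smul]
      exact h.left_support.smul (neg_nonneg.2 (inv_nonpos.2 hneg.le))
    rw [widthValue, height_eq_of_support h.right_mem h1, height_eq_of_support h.left_mem h2,
      hnorm, abs_of_neg hneg, inner_neg_right, ← sub_eq_add_neg, ← inner_sub_left, hba,
      inner_neg_left, hin]
    field_simp
  · have h1 : IsOutwardSupport (convexHull ℝ {x | x ∈ L}) a (rot E) := by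
      rw [hrot]
      exact h.left_support.smul (inv_nonneg.2 hpos.le)
    have h2 : IsOutwardSupport (convexHull ℝ {x | x ∈ L}) b (-rot E) := by
      rw [hrot, ← smul_neg, ← hba]
      exact h.right_support.smul (inv_nonneg.2 hpos.le)
    rw [widthValue, height_eq_of_support h.left_mem h1, height_eq_of_support h.right_mem h2,
      hnorm, abs_of_pos hpos, inner_neg_right, ← sub_eq_add_neg, ← inner_sub_left, hin]
    field_simp

/-! ### Recovering the edge directions of a triangle from its three support lines -/

lemma cross_smul_eq (a b k : Plane) :
    cross a b • k = inner ℝ b k • rot a - inner ℝ a k • rot b := by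
  refine plane_ext ?_ ?_ <;>
  simp only [PiLp.sub_apply, PiLp.smul_apply, rot_zero_apply, rot_one_apply, cross, inner_eq,
    smul_eq_mul] <;> ring

/-- Two triples of points on circles around the origin, with proportional differences, are
proportional. -/
lemma eq_smul_of_sub_eq {u U : ZMod 3 → Plane} {m t : ℝ} (hu : ∀ i, ‖u i‖ = 1)
    (hU : ∀ i, ‖U i‖ = m) (ht : t ≠ 0) (h : ∀ i, U i - U (i + 1) = t • (u i - u (i + 1)))
    (hc : cross (u 0 - u 1) (u 1 - u 2) ≠ 0) (i : ZMod 3) : U i = t • u i := by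
  -- The triples differ by one common translation `k`. Equal norms make `k` orthogonal to two
  -- independent differences, so it vanishes.
  set k := U 0 - t • u 0 with hk
  have hUk : ∀ i, U i = t • u i + k := by
    have h0 := h 0
    have h1 := h 1
    rw [zero_add] at h0
    rw [show (1 : ZMod 3) + 1 = 2 from rfl] at h1
    refine forall_zmod_three.2 ⟨by rw [hk]; abel, ?_, ?_⟩
    · rw [hk, sub_eq_iff_eq_add.1 h0]
      module
    · rw [hk, sub_eq_iff_eq_add.1 h0, sub_eq_iff_eq_add.1 h1]
      module
  have hin : ∀ i, inner ℝ (u i - u (i + 1)) k = 0 := fun i => by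
    have h1 : ‖U i‖ ^ 2 = ‖U (i + 1)‖ ^ 2 := by rw [hU, hU]
    rw [hUk, hUk, norm_add_sq_real, norm_add_sq_real, norm_smul, norm_smul, hu, hu,
      inner_smul_left, inner_smul_left, conj_trivial] at h1
    rw [inner_sub_left]
    have h2 : t * (inner ℝ (u i) k - inner ℝ (u (i + 1)) k) = 0 := by linarith
    exact (mul_eq_zero.1 h2).resolve_left ht
  have hk0 : k = 0 := by
    have h1 := cross_smul_eq (u 0 - u 1) (u 1 - u 2) k
    have i0 := hin 0
    have i1 := hin 1
    rw [zero_add] at i0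
    rw [show (1 : ZMod 3) + 1 = 2 from rfl] at i1
    rw [i0, i1, zero_smul, zero_smul, sub_zero] at h1
    exact (smul_eq_zero.1 h1).resolve_left hc
  rw [hUk, hk0, add_zero]

/-- The differences of the `u i` are `k i • rot (E i)`, and those of the `tripleDir` are `(2 * s i)
• rot (E i)`. Both `k` and `s` are coefficients of a linear relation among the `E i`, so they are
proportional; differences and equal norms then determine the triple. -/
lemma exists_tripleDir_eq_smul {u E : ZMod 3 → Plane} (hu : ∀ i, ‖u i‖ = 1)
    (hE : ∀ i, E i ≠ 0) (hne : ∀ i, u i - u (i + 1) ≠ 0)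
    (hEu : ∀ i, inner ℝ (E i) (u i - u (i + 1)) = 0)
    (hc : cross (u 0 - u 1) (u 1 - u 2) ≠ 0) :
    ∃ t : ℝ, t ≠ 0 ∧ ∀ i, tripleDir (E i) (E (i + 2)) (E (i + 1)) = t • u i := by
  choose k hk using fun i => exists_eq_smul_rot (hE i) (hEu i)
  have hk0 : ∀ i, k i ≠ 0 := fun i h0 => hne i (by rw [hk, h0, zero_smul])
  let s : ZMod 3 → ℝ := fun i => cross (E (i + 1)) (E (i + 2))
  have hkE : ∑ i, k i • E i = 0 := by
    have h0 : ∑ i, (u i - u (i + 1)) = 0 := by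
      rw [Finset.sum_sub_distrib, sum_shift, sub_self]
    simp only [hk] at h0
    rw [sum_zmod_three] at h0 ⊢
    rw [← rot_smul, ← rot_smul, ← rot_smul, ← rot_add, ← rot_add] at h0
    rw [← norm_eq_zero, ← norm_rot, h0, norm_zero]
  have hks : ∀ i, s i = s 0 / k 0 * k i := by
    have hcr : ∀ a, cross a (∑ i, k i • E i) =
        k 0 * cross a (E 0) + k 1 * cross a (E 1) + k 2 * cross a (E 2) := fun a => by
      rw [sum_zmod_three, cross_add_right, cross_add_right, cross_smul_right, cross_smul_right,
        cross_smul_right]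
    have hz : ∀ a, cross a 0 = 0 := fun a => by simp [cross]
    have h1 := hcr (E 1)
    have h2 := hcr (E 2)
    rw [hkE, hz, cross_self] at h1 h2
    have s0 : s 0 = cross (E 1) (E 2) := rfl
    have s1 : s 1 = cross (E 2) (E 0) := rfl
    have s2 : s 2 = cross (E 0) (E 1) := rfl
    rw [← s0, cross_comm, ← s2] at h1
    rw [← s1, cross_comm, ← s0] at h2
    have := hk0 0
    refine forall_zmod_three.2 ⟨?_, ?_, ?_⟩
    · field_simp
    · rw [div_mul_eq_mul_div, eq_div_iff this]
      linarith
    · rw [div_mul_eq_mul_div, eq_div_iff this]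
      linarith
  have hs2 : s 2 ≠ 0 := fun h0 => hc (by
    have h1 := hk 0
    have h2 := hk 1
    rw [zero_add] at h1
    rw [show (1 : ZMod 3) + 1 = 2 from rfl] at h2
    have h3 : cross (k 0 • rot (E 0)) (k 1 • rot (E 1)) = k 0 * k 1 * s 2 := by
      have : s 2 = cross (E 0) (E 1) := rfl
      rw [this]
      simp only [cross, PiLp.smul_apply, rot_zero_apply, rot_one_apply, smul_eq_mul]
      ring
    rw [h1, h2, h3, h0, mul_zero])
  have ht : 2 * (s 0 / k 0) ≠ 0 := fun h0 => hs2 (by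
    rw [hks 2, (mul_eq_zero.1 h0).resolve_left two_ne_zero, zero_mul])
  refine ⟨2 * (s 0 / k 0), ht, eq_smul_of_sub_eq hu (m := ‖E 0‖ * ‖E 1‖ * ‖E 2‖) ?_ ht
    (fun i => ?_) hc⟩
  · simp only [norm_tripleDir]
    refine forall_zmod_three.2 ⟨?_, ?_, ?_⟩
    · change ‖E 0‖ * ‖E 2‖ * ‖E 1‖ = _
      ring
    · change ‖E 1‖ * ‖E 0‖ * ‖E 2‖ = _
      ring
    · change ‖E 2‖ * ‖E 1‖ * ‖E 0‖ = _
      ring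
  · have h1 : tripleDir (E (i + 1)) (E (i + 1 + 2)) (E (i + 1 + 1)) =
        tripleDir (E i) (E (i + 1)) (E (i + 2)) := by
      rw [add_assoc i, add_assoc i, show (1 : ZMod 3) + 2 = 0 from rfl,
        show (1 : ZMod 3) + 1 = 2 from rfl, add_zero, tripleDir_comm]
    rw [h1, tripleDir_sub, hk, smul_smul, mul_assoc, ← hks]

lemma tripleDir_neg (a b c : Plane) : tripleDir (-a) b c = -tripleDir a b c ∧
    tripleDir a (-b) c = -tripleDir a b c ∧ tripleDir a b (-c) = -tripleDir a b c := by
  refine ⟨plane_ext ?_ ?_, plane_ext ?_ ?_, plane_ext ?_ ?_⟩ <;>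
  simp only [PiLp.neg_apply, tripleDir_zero, tripleDir_one] <;> ring

/-- Some shortest orbit of a polygon is determined by at most three edge directions. -/
theorem exists_value_eq_minLength {L : List Plane} (hS : IsTable (convexHull ℝ {x | x ∈ L})) :
    (∃ x ∈ L, ∃ y ∈ L, x - y ≠ 0 ∧
      widthValue L (x - y) = minLength (convexHull ℝ {x | x ∈ L})) ∨
    ∃ x ∈ L, ∃ y ∈ L, ∃ x' ∈ L, ∃ y' ∈ L, ∃ x'' ∈ L, ∃ y'' ∈ L,
      let u := tripleDir (x - y) (x'' - y'') (x' - y')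
      let v := tripleDir (x' - y') (x - y) (x'' - y'')
      let w := tripleDir (x'' - y'') (x' - y') (x - y)
      Surrounds u v w ∧ triangleValue L u v w = minLength (convexHull ℝ {x | x ∈ L}) := by
  obtain ⟨p, n, h, hs⟩ := exists_pinned_isShortestCaged hS
  have hl := (minLength_eq hS hs).2.symm
  obtain ⟨a, b, hab, hlab, -⟩ | ho := hs.isDoubleNormal_or_isTriangleOrbit hS h
  · left
    obtain ⟨x, hx, y, hy, hxy, hin⟩ := hab.exists_orthogonal_edge L.finite_toSet hS
      (hlab.symm.trans hl)
    refine ⟨x, hx, y, hy, sub_ne_zero.2 hxy, ?_⟩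
    rw [widthValue_eq_of_isDoubleNormal hab (sub_ne_zero.2 hxy) hin, ← hlab, hl]
  · right
    choose x hx y hy hxy hin using ho.exists_orthogonal_edge L.finite_toSet hS hl
    set u := edgeDir p with hu
    have hu1 : ∀ i, ‖u i‖ = 1 := norm_edgeDir ho.ne
    have c0 : 0 < cross (u 0) (u 1) * cross (u 1) (u 2) := ho.cross_mul_pos 0
    have c1 : 0 < cross (u 1) (u 2) * cross (u 2) (u 0) := ho.cross_mul_pos 1
    have hc : cross (u 0 - u 1) (u 1 - u 2) ≠ 0 := fun h0 => by
      have e : cross (u 0 - u 1) (u 1 - u 2) =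
          cross (u 0) (u 1) + cross (u 1) (u 2) + cross (u 2) (u 0) := by
        simp only [cross, PiLp.sub_apply]
        ring
      rw [e] at h0
      have h1 := congrArg (cross (u 1) (u 2) * ·) h0
      simp only [mul_add, mul_zero] at h1
      nlinarith [mul_self_nonneg (cross (u 1) (u 2))]
    -- Reversing the first edge changes the sign of the factor.
    obtain ⟨t, ht, hdir⟩ := exists_tripleDir_eq_smul (E := fun i => x i - y i) hu1
      (fun i => sub_ne_zero.2 (hxy i)) ho.bounce_ne hin hc
    have key : ∀ t : ℝ, 0 < t → ∀ U : ZMod 3 → Plane, (∀ i, U i = t • u i) →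
        Surrounds (U 0) (U 1) (U 2) ∧ triangleValue L (U 0) (U 1) (U 2) =
          minLength (convexHull ℝ {x | x ∈ L}) := fun t ht U hU => by
      have hcr : ∀ i j, cross (t • u i) (t • u j) = t ^ 2 * cross (u i) (u j) := fun i j => by
        simp only [cross, PiLp.smul_apply, smul_eq_mul]
        ring
      refine ⟨⟨?_, ?_⟩, ?_⟩
      · rw [hU, hU, hU, hcr, hcr]
        have : 0 < t ^ 2 * t ^ 2 * (cross (u 0) (u 1) * cross (u 1) (u 2)) := by positivity
        linarith
      · rw [hU, hU, hU, hcr, hcr]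
        have : 0 < t ^ 2 * t ^ 2 * (cross (u 1) (u 2) * cross (u 2) (u 0)) := by positivity
        linarith
      · have hh : ∀ i, height L (U i - U (i + 1)) =
            t * inner ℝ (p i) (u i - u (i + 1)) := fun i => by
          rw [hU, hU, ← smul_sub, height_eq_of_support (ho.mem i) ((ho.support i).smul ht.le),
            inner_smul_right]
        have h0 := hh 0
        have h1 := hh 1
        have h2 := hh 2
        have hsum := sum_inner_edgeDir (p := p)
        rw [← hu, sum_zmod_three] at hsum
        rw [zero_add] at h0 hsum
        rw [show (1 : ZMod 3) + 1 = 2 from rfl] at h1 hsum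
        rw [show (2 : ZMod 3) + 1 = 0 from rfl] at h2 hsum
        rw [triangleValue, h0, h1, h2, hU, norm_smul, hu1, Real.norm_of_nonneg ht.le, ← hl,
          ← hsum]
        field_simp
    obtain ht | ht := ht.lt_or_gt
    · refine ⟨y 0, hy 0, x 0, hx 0, x 1, hx 1, y 1, hy 1, x 2, hx 2, y 2, hy 2, ?_⟩
      have := key (-t) (neg_pos.2 ht) (fun i => -tripleDir (x i - y i) (x (i + 2) - y (i + 2))
        (x (i + 1) - y (i + 1))) fun i => by rw [hdir, neg_smul]
      rw [← neg_sub (x 0) (y 0), (tripleDir_neg _ _ _).1, (tripleDir_neg _ _ _).2.1,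
        (tripleDir_neg _ _ _).2.2]
      exact this
    · exact ⟨x 0, hx 0, y 0, hy 0, x 1, hx 1, y 1, hy 1, x 2, hx 2, y 2, hy 2,
        key t ht _ hdir⟩

/-! ## Programs -/

/-- The program `P`, started on `x`, halts with output `y`. -/
def Halts (P : Prog) (x y : Data) : Prop := ∃ t, Runs P x y t

lemma Halts.id (x : Data) : Halts Prog.id x x := ⟨_, Runs.id x⟩
lemma Halts.one (x : Data) : Halts Prog.one x (Data.num 1) := ⟨_, Runs.one x⟩
lemma Halts.fst (x y : Data) : Halts Prog.fst (Data.pair x y) x := ⟨_, Runs.fst x y⟩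
lemma Halts.snd (x y : Data) : Halts Prog.snd (Data.pair x y) y := ⟨_, Runs.snd x y⟩

lemma Halts.pair {f g : Prog} {x y z : Data} (hf : Halts f x y) (hg : Halts g x z) :
    Halts (Prog.pair f g) x (Data.pair y z) :=
  let ⟨_, hf⟩ := hf
  let ⟨_, hg⟩ := hg
  ⟨_, Runs.pair hf hg⟩

lemma Halts.comp {f g : Prog} {x y z : Data} (hf : Halts f x y) (hg : Halts g y z) :
    Halts (Prog.comp g f) x z :=
  let ⟨_, hf⟩ := hf
  let ⟨_, hg⟩ := hg
  ⟨_, Runs.comp hf hg⟩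

lemma Halts.compFst {f : Prog} {x y z : Data} (hf : Halts f x (Data.pair y z)) :
    Halts (Prog.comp Prog.fst f) x y := hf.comp (Halts.fst y z)

lemma Halts.compSnd {f : Prog} {x y z : Data} (hf : Halts f x (Data.pair y z)) :
    Halts (Prog.comp Prog.snd f) x z := hf.comp (Halts.snd y z)

lemma Halts.ifLe {s t f g : Prog} {x y z : Data} {a b : ℝ} (hs : Halts s x (Data.num a))
    (ht : Halts t x (Data.num b)) (hf : a ≤ b → Halts f x y) (hg : b < a → Halts g x z) :
    Halts (Prog.ifLe s t f g) x (if a ≤ b then y else z) := by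
  obtain ⟨_, hs⟩ := hs
  obtain ⟨_, ht⟩ := ht
  split_ifs with h
  · obtain ⟨_, hf⟩ := hf h
    exact ⟨_, Runs.ifLe_pos hs ht h hf⟩
  · obtain ⟨_, hg⟩ := hg (not_le.1 h)
    exact ⟨_, Runs.ifLe_neg hs ht (not_le.1 h) hg⟩

lemma Halts.loop_nil {s f : Prog} {x : Data} (hs : Halts s x Data.nil) :
    Halts (Prog.loop s f) x x :=
  let ⟨_, hs⟩ := hs
  ⟨_, Runs.loop_nil hs⟩

lemma Halts.loop_pair {s f : Prog} {x y z u v : Data} (hs : Halts s x (Data.pair u v))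
    (hf : Halts f x y) (hl : Halts (Prog.loop s f) y z) : Halts (Prog.loop s f) x z :=
  let ⟨_, hs⟩ := hs
  let ⟨_, hf⟩ := hf
  let ⟨_, hl⟩ := hl
  ⟨_, Runs.loop_pair hs hf hl⟩

/-! ### Arithmetic -/

/-- Sum of the outputs of two programs. -/
def addP (f g : Prog) : Prog := Prog.comp Prog.add (Prog.pair f g)
/-- Difference of the outputs of two programs. -/
def subP (f g : Prog) : Prog := Prog.comp Prog.sub (Prog.pair f g)
/-- Product of the outputs of two programs. -/
def mulP (f g : Prog) : Prog := Prog.comp Prog.mul (Prog.pair f g)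
/-- Quotient of the outputs of two programs. -/
def divP (f g : Prog) : Prog := Prog.comp Prog.div (Prog.pair f g)
/-- The number zero. -/
def zeroP : Prog := subP Prog.one Prog.one
/-- Minimum of the outputs of two programs. -/
def minP (f g : Prog) : Prog := Prog.ifLe f g f g
/-- Maximum of the outputs of two programs. -/
def maxP (f g : Prog) : Prog := Prog.ifLe f g g f

section arithmetic

variable {f g : Prog} {x : Data} {a b : ℝ}

lemma Halts.addP (hf : Halts f x (Data.num a)) (hg : Halts g x (Data.num b)) :
    Halts (addP f g) x (Data.num (a + b)) := (hf.pair hg).comp ⟨_, Runs.add a b⟩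

lemma Halts.subP (hf : Halts f x (Data.num a)) (hg : Halts g x (Data.num b)) :
    Halts (subP f g) x (Data.num (a - b)) := (hf.pair hg).comp ⟨_, Runs.sub a b⟩

lemma Halts.mulP (hf : Halts f x (Data.num a)) (hg : Halts g x (Data.num b)) :
    Halts (mulP f g) x (Data.num (a * b)) := (hf.pair hg).comp ⟨_, Runs.mul a b⟩

lemma Halts.divP (hf : Halts f x (Data.num a)) (hg : Halts g x (Data.num b)) (hb : b ≠ 0) :
    Halts (divP f g) x (Data.num (a / b)) := (hf.pair hg).comp ⟨_, Runs.div a b hb⟩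

lemma Halts.zeroP (x : Data) : Halts zeroP x (Data.num 0) := by
  have := (Halts.one x).subP (Halts.one x)
  rwa [sub_self] at this

lemma Halts.minP (hf : Halts f x (Data.num a)) (hg : Halts g x (Data.num b)) :
    Halts (minP f g) x (Data.num (min a b)) := by
  have := Halts.ifLe hf hg (fun _ => hf) fun _ => hg
  rwa [← apply_ite, ← min_def] at this

lemma Halts.maxP (hf : Halts f x (Data.num a)) (hg : Halts g x (Data.num b)) :
    Halts (maxP f g) x (Data.num (max a b)) := by
  have := Halts.ifLe hf hg (fun _ => hg) fun _ => hf
  rwa [← apply_ite, ← max_def] at this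

end arithmetic

/-! ### Vectors -/

/-- A vector as a datum. -/
def encodeVec (v : Plane) : Data := Data.pair (Data.num (v 0)) (Data.num (v 1))

/-- First coordinate. -/
def coord0 (f : Prog) : Prog := Prog.comp Prog.fst f
/-- Second coordinate. -/
def coord1 (f : Prog) : Prog := Prog.comp Prog.snd f
/-- Difference of vectors. -/
def vsubP (f g : Prog) : Prog :=
  Prog.pair (subP (coord0 f) (coord0 g)) (subP (coord1 f) (coord1 g))
/-- Opposite vector. -/
def vnegP (f : Prog) : Prog := Prog.pair (subP zeroP (coord0 f)) (subP zeroP (coord1 f))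
/-- Rotation by a right angle. -/
def rotP (f : Prog) : Prog := Prog.pair (subP zeroP (coord1 f)) (coord0 f)
/-- Inner product. -/
def innerP (f g : Prog) : Prog :=
  addP (mulP (coord0 f) (coord0 g)) (mulP (coord1 f) (coord1 g))
/-- Determinant. -/
def crossP (f g : Prog) : Prog :=
  subP (mulP (coord0 f) (coord1 g)) (mulP (coord1 f) (coord0 g))
/-- Euclidean norm. -/
def normP (f : Prog) : Prog := Prog.comp Prog.sqrt (innerP f f)
/-- Product of complex numbers, the third one conjugated. -/
def tripleDirP (f g h : Prog) : Prog :=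
  Prog.pair
    (addP (mulP (subP (mulP (coord0 f) (coord0 g)) (mulP (coord1 f) (coord1 g))) (coord0 h))
      (mulP (addP (mulP (coord0 f) (coord1 g)) (mulP (coord1 f) (coord0 g))) (coord1 h)))
    (subP (mulP (addP (mulP (coord0 f) (coord1 g)) (mulP (coord1 f) (coord0 g))) (coord0 h))
      (mulP (subP (mulP (coord0 f) (coord0 g)) (mulP (coord1 f) (coord1 g))) (coord1 h)))

section vectors

variable {f g h : Prog} {x : Data} {u v w : Plane}

lemma Halts.coord0 (hf : Halts f x (encodeVec u)) : Halts (coord0 f) x (Data.num (u 0)) :=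
  hf.compFst

lemma Halts.coord1 (hf : Halts f x (encodeVec u)) : Halts (coord1 f) x (Data.num (u 1)) :=
  hf.compSnd

lemma Halts.vsubP (hf : Halts f x (encodeVec u)) (hg : Halts g x (encodeVec v)) :
    Halts (vsubP f g) x (encodeVec (u - v)) :=
  (hf.coord0.subP hg.coord0).pair (hf.coord1.subP hg.coord1)

lemma Halts.vnegP (hf : Halts f x (encodeVec u)) : Halts (vnegP f) x (encodeVec (-u)) := by
  have := ((Halts.zeroP x).subP hf.coord0).pair ((Halts.zeroP x).subP hf.coord1)
  rwa [zero_sub, zero_sub] at this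

lemma Halts.rotP (hf : Halts f x (encodeVec u)) : Halts (rotP f) x (encodeVec (rot u)) := by
  have := ((Halts.zeroP x).subP hf.coord1).pair hf.coord0
  rwa [zero_sub] at this

lemma Halts.innerP (hf : Halts f x (encodeVec u)) (hg : Halts g x (encodeVec v)) :
    Halts (innerP f g) x (Data.num (inner ℝ u v)) := by
  rw [inner_eq]
  exact (hf.coord0.mulP hg.coord0).addP (hf.coord1.mulP hg.coord1)

lemma Halts.crossP (hf : Halts f x (encodeVec u)) (hg : Halts g x (encodeVec v)) :
    Halts (crossP f g) x (Data.num (cross u v)) :=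
  (hf.coord0.mulP hg.coord1).subP (hf.coord1.mulP hg.coord0)

lemma Halts.normP (hf : Halts f x (encodeVec u)) : Halts (normP f) x (Data.num ‖u‖) := by
  have := (hf.innerP hf).comp ⟨_, Runs.sqrt _ real_inner_self_nonneg⟩
  rwa [real_inner_self_eq_norm_sq, Real.sqrt_sq (norm_nonneg u)] at this

lemma Halts.tripleDirP (hf : Halts f x (encodeVec u)) (hg : Halts g x (encodeVec v))
    (hh : Halts h x (encodeVec w)) : Halts (tripleDirP f g h) x (encodeVec (tripleDir u v w)) :=
  (((((hf.coord0.mulP hg.coord0).subP (hf.coord1.mulP hg.coord1)).mulP hh.coord0).addP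
    (((hf.coord0.mulP hg.coord1).addP (hf.coord1.mulP hg.coord0)).mulP hh.coord1))).pair
  (((((hf.coord0.mulP hg.coord1).addP (hf.coord1.mulP hg.coord0)).mulP hh.coord0).subP
    (((hf.coord0.mulP hg.coord0).subP (hf.coord1.mulP hg.coord1)).mulP hh.coord1)))

end vectors

/-! ### Loops over lists of points -/

/-- One step of a loop over a list: the state `((e, x :: l), a)` is replaced by
`((e, l), B ((e, x), a))`. -/
def foldStep (B : Prog) : Prog :=
  Prog.pair
    (Prog.pair (Prog.comp Prog.fst Prog.fst) (Prog.comp Prog.snd (Prog.comp Prog.snd Prog.fst)))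
    (Prog.comp B (Prog.pair
      (Prog.pair (Prog.comp Prog.fst Prog.fst) (Prog.comp Prog.fst (Prog.comp Prog.snd Prog.fst)))
      Prog.snd))

/-- `foldP l B` maps `(e, a)` to the final value of the accumulator `a` after it has been replaced
by `B ((e, x), a)` for all points `x` in the list that `l` returns on `e`. -/
def foldP (l B : Prog) : Prog :=
  Prog.comp Prog.snd (Prog.comp (Prog.loop (Prog.comp Prog.snd Prog.fst) (foldStep B))
    (Prog.pair (Prog.pair Prog.fst (Prog.comp l Prog.fst)) Prog.snd))

/-- `I` is a loop invariant relating the points still to be visited to the accumulator. -/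
lemma Halts.foldLoop {B : Prog} {e : Data} {I : List Plane → ℝ → Prop}
    (hI : ∀ x l a, I (x :: l) a → ∃ b,
      Halts B (Data.pair (Data.pair e (encodeVec x)) (Data.num a)) (Data.num b) ∧ I l b) :
    ∀ l a, I l a → ∃ b, Halts (Prog.loop (Prog.comp Prog.snd Prog.fst) (foldStep B))
      (Data.pair (Data.pair e (encodePoints l)) (Data.num a))
      (Data.pair (Data.pair e Data.nil) (Data.num b)) ∧ I [] b := by
  intro l
  induction l with
  | nil => exact fun a ha => ⟨a, Halts.loop_nil (Halts.fst _ _).compSnd, ha⟩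
  | cons x l ih =>
    intro a ha
    obtain ⟨b, hb, hIb⟩ := hI x l a ha
    obtain ⟨c, hc, hIc⟩ := ih b hIb
    have h1 := Halts.fst (Data.pair e (encodePoints (x :: l))) (Data.num a)
    have h2 : Halts (Prog.comp Prog.snd Prog.fst)
        (Data.pair (Data.pair e (encodePoints (x :: l))) (Data.num a))
        (Data.pair (encodeVec x) (encodePoints l)) := h1.compSnd
    exact ⟨c, Halts.loop_pair h2 ((h1.compFst.pair h2.compSnd).pair
      (((h1.compFst.pair h2.compFst).pair (Halts.snd _ _)).comp hb)) hc, hIc⟩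

lemma Halts.foldP {g B : Prog} {e : Data} {I : List Plane → ℝ → Prop} {l : List Plane} {a : ℝ}
    (hg : Halts g e (encodePoints l))
    (hI : ∀ x l a, I (x :: l) a → ∃ b,
      Halts B (Data.pair (Data.pair e (encodeVec x)) (Data.num a)) (Data.num b) ∧ I l b)
    (ha : I l a) : ∃ b, Halts (foldP g B) (Data.pair e (Data.num a)) (Data.num b) ∧ I [] b := by
  obtain ⟨b, hb, hIb⟩ := Halts.foldLoop hI l a ha
  exact ⟨b, ((((Halts.fst _ _).pair ((Halts.fst _ _).comp hg)).pair (Halts.snd _ _)).comp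
    hb).compSnd, hIb⟩

/-- The largest inner product of the vector returned by `v` with a point of the list returned
by `g`. -/
def heightP (g v : Prog) : Prog :=
  Prog.comp
    (foldP g (maxP Prog.snd (innerP (Prog.comp Prog.snd Prog.fst)
      (Prog.comp v (Prog.comp Prog.fst Prog.fst)))))
    (Prog.pair Prog.id (innerP (Prog.comp Prog.fst g) v))

lemma Halts.heightP {g v : Prog} {e : Data} {L : List Plane} {N : Plane} (hL : L ≠ [])
    (hg : Halts g e (encodePoints L)) (hv : Halts v e (encodeVec N)) :
    Halts (heightP g v) e (Data.num (height L N)) := by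
  obtain ⟨y, L', rfl⟩ := List.exists_cons_of_ne_nil hL
  set L := y :: L' with hLdef
  have hy : Halts (Prog.comp Prog.fst g) e (encodeVec y) := hg.compFst
  obtain ⟨b, hb, -, hb1, hb2⟩ := Halts.foldP (a := inner ℝ y N)
    -- The accumulator is always attained on `L` and dominates every point already visited. It
    -- starts at the first point, so the list must be nonempty.
    (I := fun l a => l ⊆ L ∧ (∀ x ∈ L, x ∈ l ∨ inner ℝ x N ≤ a) ∧ ∃ x ∈ L, inner ℝ x N = a) hg
    (B := Billiard.maxP Prog.snd (Billiard.innerP (Prog.comp Prog.snd Prog.fst)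
      (Prog.comp v (Prog.comp Prog.fst Prog.fst))))
    (fun x l a ⟨hl, h1, h2⟩ => by
      refine ⟨_, (Halts.snd _ _).maxP ((Halts.fst _ _).compSnd.innerP
        ((Halts.fst _ _).compFst.comp hv)), fun z hz => hl (List.mem_cons_of_mem _ hz),
        fun z hz => ?_, ?_⟩
      · obtain h | h := h1 z hz
        · obtain rfl | h := List.mem_cons.1 h
          · exact Or.inr (le_max_right _ _)
          · exact Or.inl h
        · exact Or.inr (h.trans (le_max_left _ _))
      · obtain h | h := max_choice a (inner ℝ x N)
        · rw [h]
          exact h2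
        · rw [h]
          exact ⟨x, hl List.mem_cons_self, rfl⟩)
    ⟨List.Subset.refl _, fun x hx => Or.inl hx, y, List.mem_cons_self, rfl⟩
  have hgreat : IsGreatest ((fun x => inner ℝ x N) '' {x | x ∈ L}) b := by
    refine ⟨hb2, ?_⟩
    rintro _ ⟨x, hx, rfl⟩
    exact (hb1 x hx).resolve_left List.not_mem_nil
  rw [height, hgreat.csSup_eq]
  exact ((Halts.id e).pair (hy.innerP hv)).comp hb

/-- The number `widthValue`. -/
def widthP (g v : Prog) : Prog :=
  divP (mulP (addP Prog.one Prog.one) (addP (heightP g (rotP v)) (heightP g (vnegP (rotP v)))))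
    (normP v)

lemma Halts.widthP {g v : Prog} {e : Data} {L : List Plane} {E : Plane} (hL : L ≠ [])
    (hg : Halts g e (encodePoints L)) (hv : Halts v e (encodeVec E)) (hE : E ≠ 0) :
    Halts (widthP g v) e (Data.num (widthValue L E)) := by
  have := ((((Halts.one e).addP (Halts.one e)).mulP ((Halts.heightP hL hg hv.rotP).addP
    (Halts.heightP hL hg hv.rotP.vnegP))).divP hv.normP (norm_ne_zero_iff.2 hE))
  rwa [one_add_one_eq_two] at this

/-- The number `triangleValue`. -/
def triangleP (g u v w : Prog) : Prog :=
  divP (addP (addP (heightP g (vsubP u v)) (heightP g (vsubP v w))) (heightP g (vsubP w u)))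
    (normP u)

lemma Halts.triangleP {g f₁ f₂ f₃ : Prog} {e : Data} {L : List Plane} {u v w : Plane}
    (hL : L ≠ []) (hg : Halts g e (encodePoints L)) (hu : Halts f₁ e (encodeVec u))
    (hv : Halts f₂ e (encodeVec v)) (hw : Halts f₃ e (encodeVec w)) (hu0 : u ≠ 0) :
    Halts (triangleP g f₁ f₂ f₃) e (Data.num (triangleValue L u v w)) :=
  (((Halts.heightP hL hg (hu.vsubP hv)).addP (Halts.heightP hL hg (hv.vsubP hw))).addP
    (Halts.heightP hL hg (hw.vsubP hu))).divP hu.normP (norm_ne_zero_iff.2 hu0)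

/-! ### Searching for the minimum -/

/-- In the environment `e`, the program `B` decreases every accumulator that is at least `m`, but
not below `m`. -/
def Sound (m : ℝ) (B : Prog) (e : Data) : Prop :=
  ∀ a, m ≤ a → ∃ b, m ≤ b ∧ b ≤ a ∧ Halts B (Data.pair e (Data.num a)) (Data.num b)

/-- In the environment `e`, the program `B` replaces every accumulator that is at least `m`
by `m`. -/
def Hits (m : ℝ) (B : Prog) (e : Data) : Prop :=
  ∀ a, m ≤ a → Halts B (Data.pair e (Data.num a)) (Data.num m)

lemma Sound.foldP {m : ℝ} {g B : Prog} {e : Data} {L : List Plane}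
    (hg : Halts g e (encodePoints L))
    (hB : ∀ x ∈ L, Sound m B (Data.pair e (encodeVec x))) : Sound m (foldP g B) e := by
  intro a ha
  obtain ⟨b, hb, -, h1, h2⟩ := Halts.foldP (I := fun l b => l ⊆ L ∧ m ≤ b ∧ b ≤ a) hg
    (fun x l c ⟨hl, h1, h2⟩ => by
      obtain ⟨b, hb1, hb2, hb⟩ := hB x (hl List.mem_cons_self) c h1
      exact ⟨b, hb, fun z hz => hl (List.mem_cons_of_mem _ hz), hb1, hb2.trans h2⟩)
    ⟨List.Subset.refl _, ha, le_rfl⟩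
  exact ⟨b, h1, h2, hb⟩

lemma Hits.foldP {m : ℝ} {g B : Prog} {e : Data} {L : List Plane}
    (hg : Halts g e (encodePoints L))
    (hB : ∀ x ∈ L, Sound m B (Data.pair e (encodeVec x)))
    (hB' : ∃ x ∈ L, Hits m B (Data.pair e (encodeVec x))) : Hits m (foldP g B) e := by
  intro a ha
  obtain ⟨y, hy, hyB⟩ := hB'
  obtain ⟨b, hb, -, h1, h2⟩ := Halts.foldP
    -- Either the decisive point `y` is still ahead or the value `m` has been reached; soundness of
    -- the other steps then keeps it at `m`.
    (I := fun l b => l ⊆ L ∧ m ≤ b ∧ (y ∈ l ∨ b = m)) hg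
    (fun x l c ⟨hl, h1, h2⟩ => by
      obtain rfl | hne := eq_or_ne y x
      · exact ⟨m, hyB c h1, fun z hz => hl (List.mem_cons_of_mem _ hz), le_rfl, Or.inr rfl⟩
      · obtain ⟨b, hb1, hb2, hb⟩ := hB x (hl List.mem_cons_self) c h1
        refine ⟨b, hb, fun z hz => hl (List.mem_cons_of_mem _ hz), hb1, ?_⟩
        obtain h | h := h2
        · exact Or.inl ((List.mem_cons.1 h).resolve_left hne)
        · exact Or.inr (le_antisymm (hb2.trans h.le) hb1))
    ⟨List.Subset.refl _, ha, Or.inl hy⟩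
  rwa [h2.resolve_left List.not_mem_nil] at hb

/-- Update the accumulator by the width orthogonal to the difference of the two last points. -/
def widthStep (g : Prog) : Prog :=
  let E := vsubP (Prog.comp Prog.snd (Prog.comp Prog.fst Prog.fst)) (Prog.comp Prog.snd Prog.fst)
  -- Pairs with `E = 0` are skipped, since the width divides by the norm of `E`.
  Prog.ifLe (innerP E E) zeroP Prog.snd
    (minP Prog.snd (widthP (Prog.comp g (Prog.comp Prog.fst (Prog.comp Prog.fst Prog.fst))) E))

lemma halts_widthStep {g : Prog} {e : Data} {L : List Plane} (hL : L ≠ [])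
    (hg : Halts g e (encodePoints L)) (x y : Plane) (a : ℝ) :
    Halts (widthStep g) (Data.pair (Data.pair (Data.pair e (encodeVec x)) (encodeVec y))
      (Data.num a)) (if inner ℝ (x - y) (x - y) ≤ (0 : ℝ) then Data.num a else
        Data.num (min a (widthValue L (x - y)))) := by
  have h1 := Halts.fst (Data.pair (Data.pair e (encodeVec x)) (encodeVec y)) (Data.num a)
  have hE := h1.compFst.compSnd.vsubP h1.compSnd
  refine Halts.ifLe (hE.innerP hE) (Halts.zeroP _) (fun _ => Halts.snd _ _) fun h => ?_
  exact (Halts.snd _ _).minP (Halts.widthP hL (h1.compFst.compFst.comp hg) hE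
    (real_inner_self_pos.1 h))

/-- Update the accumulator by the length of the triangle determined by three edge directions. -/
def triangleStep (g : Prog) : Prog :=
  let p0 := Prog.fst
  let p1 := Prog.comp Prog.fst p0
  let p2 := Prog.comp Prog.fst p1
  let p3 := Prog.comp Prog.fst p2
  let p4 := Prog.comp Prog.fst p3
  let p5 := Prog.comp Prog.fst p4
  let E₁ := vsubP (Prog.comp Prog.snd p5) (Prog.comp Prog.snd p4)
  let E₂ := vsubP (Prog.comp Prog.snd p3) (Prog.comp Prog.snd p2)
  let E₃ := vsubP (Prog.comp Prog.snd p1) (Prog.comp Prog.snd p0)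
  let u := tripleDirP E₁ E₃ E₂
  let v := tripleDirP E₂ E₁ E₃
  let w := tripleDirP E₃ E₂ E₁
  -- The two tests decide `Surrounds`, without which the value need not be an upper bound. The first
  -- also ensures `u ≠ 0` for the division.
  Prog.ifLe (mulP (crossP u v) (crossP v w)) zeroP Prog.snd
    (Prog.ifLe (mulP (crossP v w) (crossP w u)) zeroP Prog.snd
      (minP Prog.snd (triangleP (Prog.comp g (Prog.comp Prog.fst p5)) u v w)))

lemma halts_triangleStep {g : Prog} {e : Data} {L : List Plane} (hL : L ≠ [])
    (hg : Halts g e (encodePoints L)) (x y x' y' x'' y'' : Plane) (a : ℝ) :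
    let u := tripleDir (x - y) (x'' - y'') (x' - y')
    let v := tripleDir (x' - y') (x - y) (x'' - y'')
    let w := tripleDir (x'' - y'') (x' - y') (x - y)
    Halts (triangleStep g) (Data.pair (Data.pair (Data.pair (Data.pair (Data.pair (Data.pair
      (Data.pair e (encodeVec x)) (encodeVec y)) (encodeVec x')) (encodeVec y')) (encodeVec x''))
      (encodeVec y'')) (Data.num a))
      (if cross u v * cross v w ≤ 0 then Data.num a else
        if cross v w * cross w u ≤ 0 then Data.num a else
          Data.num (min a (triangleValue L u v w))) := by
  intro u v w
  have h0 := Halts.fst (Data.pair (Data.pair (Data.pair (Data.pair (Data.pair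
    (Data.pair e (encodeVec x)) (encodeVec y)) (encodeVec x')) (encodeVec y')) (encodeVec x''))
    (encodeVec y'')) (Data.num a)
  have h1 := h0.compFst
  have h2 := h1.compFst
  have h3 := h2.compFst
  have h4 := h3.compFst
  have h5 := h4.compFst
  have E₁ := h5.compSnd.vsubP h4.compSnd
  have E₂ := h3.compSnd.vsubP h2.compSnd
  have E₃ := h1.compSnd.vsubP h0.compSnd
  have hu := E₁.tripleDirP E₃ E₂
  have hv := E₂.tripleDirP E₁ E₃
  have hw := E₃.tripleDirP E₂ E₁
  refine Halts.ifLe ((hu.crossP hv).mulP (hv.crossP hw)) (Halts.zeroP _)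
    (fun _ => Halts.snd _ _) fun h => Halts.ifLe ((hv.crossP hw).mulP (hw.crossP hu))
    (Halts.zeroP _) (fun _ => Halts.snd _ _) fun _ => ?_
  refine (Halts.snd _ _).minP (Halts.triangleP hL (h5.compFst.comp hg) hu hv hw fun hu0 => ?_)
  rw [hu0] at h
  simp [cross] at h

lemma sound_widthStep {g : Prog} {e : Data} {L : List Plane} (hL : L ≠ [])
    (hS : IsTable (convexHull ℝ {x | x ∈ L})) (hg : Halts g e (encodePoints L)) (x y : Plane) :
    Sound (minLength (convexHull ℝ {x | x ∈ L})) (widthStep g)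
      (Data.pair (Data.pair e (encodeVec x)) (encodeVec y)) := by
  intro a ha
  have h := halts_widthStep hL hg x y a
  split_ifs at h with h0
  · exact ⟨a, ha, le_rfl, h⟩
  · exact ⟨_, le_min ha (minLength_le_widthValue hS (real_inner_self_pos.1 (not_le.1 h0))),
      min_le_left _ _, h⟩

lemma hits_widthStep {g : Prog} {e : Data} {L : List Plane} (hL : L ≠ [])
    (hg : Halts g e (encodePoints L)) {x y : Plane} (hxy : x - y ≠ 0) {m : ℝ}
    (hm : widthValue L (x - y) = m) :
    Hits m (widthStep g) (Data.pair (Data.pair e (encodeVec x)) (encodeVec y)) := by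
  intro a ha
  have h := halts_widthStep hL hg x y a
  rwa [if_neg (not_le.2 (real_inner_self_pos.2 hxy)), hm, min_eq_right ha] at h

lemma sound_triangleStep {g : Prog} {e : Data} {L : List Plane} (hL : L ≠ [])
    (hS : IsTable (convexHull ℝ {x | x ∈ L})) (hg : Halts g e (encodePoints L))
    (x y x' y' x'' y'' : Plane) :
    Sound (minLength (convexHull ℝ {x | x ∈ L})) (triangleStep g)
      (Data.pair (Data.pair (Data.pair (Data.pair (Data.pair (Data.pair e (encodeVec x))
        (encodeVec y)) (encodeVec x')) (encodeVec y')) (encodeVec x'')) (encodeVec y'')) := by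
  intro a ha
  have h := halts_triangleStep hL hg x y x' y' x'' y'' a
  dsimp only at h
  split_ifs at h with h0 h1
  · exact ⟨a, ha, le_rfl, h⟩
  · exact ⟨a, ha, le_rfl, h⟩
  · refine ⟨_, le_min ha (minLength_le_triangleValue hS ?_ ?_ ⟨not_le.1 h0, not_le.1 h1⟩),
      min_le_left _ _, h⟩
    · simp only [norm_tripleDir]
      ring
    · simp only [norm_tripleDir]
      ring

lemma hits_triangleStep {g : Prog} {e : Data} {L : List Plane} (hL : L ≠ [])
    (hg : Halts g e (encodePoints L)) {x y x' y' x'' y'' : Plane} {m : ℝ}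
    (hs : Surrounds (tripleDir (x - y) (x'' - y'') (x' - y'))
      (tripleDir (x' - y') (x - y) (x'' - y'')) (tripleDir (x'' - y'') (x' - y') (x - y)))
    (hm : triangleValue L (tripleDir (x - y) (x'' - y'') (x' - y'))
      (tripleDir (x' - y') (x - y) (x'' - y'')) (tripleDir (x'' - y'') (x' - y') (x - y)) = m) :
    Hits m (triangleStep g)
      (Data.pair (Data.pair (Data.pair (Data.pair (Data.pair (Data.pair e (encodeVec x))
        (encodeVec y)) (encodeVec x')) (encodeVec y')) (encodeVec x'')) (encodeVec y'')) := by
  intro a ha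
  have h := halts_triangleStep hL hg x y x' y' x'' y'' a
  dsimp only at h
  rwa [if_neg (not_le.2 hs.1), if_neg (not_le.2 hs.2), hm, min_eq_right ha] at h

/-- Loop over all pairs of points. -/
def fold₂ (g B : Prog) : Prog := foldP g (foldP (Prog.comp g Prog.fst) B)

lemma Sound.fold₂ {m : ℝ} {g B : Prog} {e : Data} {L : List Plane}
    (hg : Halts g e (encodePoints L))
    (hB : ∀ x ∈ L, ∀ y ∈ L, Sound m B (Data.pair (Data.pair e (encodeVec x)) (encodeVec y))) :
    Sound m (fold₂ g B) e :=
  Sound.foldP hg fun x hx => Sound.foldP ((Halts.fst _ _).comp hg) fun y hy => hB x hx y hy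

lemma Hits.fold₂ {m : ℝ} {g B : Prog} {e : Data} {L : List Plane}
    (hg : Halts g e (encodePoints L))
    (hB : ∀ x ∈ L, ∀ y ∈ L, Sound m B (Data.pair (Data.pair e (encodeVec x)) (encodeVec y)))
    (hB' : ∃ x ∈ L, ∃ y ∈ L, Hits m B (Data.pair (Data.pair e (encodeVec x)) (encodeVec y))) :
    Hits m (fold₂ g B) e := by
  obtain ⟨x, hx, y, hy, h⟩ := hB'
  exact Hits.foldP hg
    (fun x hx => Sound.foldP ((Halts.fst _ _).comp hg) fun y hy => hB x hx y hy)
    ⟨x, hx, Hits.foldP ((Halts.fst _ _).comp hg) (fun y hy => hB x hx y hy) ⟨y, hy, h⟩⟩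

/-- Access to the list after two points have been added to the environment. -/
def skip₂ (g : Prog) : Prog := Prog.comp g (Prog.comp Prog.fst Prog.fst)

lemma Halts.skip₂ {g : Prog} {e d d' z : Data} (hg : Halts g e z) :
    Halts (skip₂ g) (Data.pair (Data.pair e d) d') z :=
  (Halts.fst _ _).compFst.comp hg

/-- The width of the polygon in direction of the first coordinate, as a first upper bound. -/
def initP : Prog := widthP Prog.snd (Prog.pair zeroP Prog.one)

/-- Loop over all differences of two vertices. -/
def widthLoop : Prog := fold₂ Prog.snd (widthStep Prog.snd)

/-- Loop over all triples of differences of two vertices. -/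
def triangleLoop : Prog :=
  fold₂ Prog.snd (fold₂ (skip₂ Prog.snd) (fold₂ (skip₂ (skip₂ Prog.snd)) (triangleStep Prog.snd)))

/-- The algorithm: it maps `(ε, L)` to `(1 + ε) * minLength S` for the convex hull `S` of `L`. -/
def lengthP : Prog :=
  mulP (addP Prog.one Prog.fst)
    (Prog.comp triangleLoop (Prog.pair Prog.id (Prog.comp widthLoop (Prog.pair Prog.id initP))))

theorem halts_lengthP {L : List Plane} (hS : IsTable (convexHull ℝ {x | x ∈ L})) (ε : ℝ) :
    Halts lengthP (encodeInput ε L)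
      (Data.num ((1 + ε) * minLength (convexHull ℝ {x | x ∈ L}))) := by
  have hL : L ≠ [] := by
    rintro rfl
    obtain ⟨x, hx⟩ := hS.interior_nonempty
    simpa using interior_subset hx
  have hg : Halts Prog.snd (encodeInput ε L) (encodePoints L) := Halts.snd _ _
  set m := minLength (convexHull ℝ {x | x ∈ L}) with hm
  let E : Plane := !₂[0, 1]
  have hE : E ≠ 0 := fun h => one_ne_zero (congrArg (fun v : Plane => v 1) h : (1 : ℝ) = 0)
  have h0 : Halts initP (encodeInput ε L) (Data.num (widthValue L E)) :=
    Halts.widthP hL hg ((Halts.zeroP _).pair (Halts.one _)) hE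
  have hm0 : m ≤ widthValue L E := minLength_le_widthValue hS hE
  have hw : Sound m widthLoop (encodeInput ε L) :=
    Sound.fold₂ hg fun x _ y _ => sound_widthStep hL hS hg x y
  have ht2 : ∀ x y x' y' : Plane, Sound m (fold₂ (skip₂ (skip₂ Prog.snd)) (triangleStep Prog.snd))
      (Data.pair (Data.pair (Data.pair (Data.pair (encodeInput ε L) (encodeVec x)) (encodeVec y))
        (encodeVec x')) (encodeVec y')) := fun x y x' y' =>
    Sound.fold₂ hg.skip₂.skip₂ fun x'' _ y'' _ => sound_triangleStep hL hS hg x y x' y' x'' y''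
  have ht1 : ∀ x y : Plane, Sound m
      (fold₂ (skip₂ Prog.snd) (fold₂ (skip₂ (skip₂ Prog.snd)) (triangleStep Prog.snd)))
      (Data.pair (Data.pair (encodeInput ε L) (encodeVec x)) (encodeVec y)) := fun x y =>
    Sound.fold₂ hg.skip₂ fun x' _ y' _ => ht2 x y x' y'
  have ht : Sound m triangleLoop (encodeInput ε L) :=
    Sound.fold₂ hg fun x _ y _ => ht1 x y
  have key : Halts (Prog.comp triangleLoop (Prog.pair Prog.id (Prog.comp widthLoop
      (Prog.pair Prog.id initP)))) (encodeInput ε L) (Data.num m) := by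
    -- One of the two loops attains `m`; the other, being sound, never takes the accumulator below
    -- `m`, so their order does not matter.
    obtain ⟨x, hx, y, hy, hxy, hv⟩ | ⟨x, hx, y, hy, x', hx', y', hy', x'', hx'', y'', hy'', hs, hv⟩ :=
      exists_value_eq_minLength hS
    · have h1 : Hits m widthLoop (encodeInput ε L) :=
        Hits.fold₂ hg (fun x _ y _ => sound_widthStep hL hS hg x y)
          ⟨x, hx, y, hy, hits_widthStep hL hg hxy hv⟩
      obtain ⟨b, hb1, hb2, hb⟩ := ht m le_rfl
      rw [le_antisymm hb2 hb1] at hb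
      exact ((Halts.id _).pair (((Halts.id _).pair h0).comp (h1 _ hm0))).comp hb
    · have h1 : Hits m triangleLoop (encodeInput ε L) :=
        Hits.fold₂ hg (fun x _ y _ => ht1 x y) ⟨x, hx, y, hy,
          Hits.fold₂ hg.skip₂ (fun x' _ y' _ => ht2 x y x' y') ⟨x', hx', y', hy',
            Hits.fold₂ hg.skip₂.skip₂
              (fun x'' _ y'' _ => sound_triangleStep hL hS hg x y x' y' x'' y'')
              ⟨x'', hx'', y'', hy'', hits_triangleStep hL hg hs hv⟩⟩⟩
      obtain ⟨b, hb1, hb2, hb⟩ := hw _ hm0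
      exact ((Halts.id _).pair (((Halts.id _).pair h0).comp hb)).comp (h1 b hb1)
  exact ((Halts.one _).addP (Halts.fst _ _)).mulP key

end Billiard

theorem mainTheorem6 :
    -- one program serves all tables, all accuracies and all approximating polygons
    ∃ P : Prog, ∀ T : Set Plane, IsTable T →
      -- the minimum that defines `ℓ(T)` is attained
      IsLeast (orbitLength '' closedOrbits T) (minLength T) ∧
      -- approximating polygons exist
      (∀ p ∈ interior T, ∀ ε : ℝ, 0 < ε → ∃ S : Set Plane, IsApprox p ε S T) ∧
      -- for each of them, `ℓ_ε(T) = (1 + ε) ℓ(S)` satisfies the estimate and is computed by `P`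
      (∀ (p : Plane) (ε : ℝ) (S : Set Plane), 0 < ε → IsApprox p ε S T →
        minLength T ≤ (1 + ε) * minLength S ∧
        (1 + ε) * minLength S ≤ (1 + ε) * minLength T ∧
        ∀ L : List Plane, S = convexHull ℝ {v | v ∈ L} →
          ∃ t : ℕ, Runs P (encodeInput ε L) (Data.num ((1 + ε) * minLength S)) t) ∧
      -- shortest orbits of approximating polygons subconverge, and limits are shortest orbits
      (∀ (p : ℕ → Plane) (ε : ℕ → ℝ) (S : ℕ → Set Plane) (c : ℕ → ℤ → Plane),
        (∀ n, 0 < ε n) → Tendsto ε atTop (𝓝 0) → (∀ n, IsApprox (p n) (ε n) (S n) T) →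
        (∀ n, c n ∈ shortestOrbits (S n)) →
        (∃ φ : ℕ → ℕ, StrictMono φ ∧
          ∃ c' ∈ shortestOrbits T, TracesConvergeTo (fun n => c (φ n)) (trace c')) ∧
        (∀ K : Set Plane, IsCompact K → TracesConvergeTo c K →
          ∃ c' ∈ shortestOrbits T, trace c' = K)) ∧
      -- every shortest orbit arises as such a limit
      (∀ c' ∈ shortestOrbits T, ∀ p ∈ interior T, ∀ ε : ℕ → ℝ,
        (∀ n, 0 < ε n) → Tendsto ε atTop (𝓝 0) →
        ∃ (S : ℕ → Set Plane) (c : ℕ → ℤ → Plane),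
          (∀ n, IsApprox p (ε n) (S n) T) ∧ (∀ n, c n ∈ shortestOrbits (S n)) ∧
          TracesConvergeTo c (trace c')) := by
  refine ⟨lengthP, fun T hT => ⟨?_, fun p hp ε hε => exists_isApprox hT hp hε,
    fun p ε S hε hS => ⟨minLength_le_of_isApprox hT hε hS, ?_, ?_⟩, ?_,
    fun c' hc' p hp ε hε hε0 => exists_approximating_orbits hT hc' hp hε hε0⟩⟩
  · obtain ⟨p, hp⟩ := exists_isShortestCaged hT.isCompact
    rw [(minLength_eq hT hp).2]
    exact (minLength_eq hT hp).1
  · exact mul_le_mul_of_nonneg_left (minLength_mono hS.polygonal.isTable hT hS.subset)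
      (by positivity)
  · rintro L rfl
    exact halts_lengthP hS.polygonal.isTable ε
  · exact fun p ε S c hε hε0 hS hc => ⟨exists_subseq_tracesConvergeTo hT hε hε0 hS hc,
      fun K hK hcK => exists_trace_eq_of_tracesConvergeTo hT hε hε0 hS hc hK hcK⟩
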